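/- **Setting.** A tabular vector-valued MDP (VMDP) has a finite nonempty state space $\mathcal S$ with $|\mathcal S|\le S$, a finite nonempty action space $\mathcal A$ with $|\mathcal A|\le A$, a horizon $H$, a fixed initial state $s_1$, unknown transition probabilities $\mathbb P_h(\cdot\mid s,a)$ and unknown return functions $\mathbf r_h(s,a)\in\mathbb R^d$, $h\in[H]$, $d\ge 1$. In an episode the agent starts in $s_1$; at each step $h\in[H]$ it observes $s_h$, takes an action $a_h$, observes a random sample of the return vector that lies almost surely in the Euclidean unit ball and has mean $\mathbf r_h(s_h,a_h)$, and the environment moves to $s_{h+1}\sim\mathbb P_h(\cdot\mid s_h,a_h)$. In a CMDP the agent moreover observes at each step a random sample in $[-1,1]$ of the cost, with mean $c_h(s_h,a_h)$ (deterministic costs are a special case). A Markov policy is a family $\pi_h:\mathcal S\to\Delta(\mathcal A)$, $h\in[H]$; a policy is a probability distribution over Markov policies, one of which is drawn at the start of the episode. For a policy $\pi$ put $\mathbf V^\pi=\mathbb E_\pi\big[\sum_{h=1}^H\mathbf r_h(s_h,a_h)\big]$ and $C^\pi=\mathbb E_\pi\big[\sum_{h=1}^H c_h(s_h,a_h)\big]$,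 both from $s_1$. Let $\mathrm{dist}$ be the Euclidean distance to a set. An algorithm receives $\mathcal C$, $\varepsilon$, $\delta$ (and knows $\mathcal S,\mathcal A,H,d$, but not the environment), chooses the policy of every episode from the data of the earlier episodes, and after $m(\varepsilon,\delta)$ episodes outputs a policy $\pi^{\mathrm{out}}$. * $m_{\mathrm{APP}}$ is the sample complexity of an *approachability algorithm* if for all $\varepsilon,\delta>0$, every nonempty convex $\mathcal C\subseteq\mathbb R^d$ and every VMDP, after $m_{\mathrm{APP}}(\varepsilon,\delta)$ episodes, with probability at least $1-\delta$, $\mathrm{dist}(\mathbf V^{\pi^{\mathrm{out}}},\mathcal C)\le\min_\pi\mathrm{dist}(\mathbf V^{\pi},\mathcal C)+\varepsilon$. * $m_{\mathrm{CMDP}}$ is the sample complexity of a *CMDP algorithm* if for all $\varepsilon,\delta>0$, every convex $\mathcal C\subseteq\mathbb R^d$ and every CMDP in which some policy satisfies $\mathbf V^\pi\in\mathcal C$, after $m_{\mathrm{CMDP}}(\varepsilon,\delta)$ episodes, with probability at least $1-\delta$, both $C^{\pi^{\mathrm{out}}}-\inf_{\pi:\mathbf V^\pi\in\mathcal C}C^\pi\le\varepsilon$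 and $\mathrm{dist}(\mathbf V^{\pi^{\mathrm{out}}},\mathcal C)\le\varepsilon$. **Statement.** There is an absolute constant $c>0$ such that for all $\mathcal S,\mathcal A,S,A,H$ and all $d\ge1$ there exist an approachability algorithm and a CMDP algorithm whose sample complexities satisfy, for all $\varepsilon\in(0,H]$ and $\delta\in(0,1]$, with $\iota=\log\frac{dSAH}{\varepsilon\delta}$, $$m_{\mathrm{APP}}(\varepsilon,\delta)\le c\Big(\frac{\min\{d,S\}H^4SA\,\iota}{\varepsilon^2}+\frac{H^3S^2A\,\iota^2}{\varepsilon}\Big),\qquad m_{\mathrm{CMDP}}(\varepsilon,\delta)\le c\Big(\frac{\min\{d,S\}H^4SA\,\iota^2}{\varepsilon^2}+\frac{H^3S^2A\,\iota^3}{\varepsilon}\Big).$$ -/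

import Mathlib

open MeasureTheory ProbabilityTheory

noncomputable section

namespace ConstrainedRL

/-- `ℝ^d` with the Euclidean norm. -/
abbrev Vec (d : ℕ) : Type := EuclideanSpace ℝ (Fin d)

/-- A (Markov, randomized, step-dependent) policy: `π h s` is the distribution on actions that is
used at step `h` in state `s`. -/
abbrev Policy (S A : Type*) [Fintype A] (H : ℕ) : Type _ := Fin H → S → stdSimplex ℝ A

/-- The data of one episode: at every step, the state, the action, and the sample observed. -/
abbrev Traj (S A O : Type*) (H : ℕ) : Type _ := Fin H → S × A × O

section Episode

variable {S A O : Type*} [MeasurableSpace S] [MeasurableSpace A] [MeasurableSpace O]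

lemma measurable_traj_cons (n : ℕ) (s : S) (a : A) :
    Measurable fun p : O × Traj S A O n => (Fin.cons (s, a, p.1) p.2 : Traj S A O (n + 1)) := by
  refine measurable_pi_lambda _ fun i => ?_
  refine Fin.cases ?_ (fun j => ?_) i
  · simp only [Fin.cons_zero]; fun_prop
  · simp only [Fin.cons_succ]; fun_prop

lemma measurable_run_snoc (H k : ℕ) :
    Measurable fun p : (Fin k → Traj S A O H) × Traj S A O H =>
      (Fin.snoc p.1 p.2 : Fin (k + 1) → Traj S A O H) := by
  refine measurable_pi_lambda _ fun i => ?_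
  refine Fin.lastCases ?_ (fun j => ?_) i
  · simp only [Fin.snoc_last]; fun_prop
  · simp only [Fin.snoc_castSucc]; fun_prop

variable [Fintype A]

/-- The law of an episode of `n` steps that starts in state `s`: draw `a ∼ π 0 s`, draw a pair
(observed sample, next state) from `step 0 s a`, and go on from the next state with the
remaining steps. -/
def trajLaw : (n : ℕ) → (Fin n → S → A → Measure (O × S)) → Policy S A n → S →
    Measure (Traj S A O n)
  | 0, _, _, _ => Measure.dirac Fin.elim0
  | n + 1, step, π, s =>
      ∑ a : A, ENNReal.ofReal (π 0 s a) •
        (step 0 s a).bind fun x =>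
          (trajLaw n (Fin.tail step) (Fin.tail π) x.2).map fun τ =>
            (Fin.cons (s, a, x.1) τ : Traj S A O (n + 1))

variable [Fintype S] [DiscreteMeasurableSpace S]

lemma trajLaw_aux (n : ℕ) (step : Fin n → S → A → Measure (O × S))
    (hstep : ∀ h s a, IsProbabilityMeasure (step h s a)) :
    (∀ π s, IsProbabilityMeasure (trajLaw n step π s)) ∧
      ∀ s, Measurable fun π : Policy S A n => trajLaw n step π s := by
  induction n with
  | zero =>
    exact ⟨fun π s => by simp only [trajLaw]; infer_instance, fun s => measurable_const⟩
  | succ n ih =>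
    obtain ⟨ihP, ihM⟩ := ih (Fin.tail step) (fun h s a => hstep h.succ s a)
    have hjoint : Measurable fun p : Policy S A n × S => trajLaw n (Fin.tail step) p.1 p.2 :=
      measurable_from_prod_countable_left ihM
    let κ : Kernel (Policy S A n × S) (Traj S A O n) := ⟨_, hjoint⟩
    have hκ : IsMarkovKernel κ := ⟨fun p => ihP p.1 p.2⟩
    have hmeas : ∀ (s : S) (a : A), Measurable fun p : Policy S A n × (O × S) =>
        (trajLaw n (Fin.tail step) p.1 p.2.2).map fun τ =>
            (Fin.cons (s, a, p.2.1) τ : Traj S A O (n + 1)) := by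
      intro s a
      refine Measure.measurable_of_measurable_coe _ fun B hB => ?_
      have hc := measurable_traj_cons (O := O) n s a
      have h1 : ∀ p : Policy S A n × (O × S),
          ((trajLaw n (Fin.tail step) p.1 p.2.2).map fun τ =>
            (Fin.cons (s, a, p.2.1) τ : Traj S A O (n + 1))) B =
          (κ.comap (fun p : Policy S A n × (O × S) => (p.1, p.2.2)) (by fun_prop)) p
            (Prod.mk p ⁻¹' {q : (Policy S A n × (O × S)) × Traj S A O n |
              (Fin.cons (s, a, q.1.2.1) q.2 : Traj S A O (n + 1)) ∈ B}) := by
        intro p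
        rw [Measure.map_apply (show Measurable fun τ : Traj S A O n =>
          (Fin.cons (s, a, p.2.1) τ : Traj S A O (n + 1)) from
          hc.comp (by fun_prop : Measurable fun τ => (p.2.1, τ))) hB]
        rfl
      simp_rw [h1]
      refine Kernel.measurable_kernel_prodMk_left ?_
      exact (hc.comp (by fun_prop : Measurable
        fun q : (Policy S A n × (O × S)) × Traj S A O n => (q.1.2.1, q.2))) hB
    have hmeas' : ∀ (π : Policy S A n) (s : S) (a : A), Measurable fun x : O × S =>
        (trajLaw n (Fin.tail step) π x.2).map fun τ =>
            (Fin.cons (s, a, x.1) τ : Traj S A O (n + 1)) := fun π s a =>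
      (hmeas s a).comp (by fun_prop : Measurable fun x : O × S => (π, x))
    have htail : Measurable fun π : Policy S A (n + 1) => (Fin.tail π : Policy S A n) :=
      measurable_pi_lambda _ fun i => measurable_pi_apply _
    refine ⟨fun π s => ⟨?_⟩, fun s => ?_⟩
    · simp only [trajLaw, Measure.coe_finsetSum, Finset.sum_apply, Measure.smul_apply,
        smul_eq_mul]
      have h1 : ∀ a : A, ((step 0 s a).bind fun x =>
          (trajLaw n (Fin.tail step) (Fin.tail π) x.2).map fun τ =>
            (Fin.cons (s, a, x.1) τ : Traj S A O (n + 1))) Set.univ = 1 := by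
        intro a
        have := hstep 0 s a
        rw [Measure.bind_apply MeasurableSet.univ (hmeas' _ s a).aemeasurable]
        have h2 : ∀ x : O × S, ((trajLaw n (Fin.tail step) (Fin.tail π) x.2).map fun τ =>
            (Fin.cons (s, a, x.1) τ : Traj S A O (n + 1))) Set.univ = 1 := by
          intro x
          have := ihP (Fin.tail π) x.2
          rw [Measure.map_apply (show Measurable fun τ : Traj S A O n =>
            (Fin.cons (s, a, x.1) τ : Traj S A O (n + 1)) from
            (measurable_traj_cons (O := O) n s a).comp
            (by fun_prop : Measurable fun τ => (x.1, τ))) MeasurableSet.univ]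
          simp
        simp [h2]
      simp only [h1, mul_one]
      have h4 : ∑ a, π 0 s a = 1 := (π 0 s).2.2
      have h5 : ∀ a ∈ (Finset.univ : Finset A), 0 ≤ π 0 s a := fun a _ => (π 0 s).2.1 a
      rw [← ENNReal.ofReal_sum_of_nonneg h5, h4, ENNReal.ofReal_one]
    · refine Measure.measurable_of_measurable_coe _ fun B hB => ?_
      simp only [trajLaw, Measure.coe_finsetSum, Finset.sum_apply, Measure.smul_apply,
        smul_eq_mul]
      refine Finset.measurable_sum _ fun a _ => Measurable.mul ?_ ?_
      · refine ENNReal.measurable_ofReal.comp ?_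
        exact (measurable_pi_apply a).comp (measurable_subtype_coe.comp
          ((measurable_pi_apply s).comp (measurable_pi_apply 0)))
      · have := hstep 0 s a
        simp_rw [Measure.bind_apply hB (hmeas' _ s a).aemeasurable]
        have h3 : Measurable fun p : Policy S A (n + 1) × (O × S) =>
            ((trajLaw n (Fin.tail step) (Fin.tail p.1) p.2.2).map fun τ =>
              (Fin.cons (s, a, p.2.1) τ : Traj S A O (n + 1))) B :=
          (Measure.measurable_coe hB).comp ((hmeas s a).comp
            ((htail.comp measurable_fst).prodMk measurable_snd))
        exact h3.lintegral_prod_right'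

end Episode

/-- An episodic environment with states `S`, actions `A` and horizon `H`. In state `s` at step `h`
action `a` produces, with joint law `step h s a`, the sample `o : O` that the agent observes and
the next state. -/
structure Env (S A O : Type*) [MeasurableSpace S] [MeasurableSpace O] (H : ℕ) where
  init : S
  step : Fin H → S → A → Measure (O × S)
  isProb : ∀ h s a, IsProbabilityMeasure (step h s a)

section Interaction

variable {S A O : Type*} [Fintype S] [Fintype A] [MeasurableSpace S] [DiscreteMeasurableSpace S]
  [MeasurableSpace A] [MeasurableSpace O] {H : ℕ}

/-- The law of one episode from the initial state, as a kernel in the policy that is run. -/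
def Env.episode (M : Env S A O H) : Kernel (Policy S A H) (Traj S A O H) where
  toFun π := trajLaw H M.step π M.init
  measurable' := (trajLaw_aux H M.step M.isProb).2 M.init

instance (M : Env S A O H) : IsMarkovKernel M.episode :=
  ⟨fun π => (trajLaw_aux H M.step M.isProb).1 π M.init⟩

/-- Expected sum `𝔼_π [∑_h g_h(s_h, a_h)]` over an episode from the initial state. -/
def Env.expectedSum {F : Type*} [NormedAddCommGroup F] [NormedSpace ℝ F] (M : Env S A O H)
    (g : Fin H → S → A → F) (π : Policy S A H) : F :=
  ∫ τ, ∑ h, g h (τ h).1 (τ h).2.1 ∂(M.episode π)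

/-- A randomized learner that interacts for `m` episodes. Before episode `k` it sees the data of the
`k` earlier episodes, and draws the policy to run in episode `k` from `explore k`. After `m` episodes
it outputs a mixture of policies, that is, a probability measure on policies. -/
structure Learner (S A O : Type*) [Fintype A] [MeasurableSpace S] [MeasurableSpace A]
    [MeasurableSpace O] (H m : ℕ) where
  explore : (k : ℕ) → Kernel (Fin k → Traj S A O H) (Policy S A H)
  output : Kernel (Fin m → Traj S A O H) (Policy S A H)
  explore_markov : ∀ k, IsMarkovKernel (explore k)
  output_markov : IsMarkovKernel output

attribute [instance] Learner.explore_markov Learner.output_markov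

/-- The law of the data of the first `k` episodes when the learner `L` interacts with `M`. -/
def Env.runLaw {m : ℕ} (M : Env S A O H) (L : Learner S A O H m) :
    (k : ℕ) → Measure (Fin k → Traj S A O H)
  | 0 => Measure.dirac Fin.elim0
  | k + 1 => (M.runLaw L k ⊗ₘ (M.episode ∘ₖ L.explore k)).map
      fun p => (Fin.snoc p.1 p.2 : Fin (k + 1) → Traj S A O H)

instance {m : ℕ} (M : Env S A O H) (L : Learner S A O H m) (k : ℕ) :
    IsProbabilityMeasure (M.runLaw L k) := by
  induction k with
  | zero => simp only [Env.runLaw]; infer_instance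
  | succ k ih =>
    simp only [Env.runLaw]
    exact Measure.isProbabilityMeasure_map (measurable_run_snoc H k).aemeasurable

end Interaction

/-- A vector-valued MDP: the observed samples are return vectors in the unit ball. -/
structure VMDP (S A : Type*) [MeasurableSpace S] (H d : ℕ) extends Env S A (Vec d) H where
  bounded : ∀ h s a, ∀ᵐ x ∂(step h s a), ‖x.1‖ ≤ 1

/-- A constrained MDP: in every step the agent observes a sample of the return vector, in the unit
ball, and a sample of the cost, in `[-1, 1]`. -/
structure CMDP (S A : Type*) [MeasurableSpace S] (H d : ℕ) extends Env S A (Vec d × ℝ) H where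
  bounded : ∀ h s a, ∀ᵐ x ∂(step h s a), ‖x.1.1‖ ≤ 1 ∧ |x.1.2| ≤ 1

section Goals

variable {S A : Type*} [Fintype S] [Fintype A] [MeasurableSpace S] [DiscreteMeasurableSpace S]
  [MeasurableSpace A] {H d : ℕ}

/-- The return function `𝐫_h(s, a)`. -/
def VMDP.ret (M : VMDP S A H d) (h : Fin H) (s : S) (a : A) : Vec d :=
  ∫ x, x.1 ∂(M.step h s a)

/-- `𝐕₁^μ(s₁)` for a mixture `μ` of policies. -/
def VMDP.value (M : VMDP S A H d) (μ : Measure (Policy S A H)) : Vec d :=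
  ∫ π, M.expectedSum M.ret π ∂μ

/-- The return function `𝐫_h(s, a)`. -/
def CMDP.ret (M : CMDP S A H d) (h : Fin H) (s : S) (a : A) : Vec d :=
  ∫ x, x.1.1 ∂(M.step h s a)

/-- The cost function `c_h(s, a)`. -/
def CMDP.cost (M : CMDP S A H d) (h : Fin H) (s : S) (a : A) : ℝ :=
  ∫ x, x.1.2 ∂(M.step h s a)

/-- `𝐕₁^μ(s₁)` for a mixture `μ` of policies. -/
def CMDP.value (M : CMDP S A H d) (μ : Measure (Policy S A H)) : Vec d :=
  ∫ π, M.expectedSum M.ret π ∂μ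

/-- `C₁^μ(s₁)` for a mixture `μ` of policies. -/
def CMDP.costValue (M : CMDP S A H d) (μ : Measure (Policy S A H)) : ℝ :=
  ∫ π, M.expectedSum M.cost π ∂μ

end Goals

section Algorithms

variable (S A : Type*) [Fintype S] [Fintype A] [MeasurableSpace S] [DiscreteMeasurableSpace S]
  [MeasurableSpace A] (H d : ℕ)

/-- `m` is the sample complexity of some approachability algorithm: given `C`, `ε` and `δ`, and
without knowing the VMDP, after `m ε δ` episodes the algorithm outputs, with probability at least
`1 - δ`, a policy whose value is at most `ε` farther from `C` than the value of any policy. -/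
def SolvesApproachability (m : ℝ → ℝ → ℕ) : Prop :=
  ∃ alg : (C : Set (Vec d)) → (ε δ : ℝ) → Learner S A (Vec d) H (m ε δ),
    ∀ C : Set (Vec d), Convex ℝ C → C.Nonempty → ∀ ε δ : ℝ, 0 < ε → 0 < δ →
      ∀ M : VMDP S A H d,
        1 - δ ≤ (M.runLaw (alg C ε δ) (m ε δ)).real
          {D | ∀ μ : ProbabilityMeasure (Policy S A H),
            Metric.infDist (M.value ((alg C ε δ).output D)) C ≤
              Metric.infDist (M.value (μ : Measure (Policy S A H))) C + ε}

/-- `m` is the sample complexity of some algorithm for CMDPs with convex constraints: given `C`, `ε`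
and `δ`, and without knowing the CMDP, after `m ε δ` episodes the algorithm outputs, with
probability at least `1 - δ`, a policy whose cost is at most `ε` above the cost of any policy with
value in `C`, and whose value is within `ε` of `C`; provided that the constraint can be met. -/
def SolvesCMDP (m : ℝ → ℝ → ℕ) : Prop :=
  ∃ alg : (C : Set (Vec d)) → (ε δ : ℝ) → Learner S A (Vec d × ℝ) H (m ε δ),
    ∀ C : Set (Vec d), Convex ℝ C → ∀ ε δ : ℝ, 0 < ε → 0 < δ →
      ∀ M : CMDP S A H d,
        (∃ μ : ProbabilityMeasure (Policy S A H), M.value (μ : Measure (Policy S A H)) ∈ C) →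
        1 - δ ≤ (M.runLaw (alg C ε δ) (m ε δ)).real
          {D | (∀ μ : ProbabilityMeasure (Policy S A H),
              M.value (μ : Measure (Policy S A H)) ∈ C →
                M.costValue ((alg C ε δ).output D) -
                  M.costValue (μ : Measure (Policy S A H)) ≤ ε) ∧
            Metric.infDist (M.value ((alg C ε δ).output D)) C ≤ ε}

end Algorithms

/-- The logarithmic factor `ι = log (d S A H / (ε δ))`. -/
def logFactor (d nS nA H : ℕ) (ε δ : ℝ) : ℝ :=
  Real.log ((d : ℝ) * nS * nA * H / (ε * δ))

end ConstrainedRL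

end

set_option linter.unusedSectionVars false

/-! Both problems reduce to one task (`ValueLearning`): find a set of policies and estimates of
their vector values such that the estimates are accurate and mixtures of these policies come close
to the value of every mixture. The rest is optimisation over estimates. Approachability minimises
the distance of the estimate to the set (`solvesApproachability_sampleSize`). For a CMDP the cost
becomes one more coordinate of the value, and the estimated cost is minimised among candidates whose
estimated return is close to the set (`solvesCMDP_sampleSize`).

Exploration ignores the rewards. Visit counts give bonuses, and the bonuses give the recursion
`unc`, which bounds both the error of estimated values and the loss from planning in the estimated
model (`norm_polVal_sub_le`, `optVal_sub_polVal_le`). The learner always plays the policy that is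
greedy for `unc`. By `unc_le_polVal` the uncertainty is, up to a constant factor and small errors,
at most the sum of clipped bonuses which that policy collects in expectation under the true
dynamics. Expected bonuses are controlled by the bonuses actually collected (`measure_regret_le`),
and these are bounded by counting visits (`collected_le`, `sum_bigBonus_le`). Hence some prefix of a
window of `windowLength` episodes has small uncertainty (`exists_uncOf_le`).

The bonus has two parts. `bonus₁`, of leading order H √(D B / n), pays for testing the model on
prescribed functions. `bonus₂`, for large n of order H² |S| B / n, pays for comparing true and
empirical transitions on arbitrary nonnegative functions with relative error 1/H; factors 1 + O(1/H)
compound to a constant over H steps. This comparison handles the functions that depend on the data,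
so |S| enters only the 1/ε term and D alone multiplies the 1/ε² term.

The factor min {d, S} comes from the choice of D. If d ≤ 2 |S|, then D = d pays for a union bound
over a net of directions, of size about (dH/ε)^d. The optimal value function of a direction is a
fixed function, so the first window yields, for every direction of the net, a nearly optimal policy.
By separation of convex sets (`exists_stdSimplex_near`) mixtures of these policies approach every
achievable value. Given the first window the policies are fixed, and fresh data of the second window
estimate their vector values; averages of vectors obey a bound free of the dimension
(`cosh_norm_add_le`). If d > 2 |S|, then D = |S| pays for the L¹ deviation of the transition
frequencies, and all policies are evaluated at once (`Accurate.norm_polVal_sub_le_of_card`).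

The factor ι contains no number of episodes, and it contains H only through H/ε. So there is no
union bound over sample sizes. Estimates use the first 4 ^ j samples, the deviation of such a batch
is allowed the logarithm `devLog` = B + H / 2 ^ j, and the expected excess over the allowed size is
summed over all j (`lintegral_scaleSum_le`). Markov's inequality then leaves errors `e h` with a
small sum (`measure_not_confident_le`), which `slack` carries through the recursions. The summand H
/ 2 ^ j gains a factor 1/H in this sum and adds only lower-order terms to the bonuses. -/

namespace ConstrainedRL

/-! ### Integrals over an episode, one step at a time -/

section EpisodeLaw

variable {S A O : Type*} [Fintype S] [Fintype A] [MeasurableSpace S] [DiscreteMeasurableSpace S]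
  [MeasurableSpace A] [MeasurableSpace O]

/-- The law of the rest of an episode, after the first action, as a kernel in the first sample
and the second state. -/
noncomputable def consKernel {n : ℕ} (step : Fin (n + 1) → S → A → Measure (O × S))
    (π : Policy S A (n + 1)) (s : S) (a : A) : Kernel (O × S) (Traj S A O (n + 1)) :=
  (Kernel.id ×ₖ (⟨fun x => trajLaw n (Fin.tail step) (Fin.tail π) x.2,
    (measurable_of_finite fun s' : S => trajLaw n (Fin.tail step) (Fin.tail π) s').comp
      measurable_snd⟩ : Kernel (O × S) (Traj S A O n))).map
    fun p : (O × S) × Traj S A O n => (Fin.cons (s, a, p.1.1) p.2 : Traj S A O (n + 1))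

lemma measurable_cons_fst (n : ℕ) (s : S) (a : A) :
    Measurable fun p : (O × S) × Traj S A O n =>
      (Fin.cons (s, a, p.1.1) p.2 : Traj S A O (n + 1)) :=
  (measurable_traj_cons (O := O) n s a).comp
    (by fun_prop : Measurable fun p : (O × S) × Traj S A O n => (p.1.1, p.2))

lemma consKernel_apply {n : ℕ} (step : Fin (n + 1) → S → A → Measure (O × S))
    (hstep : ∀ h s a, IsProbabilityMeasure (step h s a))
    (π : Policy S A (n + 1)) (s : S) (a : A) (x : O × S) :
    consKernel step π s a x = (trajLaw n (Fin.tail step) (Fin.tail π) x.2).map fun τ =>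
      (Fin.cons (s, a, x.1) τ : Traj S A O (n + 1)) := by
  have hP : ∀ s', IsProbabilityMeasure (trajLaw n (Fin.tail step) (Fin.tail π) s') := fun s' =>
    (trajLaw_aux n (Fin.tail step) (fun h s a => hstep h.succ s a)).1 (Fin.tail π) s'
  set κ : Kernel (O × S) (Traj S A O n) :=
    ⟨fun x => trajLaw n (Fin.tail step) (Fin.tail π) x.2,
    (measurable_of_finite fun s' : S => trajLaw n (Fin.tail step) (Fin.tail π) s').comp
      measurable_snd⟩ with hκ
  have : IsMarkovKernel κ := ⟨fun x => hP x.2⟩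
  have h1 : κ x = trajLaw n (Fin.tail step) (Fin.tail π) x.2 := rfl
  rw [consKernel, Kernel.map_apply _ (measurable_cons_fst n s a), Kernel.prod_apply,
    Kernel.id_apply, ← hκ, h1, Measure.dirac_prod,
    Measure.map_map (measurable_cons_fst n s a) (by fun_prop)]
  rfl

lemma isMarkovKernel_consKernel {n : ℕ} (step : Fin (n + 1) → S → A → Measure (O × S))
    (hstep : ∀ h s a, IsProbabilityMeasure (step h s a))
    (π : Policy S A (n + 1)) (s : S) (a : A) : IsMarkovKernel (consKernel step π s a) := by
  refine ⟨fun x => ?_⟩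
  rw [consKernel_apply step hstep]
  have := (trajLaw_aux n (Fin.tail step) (fun h s a => hstep h.succ s a)).1 (Fin.tail π) x.2
  exact Measure.isProbabilityMeasure_map
    ((measurable_cons_fst n s a).comp (measurable_prodMk_left (x := x))).aemeasurable

/-- Writing the continuation as a kernel makes the measurability needed to integrate against `bind`
automatic. -/
lemma trajLaw_succ {n : ℕ} (step : Fin (n + 1) → S → A → Measure (O × S))
    (hstep : ∀ h s a, IsProbabilityMeasure (step h s a))
    (π : Policy S A (n + 1)) (s : S) :
    trajLaw (n + 1) step π s =
      ∑ a : A, ENNReal.ofReal (π 0 s a) • (step 0 s a).bind (consKernel step π s a) := by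
  simp only [trajLaw]
  congr 1
  funext a
  congr 2
  funext x
  rw [consKernel_apply step hstep]

lemma lintegral_trajLaw_succ {n : ℕ} (step : Fin (n + 1) → S → A → Measure (O × S))
    (hstep : ∀ h s a, IsProbabilityMeasure (step h s a))
    (π : Policy S A (n + 1)) (s : S) {G : Traj S A O (n + 1) → ENNReal} (hG : Measurable G) :
    ∫⁻ τ, G τ ∂trajLaw (n + 1) step π s =
      ∑ a : A, ENNReal.ofReal (π 0 s a) * ∫⁻ x, ∫⁻ τ, G (Fin.cons (s, a, x.1) τ)
        ∂trajLaw n (Fin.tail step) (Fin.tail π) x.2 ∂step 0 s a := by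
  rw [trajLaw_succ step hstep, lintegral_finsetSum_measure]
  refine Finset.sum_congr rfl fun a _ => ?_
  rw [lintegral_smul_measure, Measure.lintegral_bind (Kernel.aemeasurable _) hG.aemeasurable,
    smul_eq_mul]
  congr 1
  refine lintegral_congr fun x => ?_
  rw [consKernel_apply step hstep]
  exact lintegral_map hG ((measurable_cons_fst n s a).comp (measurable_prodMk_left (x := x)))

lemma sum_policy (H : ℕ) (π : Policy S A H) (h : Fin H) (s : S) :
    ∑ a, ENNReal.ofReal (π h s a) = 1 := by
  have h4 : ∑ a, π h s a = 1 := (π h s).2.2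
  have h5 : ∀ a ∈ (Finset.univ : Finset A), 0 ≤ π h s a := fun a _ => (π h s).2.1 a
  rw [← ENNReal.ofReal_sum_of_nonneg h5, h4, ENNReal.ofReal_one]

end EpisodeLaw

/-! ### Samples at a state-action pair and their conditional law -/

/-- The sample of an episode at step `h`: what is observed, and the next state (`s₀` at the last
step). -/
def sampleAt {S A O : Type*} {H : ℕ} (s₀ : S) (τ : Traj S A O H) (h : Fin H) : O × S :=
  ((τ h).2.2, if hh : h.1 + 1 < H then (τ ⟨h.1 + 1, hh⟩).1 else s₀)

/-- The law of `sampleAt` given that `a` is played in state `s` at step `h`. -/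
noncomputable def sampleLaw {S A O : Type*} [MeasurableSpace S] [MeasurableSpace O] {H : ℕ}
    (s₀ : S) (step : Fin H → S → A → Measure (O × S)) (h : Fin H) (s : S) (a : A) :
    Measure (O × S) :=
  (step h s a).map fun x => (x.1, if h.1 + 1 < H then x.2 else s₀)

section SampleLaw

variable {S A O : Type*} [Fintype S] [Fintype A] [MeasurableSpace S] [DiscreteMeasurableSpace S]
  [MeasurableSpace A] [DiscreteMeasurableSpace A] [MeasurableSpace O] {H : ℕ}

lemma measurable_sampleAt (s₀ : S) (h : Fin H) :
    Measurable fun τ : Traj S A O H => sampleAt s₀ τ h := by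
  unfold sampleAt
  refine Measurable.prodMk (by fun_prop) ?_
  split_ifs <;> fun_prop

lemma measurable_sampleLaw_map (s₀ : S) (h : Fin H) :
    Measurable fun x : O × S => (x.1, if h.1 + 1 < H then x.2 else s₀) := by
  refine Measurable.prodMk (by fun_prop) ?_
  split_ifs <;> fun_prop

lemma isProbabilityMeasure_sampleLaw (s₀ : S) (step : Fin H → S → A → Measure (O × S))
    (hstep : ∀ h s a, IsProbabilityMeasure (step h s a)) (h : Fin H) (s : S) (a : A) :
    IsProbabilityMeasure (sampleLaw s₀ step h s a) := by
  have := hstep h s a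
  exact Measure.isProbabilityMeasure_map (measurable_sampleLaw_map s₀ h).aemeasurable

lemma sampleAt_cons_zero (s₀ : S) {n : ℕ} (y : S × A × O) (τ : Traj S A O (n + 1)) :
    sampleAt s₀ (Fin.cons y τ : Traj S A O (n + 2)) 0 = (y.2.2, (τ 0).1) := by
  simp only [sampleAt, Fin.cons_zero]
  rw [dif_pos (by simp)]
  rfl

lemma sampleAt_cons_succ (s₀ : S) {n : ℕ} (y : S × A × O) (τ : Traj S A O n) (h : Fin n) :
    sampleAt s₀ (Fin.cons y τ : Traj S A O (n + 1)) h.succ = sampleAt s₀ τ h := by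
  simp only [sampleAt, Fin.cons_succ, Fin.val_succ]
  congr 1
  by_cases hh : h.1 + 1 < n
  · rw [dif_pos (by omega), dif_pos hh]
    rfl
  · rw [dif_neg (by omega), dif_neg hh]

lemma lintegral_trajLaw_fst {n : ℕ} (step : Fin (n + 1) → S → A → Measure (O × S))
    (hstep : ∀ h s a, IsProbabilityMeasure (step h s a)) (π : Policy S A (n + 1)) (s : S)
    (f : S → ENNReal) :
    ∫⁻ τ, f (τ 0).1 ∂trajLaw (n + 1) step π s = f s := by
  rw [lintegral_trajLaw_succ step hstep]
  · simp only [Fin.cons_zero, lintegral_const]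
    have h2 : ∀ s', trajLaw n (Fin.tail step) (Fin.tail π) s' Set.univ = 1 := fun s' => by
      have := (trajLaw_aux n (Fin.tail step) (fun h s a => hstep h.succ s a)).1 (Fin.tail π) s'
      simp
    simp only [h2, mul_one, lintegral_const, measure_univ, ← Finset.sum_mul, sum_policy, one_mul]
  · exact (measurable_of_finite f).comp (by fun_prop)

open Classical in
/-- If the mean of `g` under the law of the samples at `(h, s, a)` is at most `c`, then the mean
over an episode of `g` at the sample of step `h` if `(s, a)` is visited, and `c` if not, is at most
`c`. -/
lemma lintegral_trajLaw_visit_le (s₀ : S) {n : ℕ} (step : Fin n → S → A → Measure (O × S))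
    (hstep : ∀ h s a, IsProbabilityMeasure (step h s a)) (π : Policy S A n) (s₁ : S)
    (h : Fin n) (s : S) (a : A) {g : O × S → ENNReal} (hg : Measurable g) (c : ENNReal)
    (hc : ∫⁻ x, g x ∂sampleLaw s₀ step h s a ≤ c) :
    ∫⁻ τ, (if (τ h).1 = s ∧ (τ h).2.1 = a then g (sampleAt s₀ τ h) else c)
      ∂trajLaw n step π s₁ ≤ c := by
  induction n generalizing s₁ with
  | zero => exact h.elim0
  | succ n ih =>
    have htail := fun s' =>
      (trajLaw_aux n (Fin.tail step) (fun h s a => hstep h.succ s a)).1 (Fin.tail π) s'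
    have hmeas : Measurable fun τ : Traj S A O (n + 1) =>
        (if (τ h).1 = s ∧ (τ h).2.1 = a then g (sampleAt s₀ τ h) else c) := by
      refine Measurable.ite ?_ (hg.comp (measurable_sampleAt s₀ h)) measurable_const
      exact ((measurableSet_singleton s).preimage
        (by fun_prop : Measurable fun τ : Traj S A O (n + 1) => (τ h).1)).inter
        ((measurableSet_singleton a).preimage
        (by fun_prop : Measurable fun τ : Traj S A O (n + 1) => (τ h).2.1))
    rw [lintegral_trajLaw_succ step hstep _ _ hmeas]
    have key : ∀ a', ∫⁻ x, ∫⁻ τ, (if ((Fin.cons (s₁, a', x.1) τ : Traj S A O (n + 1)) h).1 = s ∧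
        ((Fin.cons (s₁, a', x.1) τ : Traj S A O (n + 1)) h).2.1 = a then
        g (sampleAt s₀ (Fin.cons (s₁, a', x.1) τ : Traj S A O (n + 1)) h) else c)
        ∂trajLaw n (Fin.tail step) (Fin.tail π) x.2 ∂step 0 s₁ a' ≤ c := by
      intro a'
      have := hstep 0 s₁ a'
      -- At step 0 the pair visited is known: if it is (s, a), the sample has exactly the law
      -- `sampleLaw`, the next state being the first state of the rest of the episode; if not, the
      -- integrand is the constant c. Later steps lie in the rest of the episode, where induction
      -- applies.
      induction h using Fin.cases with
      | zero =>
        simp only [Fin.cons_zero]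
        by_cases hsa : s₁ = s ∧ a' = a
        · simp only [hsa, and_self, if_true]
          rw [sampleLaw, lintegral_map hg (measurable_sampleLaw_map s₀ 0)] at hc
          refine le_trans (le_of_eq ?_) hc
          refine lintegral_congr fun x => ?_
          rcases n with _ | n
          · simp [sampleAt]
          · simp_rw [sampleAt_cons_zero]
            have := lintegral_trajLaw_fst (Fin.tail step) (fun h s a => hstep h.succ s a)
              (Fin.tail π) x.2 (fun s' => g (x.1, s'))
            simpa using this
        · simp only [hsa, if_false]
          simp
      | succ h =>
        simp only [Fin.cons_succ, sampleAt_cons_succ]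
        have hc' : ∫⁻ x, g x ∂sampleLaw s₀ (Fin.tail step) h s a ≤ c := by
          refine le_trans (le_of_eq ?_) hc
          simp only [sampleLaw, Fin.tail, Fin.val_succ, Nat.add_lt_add_iff_right]
        calc _ ≤ ∫⁻ x, c ∂step 0 s₁ a' := lintegral_mono fun x =>
              ih (Fin.tail step) (fun h s a => hstep h.succ s a) (Fin.tail π) x.2 h hc'
          _ = c := by simp
    calc _ ≤ ∑ a', ENNReal.ofReal (π 0 s₁ a') * c :=
          Finset.sum_le_sum fun a' _ => mul_le_mul_right (key a') _
      _ = c := by rw [← Finset.sum_mul, sum_policy, one_mul]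

end SampleLaw

/-! ### Backward recursion and backward induction -/

/-- Backward recursion from the value `0` at step `H`: the value at step `h` is `T h` of the value
at step `h + 1`. -/
def backup {X : Type*} [Zero X] : (H : ℕ) → (Fin H → X → X) → ℕ → X
  | 0, _, _ => 0
  | n + 1, T, 0 => T 0 (backup n (Fin.tail T) 0)
  | n + 1, T, h + 1 => backup n (Fin.tail T) h

section Backup

variable {X : Type*} [Zero X]

lemma backup_of_le {H : ℕ} (T : Fin H → X → X) {h : ℕ} (hh : H ≤ h) : backup H T h = 0 := by
  induction H generalizing h with
  | zero => rfl
  | succ n ih =>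
    obtain ⟨k, rfl⟩ : ∃ k, h = k + 1 := ⟨h - 1, by omega⟩
    exact ih (Fin.tail T) (by omega)

lemma backup_eq {H : ℕ} (T : Fin H → X → X) (h : Fin H) :
    backup H T h = T h (backup H T (h + 1)) := by
  induction H with
  | zero => exact h.elim0
  | succ n ih =>
    induction h using Fin.cases with
    | zero => rfl
    | succ h =>
      have := ih (Fin.tail T) h
      simpa [backup, Fin.tail] using this

/-- Backward induction. -/
lemma backward_induction {H : ℕ} {Q : ℕ → Prop} (hend : ∀ h, H ≤ h → Q h)
    (hstep : ∀ h : Fin H, Q (h + 1) → Q h) (h : ℕ) : Q h := by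
  by_cases hh : H ≤ h
  · exact hend h hh
  · obtain ⟨k, hk⟩ : ∃ k, H = h + k := ⟨H - h, by omega⟩
    induction k generalizing h with
    | zero => omega
    | succ k ih =>
      refine hstep ⟨h, by omega⟩ ?_
      by_cases h2 : H ≤ h + 1
      · exact hend _ h2
      · exact ih (h + 1) h2 (by omega)

end Backup

/-! ### Bellman operators of a policy -/

section Bellman

variable {S A : Type*} [Fintype S] [Fintype A] {H : ℕ} {F : Type*} [NormedAddCommGroup F]
  [NormedSpace ℝ F]

lemma policy_nonneg (π : Policy S A H) (h : Fin H) (s : S) (a : A) : 0 ≤ π h s a :=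
  (π h s).2.1 a

lemma policy_sum (π : Policy S A H) (h : Fin H) (s : S) : ∑ a, π h s a = 1 :=
  (π h s).2.2

/-- The value of `g` at `(h, s, a)` plus the mean of `V` at the next state. -/
noncomputable def lookahead (P : Fin H → S → A → S → ℝ) (g : Fin H → S → A → F) (h : Fin H)
    (V : S → F) (s : S) (a : A) : F :=
  g h s a + ∑ s', P h s a s' • V s'

/-- The Bellman operators of a policy. -/
noncomputable def bellman (P : Fin H → S → A → S → ℝ) (g : Fin H → S → A → F) (π : Policy S A H)
    (h : Fin H) (V : S → F) (s : S) : F :=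
  ∑ a, π h s a • lookahead P g h V s a

/-- The values of a policy. -/
noncomputable def polVal (P : Fin H → S → A → S → ℝ) (g : Fin H → S → A → F) (π : Policy S A H) :
    ℕ → S → F :=
  backup H (bellman P g π)

lemma polVal_of_le (P : Fin H → S → A → S → ℝ) (g : Fin H → S → A → F) (π : Policy S A H)
    {h : ℕ} (hh : H ≤ h) (s : S) : polVal P g π h s = 0 := by
  rw [polVal, backup_of_le _ hh]; rfl

lemma polVal_eq (P : Fin H → S → A → S → ℝ) (g : Fin H → S → A → F) (π : Policy S A H)
    (h : Fin H) (s : S) :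
    polVal P g π h s = ∑ a, π h s a • lookahead P g h (polVal P g π (h + 1)) s a := by
  rw [polVal, backup_eq]; rfl

end Bellman

/-! ### Expected sums as Bellman values -/

section ExpectedSum

variable {S A O : Type*} [Fintype S] [Fintype A] [MeasurableSpace S] [DiscreteMeasurableSpace S]
  [MeasurableSpace A] [DiscreteMeasurableSpace A] [MeasurableSpace O]
  {F : Type*} [NormedAddCommGroup F] [NormedSpace ℝ F]

lemma stronglyMeasurable_sum_visit {n : ℕ} (g : Fin n → S → A → F) :
    StronglyMeasurable fun τ : Traj S A O n => ∑ h, g h (τ h).1 (τ h).2.1 := by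
  refine Finset.stronglyMeasurable_fun_sum _ fun h _ => ?_
  have : StronglyMeasurable fun p : S × A => g h p.1 p.2 := StronglyMeasurable.of_discrete
  exact this.comp_measurable
    (by fun_prop : Measurable fun τ : Traj S A O n => ((τ h).1, (τ h).2.1))

lemma norm_sum_visit_le {n : ℕ} (g : Fin n → S → A → F) (τ : Traj S A O n) :
    ‖∑ h, g h (τ h).1 (τ h).2.1‖ ≤ ∑ h, ∑ s, ∑ a, ‖g h s a‖ := by
  refine (norm_sum_le _ _).trans (Finset.sum_le_sum fun h _ => ?_)
  refine le_trans ?_ (Finset.single_le_sum (f := fun s => ∑ a, ‖g h s a‖)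
    (fun s _ => Finset.sum_nonneg fun a _ => norm_nonneg _) (Finset.mem_univ (τ h).1))
  exact Finset.single_le_sum (f := fun a => ‖g h (τ h).1 a‖) (fun a _ => norm_nonneg _)
    (Finset.mem_univ (τ h).2.1)

lemma integrable_sum_visit {n : ℕ} (g : Fin n → S → A → F) (μ : Measure (Traj S A O n))
    [IsFiniteMeasure μ] : Integrable (fun τ => ∑ h, g h (τ h).1 (τ h).2.1) μ :=
  Integrable.of_bound (stronglyMeasurable_sum_visit g).aestronglyMeasurable _
    (Filter.Eventually.of_forall (norm_sum_visit_le g))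

lemma integral_snd_eq_sum [CompleteSpace F] (μ : Measure (O × S)) [IsFiniteMeasure μ] (V : S → F) :
    ∫ x, V x.2 ∂μ = ∑ s', μ.real {x | x.2 = s'} • V s' := by
  have hV : StronglyMeasurable V := StronglyMeasurable.of_discrete
  have h1 : ∫ x, V x.2 ∂μ = ∫ s', V s' ∂(μ.map Prod.snd) :=
    (integral_map measurable_snd.aemeasurable hV.aestronglyMeasurable).symm
  rw [h1, integral_fintype (Integrable.of_finite)]
  refine Finset.sum_congr rfl fun s' _ => ?_
  rw [Measure.real, Measure.real, Measure.map_apply measurable_snd (measurableSet_singleton s')]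
  rfl

/-- The mean of a sum of rewards over an episode is given by the Bellman recursion. -/
lemma integral_trajLaw_sum [CompleteSpace F] {n : ℕ} (step : Fin n → S → A → Measure (O × S))
    (hstep : ∀ h s a, IsProbabilityMeasure (step h s a)) (P : Fin n → S → A → S → ℝ)
    (hP : ∀ h : Fin n, h.1 + 1 < n → ∀ s a s', P h s a s' = (step h s a).real {x | x.2 = s'})
    (g : Fin n → S → A → F) (π : Policy S A n) (s : S) :
    ∫ τ, ∑ h, g h (τ h).1 (τ h).2.1 ∂trajLaw n step π s = polVal P g π 0 s := by
  induction n generalizing s with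
  | zero => simp [polVal, backup]
  | succ n ih =>
    have hK := isMarkovKernel_consKernel step hstep π s
    have hprob := (trajLaw_aux (n + 1) step hstep).1 π s
    have hsub := fun s' =>
      (trajLaw_aux n (Fin.tail step) (fun h s a => hstep h.succ s a)).1 (Fin.tail π) s'
    have htail : ∀ s', polVal P g π 1 s' =
        ∫ τ, ∑ h, (Fin.tail g) h (τ h).1 (τ h).2.1 ∂trajLaw n (Fin.tail step) (Fin.tail π) s' := by
      intro s'
      rw [ih (Fin.tail step) (fun h s a => hstep h.succ s a) (Fin.tail P)
        (fun h hh s a s' => hP h.succ (by simpa using hh) s a s') (Fin.tail g) (Fin.tail π) s']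
      rfl
    have h0 := polVal_eq P g π 0 s
    simp only [Fin.val_zero, zero_add] at h0
    rw [h0, trajLaw_succ step hstep, integral_finsetSum_measure]
    · refine Finset.sum_congr rfl fun a _ => ?_
      have := hstep 0 s a
      have := hK a
      rw [integral_smul_measure, ENNReal.toReal_ofReal (policy_nonneg π 0 s a),
        Measure.comp_eq_comp_const_apply, Kernel.integral_comp (integrable_sum_visit g _),
        Kernel.const_apply]
      congr 1
      have h2 : ∀ x : O × S, ∫ τ, ∑ h, g h (τ h).1 (τ h).2.1 ∂consKernel step π s a x =
          g 0 s a + polVal P g π 1 x.2 := by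
        intro x
        have hcons : Measurable fun τ : Traj S A O n =>
            (Fin.cons (s, a, x.1) τ : Traj S A O (n + 1)) :=
          (measurable_cons_fst n s a).comp (measurable_prodMk_left (x := x))
        rw [consKernel_apply step hstep, integral_map hcons.aemeasurable
          (stronglyMeasurable_sum_visit g).aestronglyMeasurable, htail]
        simp only [Fin.sum_univ_succ, Fin.cons_zero, Fin.cons_succ]
        refine (integral_add (integrable_const _)
          (integrable_sum_visit (Fin.tail g) _)).trans ?_
        simp
      simp only [h2]
      have hint : Integrable (fun x : O × S => polVal P g π 1 x.2) (step 0 s a) := by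
        have hV : StronglyMeasurable (polVal P g π 1) := StronglyMeasurable.of_discrete
        refine Integrable.of_bound (hV.comp_measurable measurable_snd).aestronglyMeasurable
          (∑ s', ‖polVal P g π 1 s'‖) (Filter.Eventually.of_forall fun x => ?_)
        exact Finset.single_le_sum (f := fun s' => ‖polVal P g π 1 s'‖)
          (fun s _ => norm_nonneg _) (Finset.mem_univ x.2)
      rw [integral_add (integrable_const _) hint, integral_snd_eq_sum]
      simp only [integral_const, probReal_univ, one_smul, lookahead]
      congr 1
      refine Finset.sum_congr rfl fun s' _ => ?_
      -- At the last step nothing is assumed about `P`, since the state after it is not observed; it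
      -- only multiplies the value 0.
      rcases Nat.eq_zero_or_pos n with rfl | hn
      · rw [polVal_of_le _ _ _ le_rfl, smul_zero, smul_zero]
      · rw [hP 0 (by simpa using hn)]
    · intro a _
      have := hK a
      have := hstep 0 s a
      exact (integrable_sum_visit g _).smul_measure (by simp)

end ExpectedSum

/-! ### Values, optimal values and accumulated errors for substochastic transitions -/

section Planning

variable {S A : Type*} [Fintype S] [Fintype A] {H : ℕ} {F : Type*} [NormedAddCommGroup F]
  [NormedSpace ℝ F]

/-- The rows of `P` are sub-probability vectors. -/
def SubStoch (P : Fin H → S → A → S → ℝ) : Prop :=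
  ∀ h s a, (∀ s', 0 ≤ P h s a s') ∧ ∑ s', P h s a s' ≤ 1

lemma SubStoch.sum_mul_le {P : Fin H → S → A → S → ℝ} (hP : SubStoch P) (h : Fin H) (s : S) (a : A)
    {f : S → ℝ} {c : ℝ} (hc : 0 ≤ c) (hf : ∀ s', f s' ≤ c) : ∑ s', P h s a s' * f s' ≤ c :=
  calc ∑ s', P h s a s' * f s' ≤ ∑ s', P h s a s' * c :=
        Finset.sum_le_sum fun s' _ => mul_le_mul_of_nonneg_left (hf s') ((hP h s a).1 s')
    _ = (∑ s', P h s a s') * c := (Finset.sum_mul _ _ _).symm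
    _ ≤ c := mul_le_of_le_one_left hc (hP h s a).2

lemma SubStoch.sum_mul_mono {P : Fin H → S → A → S → ℝ} (hP : SubStoch P) (h : Fin H) (s : S)
    (a : A) {f f' : S → ℝ} (hf : ∀ s', f s' ≤ f' s') :
    ∑ s', P h s a s' * f s' ≤ ∑ s', P h s a s' * f' s' :=
  Finset.sum_le_sum fun s' _ => mul_le_mul_of_nonneg_left (hf s') ((hP h s a).1 s')

lemma SubStoch.sum_mul_nonneg {P : Fin H → S → A → S → ℝ} (hP : SubStoch P) (h : Fin H) (s : S)
    (a : A) {f : S → ℝ} (hf : ∀ s', 0 ≤ f s') : 0 ≤ ∑ s', P h s a s' * f s' :=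
  Finset.sum_nonneg fun s' _ => mul_nonneg ((hP h s a).1 s') (hf s')

lemma SubStoch.norm_sum_smul_le {P : Fin H → S → A → S → ℝ} (hP : SubStoch P) (h : Fin H) (s : S)
    (a : A) {f : S → F} {f' : S → ℝ} (hf : ∀ s', ‖f s'‖ ≤ f' s') :
    ‖∑ s', P h s a s' • f s'‖ ≤ ∑ s', P h s a s' * f' s' := by
  refine (norm_sum_le _ _).trans (Finset.sum_le_sum fun s' _ => ?_)
  rw [norm_smul, Real.norm_of_nonneg ((hP h s a).1 s')]
  exact mul_le_mul_of_nonneg_left (hf s') ((hP h s a).1 s')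

lemma norm_lookahead_le {P : Fin H → S → A → S → ℝ} (hP : SubStoch P) {g : Fin H → S → A → F}
    (hg : ∀ h s a, ‖g h s a‖ ≤ 1) (h : Fin H) {V : S → F}
    (hV : ∀ s, ‖V s‖ ≤ ((H - (h + 1) : ℕ) : ℝ)) (s : S) (a : A) :
    ‖lookahead P g h V s a‖ ≤ ((H - h : ℕ) : ℝ) := by
  have h1 : ((H - h : ℕ) : ℝ) = 1 + ((H - (h + 1) : ℕ) : ℝ) := by
    have := h.2
    rw [← Nat.cast_one, ← Nat.cast_add]
    congr 1
    omega
  rw [h1]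
  refine (norm_add_le _ _).trans (add_le_add (hg h s a) ?_)
  exact (hP.norm_sum_smul_le h s a hV).trans (hP.sum_mul_le h s a (Nat.cast_nonneg _) fun _ => le_rfl)

lemma norm_policy_sum_le (π : Policy S A H) (h : Fin H) (s : S) {f : A → F} {c : ℝ}
    (hf : ∀ a, ‖f a‖ ≤ c) : ‖∑ a, π h s a • f a‖ ≤ c := by
  calc ‖∑ a, π h s a • f a‖ ≤ ∑ a, π h s a * c := by
        refine (norm_sum_le _ _).trans (Finset.sum_le_sum fun a _ => ?_)
        rw [norm_smul, Real.norm_of_nonneg (policy_nonneg π h s a)]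
        exact mul_le_mul_of_nonneg_left (hf a) (policy_nonneg π h s a)
    _ = c := by rw [← Finset.sum_mul, policy_sum, one_mul]

lemma norm_polVal_le {P : Fin H → S → A → S → ℝ} (hP : SubStoch P) {g : Fin H → S → A → F}
    (hg : ∀ h s a, ‖g h s a‖ ≤ 1) (π : Policy S A H) (h : ℕ) :
    ∀ s, ‖polVal P g π h s‖ ≤ ((H - h : ℕ) : ℝ) := by
  refine backward_induction (H := H) (Q := fun h => ∀ s, ‖polVal P g π h s‖ ≤ ((H - h : ℕ) : ℝ))
    (fun h hh s => ?_) (fun h ih s => ?_) h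
  · rw [polVal_of_le P g π hh]; simp
  · rw [polVal_eq]
    exact norm_policy_sum_le π h s fun a => norm_lookahead_le hP hg h ih s a

lemma norm_polVal_le' {P : Fin H → S → A → S → ℝ} (hP : SubStoch P) {g : Fin H → S → A → F}
    (hg : ∀ h s a, ‖g h s a‖ ≤ 1) (π : Policy S A H) (h : ℕ) (s : S) :
    ‖polVal P g π h s‖ ≤ H :=
  (norm_polVal_le hP hg π h s).trans (by exact_mod_cast Nat.sub_le _ _)

/-- The policy that plays the action `α h s` in state `s` at step `h`. -/
noncomputable def detPolicy (α : Fin H → S → A) : Policy S A H := by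
  classical
  exact fun h s => ⟨Pi.single (α h s) 1, single_mem_stdSimplex ℝ (α h s)⟩

lemma sum_detPolicy (α : Fin H → S → A) (h : Fin H) (s : S) (f : A → F) :
    ∑ a, detPolicy α h s a • f a = f (α h s) := by
  classical
  have h1 : ∀ a, detPolicy α h s a = (Pi.single (α h s) 1 : A → ℝ) a := fun a => by
    unfold detPolicy
    exact congrFun (congrArg _ (by congr)) a
  simp [h1, Pi.single_apply, ite_smul]

lemma polVal_detPolicy (P : Fin H → S → A → S → ℝ) (g : Fin H → S → A → F) (α : Fin H → S → A)
    (h : Fin H) (s : S) : polVal P g (detPolicy α) h s =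
      lookahead P g h (polVal P g (detPolicy α) (h + 1)) s (α h s) := by
  rw [polVal_eq, sum_detPolicy]

/-- The accumulated effect of the errors `3 * e h`, when errors grow by a factor `c` per step. -/
noncomputable def slack (c : ℝ) (e : Fin H → ℝ) : ℕ → ℝ :=
  backup H fun h x => 3 * e h + c * x

lemma slack_eq (c : ℝ) (e : Fin H → ℝ) (h : Fin H) :
    slack c e h = 3 * e h + c * slack c e (h + 1) := by
  rw [slack, backup_eq]

lemma slack_of_le (c : ℝ) (e : Fin H → ℝ) {h : ℕ} (hh : H ≤ h) : slack c e h = 0 :=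
  backup_of_le _ hh

lemma slack_nonneg {c : ℝ} (hc : 0 ≤ c) {e : Fin H → ℝ} (he : ∀ h, 0 ≤ e h) (h : ℕ) :
    0 ≤ slack c e h :=
  backward_induction (Q := fun h => 0 ≤ slack c e h) (fun h hh => (slack_of_le c e hh).ge)
    (fun h ih => by rw [slack_eq]; have := he h; positivity) h

lemma slack_zero_le {n : ℕ} {c : ℝ} (hc : 1 ≤ c) {e : Fin n → ℝ} (he : ∀ h, 0 ≤ e h) :
    slack c e 0 ≤ c ^ n * (3 * ∑ h, e h) := by
  induction n with
  | zero => simp [slack, backup]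
  | succ n ih =>
    have h1 : slack c e 0 = 3 * e 0 + c * slack c (Fin.tail e) 0 := rfl
    have h2 := ih (e := Fin.tail e) fun h => he h.succ
    have h3 : ∑ h, e h = e 0 + ∑ h, Fin.tail e h := Fin.sum_univ_succ e
    have h4 : 1 ≤ c ^ (n + 1) := one_le_pow₀ hc
    have h5 := he 0
    rw [h1, h3]
    calc 3 * e 0 + c * slack c (Fin.tail e) 0
        ≤ c ^ (n + 1) * (3 * e 0) + c * (c ^ n * (3 * ∑ h, Fin.tail e h)) :=
          add_le_add (le_mul_of_one_le_left (by positivity) h4)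
            (mul_le_mul_of_nonneg_left h2 (by linarith))
      _ = _ := by ring

variable [Nonempty A]

/-- The optimal values. -/
noncomputable def optVal (P : Fin H → S → A → S → ℝ) (g : Fin H → S → A → ℝ) : ℕ → S → ℝ :=
  backup H fun h V s => Finset.univ.sup' Finset.univ_nonempty (lookahead P g h V s)

lemma optVal_eq (P : Fin H → S → A → S → ℝ) (g : Fin H → S → A → ℝ) (h : Fin H) (s : S) :
    optVal P g h s =
      Finset.univ.sup' Finset.univ_nonempty (lookahead P g h (optVal P g (h + 1)) s) := by
  rw [optVal, backup_eq]

lemma optVal_of_le (P : Fin H → S → A → S → ℝ) (g : Fin H → S → A → ℝ) {h : ℕ} (hh : H ≤ h)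
    (s : S) : optVal P g h s = 0 := by
  rw [optVal, backup_of_le _ hh]; rfl

lemma lookahead_le_optVal (P : Fin H → S → A → S → ℝ) (g : Fin H → S → A → ℝ) (h : Fin H) (s : S)
    (a : A) : lookahead P g h (optVal P g (h + 1)) s a ≤ optVal P g h s := by
  rw [optVal_eq]
  exact Finset.le_sup' _ (Finset.mem_univ a)

lemma exists_optVal_eq (P : Fin H → S → A → S → ℝ) (g : Fin H → S → A → ℝ) (h : Fin H) (s : S) :
    ∃ a, optVal P g h s = lookahead P g h (optVal P g (h + 1)) s a := by
  obtain ⟨a, -, ha⟩ := Finset.exists_mem_eq_sup' (Finset.univ_nonempty (α := A))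
    (lookahead P g h (optVal P g (h + 1)) s)
  exact ⟨a, (optVal_eq P g h s).trans ha⟩

lemma abs_optVal_le {P : Fin H → S → A → S → ℝ} (hP : SubStoch P) {g : Fin H → S → A → ℝ}
    (hg : ∀ h s a, ‖g h s a‖ ≤ 1) (h : ℕ) : ∀ s, ‖optVal P g h s‖ ≤ ((H - h : ℕ) : ℝ) := by
  refine backward_induction (H := H) (Q := fun h => ∀ s, ‖optVal P g h s‖ ≤ ((H - h : ℕ) : ℝ))
    (fun h hh s => ?_) (fun h ih s => ?_) h
  · rw [optVal_of_le P g hh]; simp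
  · obtain ⟨a, ha⟩ := exists_optVal_eq P g h s
    rw [ha]
    exact norm_lookahead_le hP hg h ih s a

lemma polVal_le_optVal {P : Fin H → S → A → S → ℝ} (hP : SubStoch P) (g : Fin H → S → A → ℝ)
    (π : Policy S A H) (h : ℕ) : ∀ s, polVal P g π h s ≤ optVal P g h s := by
  refine backward_induction (H := H) (Q := fun h => ∀ s, polVal P g π h s ≤ optVal P g h s)
    (fun h hh s => ?_) (fun h ih s => ?_) h
  · rw [optVal_of_le P g hh, polVal_of_le P g π hh]
  · rw [polVal_eq]
    calc _ ≤ ∑ a, π h s a * optVal P g h s := by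
          refine Finset.sum_le_sum fun a _ => ?_
          refine mul_le_mul_of_nonneg_left ?_ (policy_nonneg π h s a)
          refine le_trans ?_ (lookahead_le_optVal P g h s a)
          exact add_le_add le_rfl (hP.sum_mul_mono h s a ih)
      _ = _ := by rw [← Finset.sum_mul, policy_sum, one_mul]

/-! ### Propagation of model errors -/

/-- The uncertainty about the values, from the bonus `β` and the estimated transitions `P`. -/
noncomputable def unc (P : Fin H → S → A → S → ℝ) (β : Fin H → S → A → ℝ) : ℕ → S → ℝ :=
  backup H fun h V s => Finset.univ.sup' Finset.univ_nonempty fun a =>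
    min (2 * (H : ℝ)) (β h s a + (1 + 2 / (H : ℝ)) * ∑ s', P h s a s' * V s')

lemma unc_eq (P : Fin H → S → A → S → ℝ) (β : Fin H → S → A → ℝ) (h : Fin H) (s : S) :
    unc P β h s = Finset.univ.sup' Finset.univ_nonempty fun a =>
      min (2 * (H : ℝ)) (β h s a + (1 + 2 / (H : ℝ)) * ∑ s', P h s a s' * unc P β (h + 1) s') := by
  rw [unc, backup_eq]

lemma unc_of_le (P : Fin H → S → A → S → ℝ) (β : Fin H → S → A → ℝ) {h : ℕ} (hh : H ≤ h)
    (s : S) : unc P β h s = 0 := by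
  rw [unc, backup_of_le _ hh]; rfl

lemma exists_unc_eq (P : Fin H → S → A → S → ℝ) (β : Fin H → S → A → ℝ) (h : Fin H) (s : S) :
    ∃ a, unc P β h s = min (2 * (H : ℝ))
      (β h s a + (1 + 2 / (H : ℝ)) * ∑ s', P h s a s' * unc P β (h + 1) s') := by
  obtain ⟨a, -, ha⟩ := Finset.exists_mem_eq_sup' (Finset.univ_nonempty (α := A)) fun a =>
    min (2 * (H : ℝ)) (β h s a + (1 + 2 / (H : ℝ)) * ∑ s', P h s a s' * unc P β (h + 1) s')
  exact ⟨a, (unc_eq P β h s).trans ha⟩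

lemma unc_mem {P : Fin H → S → A → S → ℝ} (hP : SubStoch P) {β : Fin H → S → A → ℝ}
    (hβ : ∀ h s a, 0 ≤ β h s a) (h : ℕ) : ∀ s, 0 ≤ unc P β h s ∧ unc P β h s ≤ 2 * H := by
  refine backward_induction (H := H) (Q := fun h => ∀ s, 0 ≤ unc P β h s ∧ unc P β h s ≤ 2 * H)
    (fun h hh s => ?_) (fun h ih s => ?_) h
  · rw [unc_of_le P β hh]; simp
  · obtain ⟨a, ha⟩ := exists_unc_eq P β h s
    rw [ha]
    have := hP.sum_mul_nonneg h s a fun s' => (ih s').1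
    have := hβ h s a
    exact ⟨le_min (by positivity) (by positivity), min_le_left _ _⟩

variable {P Q : Fin H → S → A → S → ℝ} {β : Fin H → S → A → ℝ} {e : Fin H → ℝ}

/-- `Q` is the estimate of the transitions, `P` are the transitions. -/
lemma le_unc_add_slack (hQ : SubStoch Q) (hβ : ∀ h s a, 0 ≤ β h s a) (he : ∀ h, 0 ≤ e h)
    (h : Fin H) (s : S) (a : A) {x : ℝ} (hx : x ≤ 2 * H)
    (hx' : 2 * H ≤ β h s a ∨ x ≤ β h s a + 3 * e h + (1 + 2 / (H : ℝ)) *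
      ∑ s', Q h s a s' * (unc Q β (h + 1) s' + slack (1 + 2 / (H : ℝ)) e (h + 1))) :
    x ≤ unc Q β h s + slack (1 + 2 / (H : ℝ)) e h := by
  have hγ : (0 : ℝ) ≤ 1 + 2 / (H : ℝ) := by positivity
  have h1 : min (2 * (H : ℝ)) (β h s a + (1 + 2 / (H : ℝ)) * ∑ s', Q h s a s' * unc Q β (h + 1) s')
      ≤ unc Q β h s := by
    rw [unc_eq]
    exact Finset.le_sup' (fun a => min (2 * (H : ℝ))
      (β h s a + (1 + 2 / (H : ℝ)) * ∑ s', Q h s a s' * unc Q β (h + 1) s')) (Finset.mem_univ a)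
  have h2 := slack_nonneg hγ he h
  refine le_trans ?_ (add_le_add_left h1 _)
  rw [← sub_le_iff_le_add]
  have h3 := hQ.sum_mul_nonneg h s a fun s' => (unc_mem hQ hβ (h + 1) s').1
  rcases hx' with hx' | hx'
  · refine le_min (by linarith) ?_
    have := mul_nonneg hγ h3
    linarith
  · refine le_min (by linarith) ?_
    rw [slack_eq]
    have h4 : ∑ s', Q h s a s' * (unc Q β (h + 1) s' + slack (1 + 2 / (H : ℝ)) e (h + 1)) ≤
        ∑ s', Q h s a s' * unc Q β (h + 1) s' + slack (1 + 2 / (H : ℝ)) e (h + 1) := by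
      simp only [mul_add, Finset.sum_add_distrib]
      gcongr
      exact hQ.sum_mul_le h s a (slack_nonneg hγ he _) fun _ => le_rfl
    have h5 := mul_le_mul_of_nonneg_left h4 hγ
    linarith

/-- The error of the estimated value of a policy is at most the uncertainty. -/
lemma norm_polVal_sub_le (hP : SubStoch P) (hQ : SubStoch Q) (hβ : ∀ h s a, 0 ≤ β h s a)
    (he : ∀ h, 0 ≤ e h) {g g' : Fin H → S → A → F} (hg : ∀ h s a, ‖g h s a‖ ≤ 1)
    (hg' : ∀ h s a, ‖g' h s a‖ ≤ 1) (π : Policy S A H)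
    (hconf : ∀ h s a, 2 * H ≤ β h s a ∨ ‖lookahead Q g' h (polVal P g π (h + 1)) s a -
      lookahead P g h (polVal P g π (h + 1)) s a‖ ≤ β h s a + 3 * e h) (h : ℕ) :
    ∀ s, ‖polVal Q g' π h s - polVal P g π h s‖ ≤
      unc Q β h s + slack (1 + 2 / (H : ℝ)) e h := by
  have hγ : (0 : ℝ) ≤ 1 + 2 / (H : ℝ) := by positivity
  refine backward_induction (H := H) (Q := fun h => ∀ s, ‖polVal Q g' π h s - polVal P g π h s‖ ≤
      unc Q β h s + slack (1 + 2 / (H : ℝ)) e h) (fun h hh s => ?_) (fun h ih s => ?_) h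
  · simp [polVal_of_le _ _ _ hh, unc_of_le _ _ hh, slack_of_le _ _ hh]
  · rw [polVal_eq, polVal_eq, ← Finset.sum_sub_distrib]
    simp_rw [← smul_sub]
    refine norm_policy_sum_le π h s fun a => ?_
    refine le_unc_add_slack hQ hβ he h s a ?_ ?_
    · have h1 := norm_lookahead_le hQ hg' h (fun s => norm_polVal_le hQ hg' π (h + 1) s) s a
      have h2 := norm_lookahead_le hP hg h (fun s => norm_polVal_le hP hg π (h + 1) s) s a
      have h3 : ((H - h : ℕ) : ℝ) ≤ H := by exact_mod_cast Nat.sub_le _ _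
      have := norm_sub_le (lookahead Q g' h (polVal Q g' π (h + 1)) s a)
        (lookahead P g h (polVal P g π (h + 1)) s a)
      linarith
    · refine (hconf h s a).imp_right fun hc => ?_
      -- The model error is charged to the true value function, which does not depend on the samples
      -- being averaged; the difference of value functions passes through the estimated transitions
      -- and is covered by the recursion.
      have h1 : lookahead Q g' h (polVal Q g' π (h + 1)) s a -
          lookahead P g h (polVal P g π (h + 1)) s a =
          (lookahead Q g' h (polVal P g π (h + 1)) s a -
          lookahead P g h (polVal P g π (h + 1)) s a) +
          ∑ s', Q h s a s' • (polVal Q g' π (h + 1) s' - polVal P g π (h + 1) s') := by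
        simp only [lookahead, smul_sub, Finset.sum_sub_distrib]
        abel
      rw [h1]
      refine (norm_add_le _ _).trans (add_le_add hc ?_)
      refine (hQ.norm_sum_smul_le h s a ih).trans (le_mul_of_one_le_left ?_ ?_)
      · exact hQ.sum_mul_nonneg h s a fun s' => add_nonneg (unc_mem hQ hβ _ s').1
          (slack_nonneg hγ he _)
      · have : (0 : ℝ) ≤ 2 / H := by positivity
        linarith

/-- The error of the estimated optimal value is at most the uncertainty. -/
lemma abs_optVal_sub_le (hP : SubStoch P) (hQ : SubStoch Q) (hβ : ∀ h s a, 0 ≤ β h s a)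
    (he : ∀ h, 0 ≤ e h) {g g' : Fin H → S → A → ℝ} (hg : ∀ h s a, ‖g h s a‖ ≤ 1)
    (hg' : ∀ h s a, ‖g' h s a‖ ≤ 1)
    (hconf : ∀ h s a, 2 * H ≤ β h s a ∨ |lookahead Q g' h (optVal P g (h + 1)) s a -
      lookahead P g h (optVal P g (h + 1)) s a| ≤ β h s a + 3 * e h) (h : ℕ) :
    ∀ s, |optVal Q g' h s - optVal P g h s| ≤
      unc Q β h s + slack (1 + 2 / (H : ℝ)) e h := by
  have hγ : (0 : ℝ) ≤ 1 + 2 / (H : ℝ) := by positivity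
  refine backward_induction (H := H) (Q := fun h => ∀ s, |optVal Q g' h s - optVal P g h s| ≤
      unc Q β h s + slack (1 + 2 / (H : ℝ)) e h) (fun h hh s => ?_) (fun h ih s => ?_) h
  · simp [optVal_of_le _ _ hh, unc_of_le _ _ hh, slack_of_le _ _ hh]
  · have key : ∀ a, |lookahead Q g' h (optVal Q g' (h + 1)) s a -
        lookahead P g h (optVal P g (h + 1)) s a| ≤
        unc Q β h s + slack (1 + 2 / (H : ℝ)) e h := by
      intro a
      refine le_unc_add_slack hQ hβ he h s a ?_ ?_
      · have h1 := norm_lookahead_le hQ hg' h (fun s => abs_optVal_le hQ hg' (h + 1) s) s a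
        have h2 := norm_lookahead_le hP hg h (fun s => abs_optVal_le hP hg (h + 1) s) s a
        have h3 : ((H - h : ℕ) : ℝ) ≤ H := by exact_mod_cast Nat.sub_le _ _
        have := norm_sub_le (lookahead Q g' h (optVal Q g' (h + 1)) s a)
          (lookahead P g h (optVal P g (h + 1)) s a)
        simp only [Real.norm_eq_abs] at *
        linarith
      · refine (hconf h s a).imp_right fun hc => ?_
        have h1 : lookahead Q g' h (optVal Q g' (h + 1)) s a -
            lookahead P g h (optVal P g (h + 1)) s a =
            (lookahead Q g' h (optVal P g (h + 1)) s a -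
            lookahead P g h (optVal P g (h + 1)) s a) +
            ∑ s', Q h s a s' • (optVal Q g' (h + 1) s' - optVal P g (h + 1) s') := by
          simp only [lookahead, smul_sub, Finset.sum_sub_distrib]
          abel
        rw [h1]
        refine (abs_add_le _ _).trans (add_le_add hc ?_)
        refine (hQ.norm_sum_smul_le h s a (F := ℝ) ih).trans (le_mul_of_one_le_left ?_ ?_)
        · exact hQ.sum_mul_nonneg h s a fun s' => add_nonneg (unc_mem hQ hβ _ s').1
            (slack_nonneg hγ he _)
        · have : (0 : ℝ) ≤ 2 / H := by positivity
          linarith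
    obtain ⟨a, ha⟩ := exists_optVal_eq Q g' h s
    obtain ⟨b, hb⟩ := exists_optVal_eq P g h s
    have h1 := lookahead_le_optVal Q g' h s b
    have h2 := lookahead_le_optVal P g h s a
    have h3 := abs_le.1 (key a)
    have h4 := abs_le.1 (key b)
    rw [abs_le]
    constructor <;> linarith

/-- The policy that is greedy for the estimate is nearly optimal. -/
lemma optVal_sub_polVal_le (hH : 0 < H) (hP : SubStoch P) (hQ : SubStoch Q)
    {β₁ β₂ : Fin H → S → A → ℝ} (hβ₁ : ∀ h s a, 0 ≤ β₁ h s a) (hβ₂ : ∀ h s a, 0 ≤ β₂ h s a)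
    (hβ : ∀ h s a, β h s a = β₁ h s a + β₂ h s a)
    (he : ∀ h, 0 ≤ e h) {g g' : Fin H → S → A → ℝ} (hg : ∀ h s a, ‖g h s a‖ ≤ 1)
    (hg' : ∀ h s a, ‖g' h s a‖ ≤ 1) (α : Fin H → S → A)
    (hα : ∀ (h : Fin H) s, optVal Q g' h s = lookahead Q g' h (optVal Q g' (h + 1)) s (α h s))
    (hconf : ∀ h s a, 2 * H ≤ β h s a ∨
      (|lookahead Q g' h (optVal P g (h + 1)) s a -
        lookahead P g h (optVal P g (h + 1)) s a| ≤ β₁ h s a + e h ∧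
      ∀ f : S → ℝ, (∀ s', 0 ≤ f s' ∧ f s' ≤ 2 * H) → ∑ s', P h s a s' * f s' ≤
        (1 + 1 / (H : ℝ)) * ∑ s', Q h s a s' * f s' + β₂ h s a + e h)) (h : ℕ) (s : S) :
    optVal P g h s - polVal P g (detPolicy α) h s ≤
      2 * (unc Q β h s + slack (1 + 2 / (H : ℝ)) e h) := by
  have hγ : (0 : ℝ) ≤ 1 + 2 / (H : ℝ) := by positivity
  have hHr : (0 : ℝ) < H := by exact_mod_cast hH
  have hβ0 : ∀ h s a, 0 ≤ β h s a := fun h s a => by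
    rw [hβ]; exact add_nonneg (hβ₁ h s a) (hβ₂ h s a)
  have hopt := abs_optVal_sub_le hP hQ hβ0 he hg hg' fun h s a =>
    (hconf h s a).imp_right fun hc => hc.1.trans (by
      rw [hβ]; have := hβ₂ h s a; have := he h; linarith)
  have key : ∀ h, ∀ s, optVal Q g' h s - polVal P g (detPolicy α) h s ≤
      unc Q β h s + slack (1 + 2 / (H : ℝ)) e h := by
    intro h
    refine backward_induction (H := H) (Q := fun h => ∀ s, optVal Q g' h s -
        polVal P g (detPolicy α) h s ≤ unc Q β h s + slack (1 + 2 / (H : ℝ)) e h)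
      (fun h hh s => ?_) (fun h ih s => ?_) h
    · simp [optVal_of_le _ _ hh, polVal_of_le _ _ _ hh, unc_of_le _ _ hh, slack_of_le _ _ hh]
    · rw [hα, polVal_detPolicy]
      set a := α h s
      have h3 : ∀ h : ℕ, ((H - h : ℕ) : ℝ) ≤ H := fun h => by exact_mod_cast Nat.sub_le _ _
      refine le_unc_add_slack hQ hβ0 he h s a ?_ ?_
      · have h1 := norm_lookahead_le hQ hg' h (fun s => abs_optVal_le hQ hg' (h + 1) s) s a
        have h2 := norm_lookahead_le hP hg h
          (fun s => norm_polVal_le hP hg (detPolicy α) (h + 1) s) s a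
        have h4 := norm_sub_le (lookahead Q g' h (optVal Q g' (h + 1)) s a)
          (lookahead P g h (polVal P g (detPolicy α) (h + 1)) s a)
        have h5 := le_abs_self (lookahead Q g' h (optVal Q g' (h + 1)) s a -
          lookahead P g h (polVal P g (detPolicy α) (h + 1)) s a)
        have := h3 h
        simp only [Real.norm_eq_abs] at *
        linarith
      · refine (hconf h s a).imp_right fun hc => ?_
        obtain ⟨hc1, hc2⟩ := hc
        set D : S → ℝ := fun s' => optVal P g (h + 1) s' - polVal P g (detPolicy α) (h + 1) s'
        have hD : ∀ s', 0 ≤ D s' ∧ D s' ≤ 2 * H := by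
          intro s'
          have h1 := polVal_le_optVal hP g (detPolicy α) (h + 1) s'
          have h2 := abs_le.1 (abs_optVal_le hP hg (h + 1) s')
          have h4 := abs_le.1 (norm_polVal_le hP hg (detPolicy α) (h + 1) s')
          have := h3 (h + 1)
          constructor <;> simp only [D] <;> linarith
        have hc3 := hc2 D hD
        set B : S → ℝ := fun s' => unc Q β (h + 1) s' + slack (1 + 2 / (H : ℝ)) e (h + 1) with hB
        have hDB : ∀ s', D s' ≤ 2 * B s' := by
          intro s'
          have h1 := (abs_le.1 (hopt (h + 1) s')).1
          have h2 := ih s'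
          simp only [D, hB]
          linarith
        -- The estimated model is tested only on the true optimal value. The function `D` depends on
        -- the data through the greedy policy, so its true mean is instead compared with its
        -- empirical mean up to a relative error 1/H; what remains is the recursive error under `Q`.
        have e1 : lookahead Q g' h (optVal Q g' (h + 1)) s a -
            lookahead P g h (polVal P g (detPolicy α) (h + 1)) s a =
            (lookahead Q g' h (optVal P g (h + 1)) s a -
              lookahead P g h (optVal P g (h + 1)) s a) + ∑ s', P h s a s' * D s' +
            (∑ s', Q h s a s' * (optVal Q g' (h + 1) s' - polVal P g (detPolicy α) (h + 1) s') -
              ∑ s', Q h s a s' * D s') := by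
          simp only [lookahead, D, mul_sub, Finset.sum_sub_distrib, smul_eq_mul]
          ring
        have e2 := hQ.sum_mul_mono h s a ih
        have e3 : ∑ s', Q h s a s' * D s' ≤ 2 * ∑ s', Q h s a s' * B s' := by
          rw [Finset.mul_sum]
          refine Finset.sum_le_sum fun s' _ => ?_
          have := mul_le_mul_of_nonneg_left (hDB s') ((hQ h s a).1 s')
          linarith
        -- Since `D` is at most twice the bound being proved, the relative error 1/H costs 2/H of
        -- that bound: this is the growth factor 1 + 2/H in `unc`.
        have e4 : 1 / (H : ℝ) * ∑ s', Q h s a s' * D s' ≤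
            2 / (H : ℝ) * ∑ s', Q h s a s' * B s' := by
          have := mul_le_mul_of_nonneg_left e3 (by positivity : (0 : ℝ) ≤ 1 / (H : ℝ))
          calc _ ≤ _ := this
            _ = _ := by ring
        have e5 := (abs_le.1 hc1).2
        have e6 := he h
        rw [e1, hβ]
        have e7 : (∑ s', Q h s a s' * B s') = ∑ s', Q h s a s' *
          (unc Q β (h + 1) s' + slack (1 + 2 / (H : ℝ)) e (h + 1)) := rfl
        rw [← e7] at e2 ⊢
        linarith
  have h1 := key h s
  have h2 := (abs_le.1 (hopt h s)).1
  linarith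

/-- The uncertainty at the state `s` is at most a multiple of the expected sum of the bonuses when
one follows a policy that is greedy for the uncertainty. -/
lemma unc_le_polVal (hH : 0 < H) (hP : SubStoch P) (hQ : SubStoch Q)
    {β₁ β₂ : Fin H → S → A → ℝ} (hβ₁ : ∀ h s a, 0 ≤ β₁ h s a) (hβ₂ : ∀ h s a, 0 ≤ β₂ h s a)
    (hβ : ∀ h s a, β h s a = β₁ h s a + β₂ h s a) (he : ∀ h, 0 ≤ e h) (α : Fin H → S → A)
    (hα : ∀ (h : Fin H) s, unc Q β h s = min (2 * (H : ℝ)) (β h s (α h s) +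
      (1 + 2 / (H : ℝ)) * ∑ s', Q h s (α h s) s' * unc Q β (h + 1) s'))
    (hconf : ∀ h s a, 2 * H ≤ β h s a ∨
      ∀ f : S → ℝ, (∀ s', 0 ≤ f s' ∧ f s' ≤ 2 * H) → ∑ s', Q h s a s' * f s' ≤
        (1 + 1 / (H : ℝ)) * ∑ s', P h s a s' * f s' + β₂ h s a + e h) (h : ℕ) :
    ∀ s, unc Q β h s ≤ (1 + 5 / (H : ℝ)) ^ (H - h) *
      polVal P (fun h s a => min (2 * (H : ℝ)) (4 * β h s a)) (detPolicy α) h s +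
      slack (1 + 5 / (H : ℝ)) e h := by
  have hHr : (1 : ℝ) ≤ H := by exact_mod_cast hH
  set ρ : ℝ := 1 + 5 / (H : ℝ) with hρ
  have hρ1 : 1 ≤ ρ := by
    have : (0 : ℝ) ≤ 5 / H := by positivity
    linarith
  set W := polVal P (fun h s a => min (2 * (H : ℝ)) (4 * β h s a)) (detPolicy α) with hW
  have hβ0 : ∀ h s a, 0 ≤ β h s a := fun h s a => by
    rw [hβ]; exact add_nonneg (hβ₁ h s a) (hβ₂ h s a)
  have hW0 : ∀ h, ∀ s, 0 ≤ W h s := by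
    intro h
    refine backward_induction (H := H) (Q := fun h => ∀ s, 0 ≤ W h s)
      (fun h hh s => by rw [hW, polVal_of_le _ _ _ hh]) (fun h ih s => ?_) h
    rw [hW, polVal_detPolicy]
    exact add_nonneg (le_min (by positivity) (by have := hβ0 h s (α h s); positivity))
      (hP.sum_mul_nonneg h s _ ih)
  refine backward_induction (H := H) (Q := fun h => ∀ s, unc Q β h s ≤ ρ ^ (H - h) * W h s +
    slack ρ e h) (fun h hh s => ?_) (fun h ih s => ?_) h
  · simp [hW, polVal_of_le _ _ _ hh, unc_of_le _ _ hh, slack_of_le _ _ hh]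
  · set a := α h s with ha
    have hYm := unc_mem hQ hβ0
    have hpow : ρ ^ (H - (h : ℕ)) = ρ * ρ ^ (H - ((h : ℕ) + 1)) := by
      rw [← pow_succ']
      congr 1
      have := h.2
      omega
    have hpow1 : 1 ≤ ρ ^ (H - (h : ℕ)) := one_le_pow₀ hρ1
    have hWe : W h s = min (2 * (H : ℝ)) (4 * β h s a) + ∑ s', P h s a s' * W (h + 1) s' := by
      rw [hW, polVal_detPolicy]; rfl
    have hs0 := slack_nonneg (by linarith : 0 ≤ ρ) he (h + 1)
    have hmin0 : 0 ≤ min (2 * (H : ℝ)) (4 * β h s a) :=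
      le_min (by positivity) (by have := hβ0 h s a; positivity)
    have hPW : 0 ≤ ∑ s', P h s a s' * W (h + 1) s' := hP.sum_mul_nonneg h s _ (hW0 _)
    suffices hsuff : unc Q β h s ≤ min (2 * (H : ℝ)) (4 * β h s a) + 3 * e h +
        ρ * ∑ s', P h s a s' * unc Q β (h + 1) s' by
      have h1 : ∑ s', P h s a s' * unc Q β (h + 1) s' ≤
          ρ ^ (H - ((h : ℕ) + 1)) * ∑ s', P h s a s' * W (h + 1) s' + slack ρ e (h + 1) := by
        refine (hP.sum_mul_mono h s a ih).trans ?_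
        simp only [mul_add, Finset.sum_add_distrib]
        refine add_le_add (le_of_eq ?_) (hP.sum_mul_le h s a hs0 fun _ => le_rfl)
        rw [Finset.mul_sum]
        exact Finset.sum_congr rfl fun s' _ => by ring
      have h2 := mul_le_mul_of_nonneg_left h1 (by linarith : 0 ≤ ρ)
      have h3 : min (2 * (H : ℝ)) (4 * β h s a) ≤
          ρ ^ (H - (h : ℕ)) * min (2 * (H : ℝ)) (4 * β h s a) := le_mul_of_one_le_left hmin0 hpow1
      rw [hWe, slack_eq, mul_add]
      have h4 : ρ * (ρ ^ (H - ((h : ℕ) + 1)) * ∑ s', P h s a s' * W (h + 1) s') =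
          ρ ^ (H - (h : ℕ)) * ∑ s', P h s a s' * W (h + 1) s' := by rw [hpow]; ring
      linarith
    have hY0 : 0 ≤ ∑ s', P h s a s' * unc Q β (h + 1) s' :=
      hP.sum_mul_nonneg h s a fun s' => (hYm (h + 1) s').1
    have hρY : 0 ≤ ρ * ∑ s', P h s a s' * unc Q β (h + 1) s' := by positivity
    have he' := he h
    rcases hconf h s a with hc | hc
    · have h1 : min (2 * (H : ℝ)) (4 * β h s a) = 2 * H := min_eq_left (by linarith)
      have h2 := (hYm h s).2
      linarith
    · have h1 := hc (unc Q β (h + 1)) (hYm (h + 1))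
      have hγ0 : (0 : ℝ) ≤ 1 + 2 / (H : ℝ) := by positivity
      -- This turns (1 + 2/H)(β₂ + e) into at most 3 β₂ + 3 e, whence the bonus 4 β ≥ β + 3 β₂ of
      -- the statement and the 3 e in `slack`.
      have hγ3 : 1 + 2 / (H : ℝ) ≤ 3 := by
        have : 2 / (H : ℝ) ≤ 2 := div_le_self (by norm_num) hHr
        linarith
      have h2 := mul_le_mul_of_nonneg_left h1 hγ0
      have hb := add_nonneg (hβ₂ h s a) he'
      have h3 : (1 + 2 / (H : ℝ)) * (β₂ h s a + e h) ≤ 3 * (β₂ h s a + e h) :=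
        mul_le_mul_of_nonneg_right hγ3 hb
      -- One factor is from the recursion of `unc`, the other from replacing empirical by true
      -- transitions; 3/H + 2/H² ≤ 5/H.
      have h4 : (1 + 2 / (H : ℝ)) * (1 + 1 / (H : ℝ)) ≤ ρ := by
        have h5 : 1 / (H : ℝ) * (1 / (H : ℝ)) ≤ 1 / (H : ℝ) :=
          mul_le_of_le_one_right (by positivity) (by rw [div_le_one (by linarith)]; exact hHr)
        have h6 : (1 + 2 / (H : ℝ)) * (1 + 1 / (H : ℝ)) =
          1 + 3 * (1 / (H : ℝ)) + 2 * (1 / (H : ℝ) * (1 / (H : ℝ))) := by ring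
        rw [h6, hρ, show 5 / (H : ℝ) = 5 * (1 / (H : ℝ)) by ring]
        linarith
      have h7 := mul_le_mul_of_nonneg_right h4 hY0
      have h8 : (1 + 2 / (H : ℝ)) * ∑ s', Q h s a s' * unc Q β (h + 1) s' ≤
          ρ * ∑ s', P h s a s' * unc Q β (h + 1) s' + 3 * β₂ h s a + 3 * e h := by
        have : (1 + 2 / (H : ℝ)) * ((1 + 1 / (H : ℝ)) * ∑ s', P h s a s' * unc Q β (h + 1) s' +
          β₂ h s a + e h) = (1 + 2 / (H : ℝ)) * (1 + 1 / (H : ℝ)) *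
          ∑ s', P h s a s' * unc Q β (h + 1) s' + (1 + 2 / (H : ℝ)) * (β₂ h s a + e h) := by ring
        linarith
      rw [hα h s, ← ha]
      have hb1 := hβ h s a
      have hb2 := hβ₁ h s a
      rw [add_assoc, ← sub_le_iff_le_add]
      refine le_min ?_ ?_
      · have := min_le_left (2 * (H : ℝ))
          (β h s a + (1 + 2 / (H : ℝ)) * ∑ s', Q h s a s' * unc Q β (h + 1) s')
        linarith
      · have := min_le_right (2 * (H : ℝ))
          (β h s a + (1 + 2 / (H : ℝ)) * ∑ s', Q h s a s' * unc Q β (h + 1) s')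
        linarith

end Planning

/-! ### Exponential supermartingales for averages and frequencies -/

section Concentration

/-- The function x ↦ cosh √x is a power series with nonnegative coefficients, so its convexity
follows term by term from that of x ↦ x ^ n. -/
lemma cosh_le_of_sq_eq {v p q w : ℝ} (hw : 0 ≤ w) (hw1 : w ≤ 1)
    (h : v ^ 2 = w * p ^ 2 + (1 - w) * q ^ 2) :
    Real.cosh v ≤ w * Real.cosh p + (1 - w) * Real.cosh q := by
  have h1 := Real.hasSum_cosh v
  have h2 := ((Real.hasSum_cosh p).mul_left w).add ((Real.hasSum_cosh q).mul_left (1 - w))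
  refine hasSum_le (fun n => ?_) h1 h2
  have h3 : (v ^ 2) ^ n ≤ w * (p ^ 2) ^ n + (1 - w) * (q ^ 2) ^ n := by
    rw [h]
    exact (convexOn_pow n).2 (Set.mem_Ici.2 (sq_nonneg p)) (Set.mem_Ici.2 (sq_nonneg q)) hw
      (by linarith) (by ring)
  have h4 : (0 : ℝ) < ((2 * n).factorial : ℝ) := by positivity
  rw [pow_mul, pow_mul, pow_mul, ← mul_div_assoc, ← mul_div_assoc, ← add_div]
  gcongr

/-- Up to a = 1 the left side is at most 1 + a²; beyond, a ≤ a². -/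
lemma exp_sub_self_le_exp_sq {a : ℝ} (ha : 0 ≤ a) : Real.exp a - a ≤ Real.exp (a ^ 2) := by
  rcases le_or_gt a 1 with h | h
  · have h1 := (abs_le.1 (Real.abs_exp_sub_one_sub_id_le (x := a) (by rw [abs_of_nonneg ha]; exact h))).2
    have h2 := Real.add_one_le_exp (a ^ 2)
    linarith
  · have : Real.exp a ≤ Real.exp (a ^ 2) := Real.exp_le_exp.2 (by nlinarith)
    linarith

lemma exp_sub_self_mono {b a : ℝ} (hb : 0 ≤ b) (h : b ≤ a) :
    Real.exp b - b ≤ Real.exp a - a := by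
  have h1 : Real.exp a = Real.exp b * Real.exp (a - b) := by rw [← Real.exp_add]; ring_nf
  have h2 := Real.add_one_le_exp (a - b)
  have h3 := Real.one_le_exp hb
  nlinarith

variable {F : Type*} [NormedAddCommGroup F] [InnerProductSpace ℝ F]

/-- The second summand on the right is linear in y and disappears in the mean when y is centred, so
cosh of the norm of a sum of centred bounded vectors grows by a factor exp ((c b)²) per step, in
every inner product space. This makes the later bounds free of the dimension. -/
lemma cosh_norm_add_le (z y : F) {c b : ℝ} (hc : 0 ≤ c) (hy : ‖y‖ ≤ b) :
    Real.cosh (c * ‖z + y‖) ≤ Real.exp ((c * b) ^ 2) * Real.cosh (c * ‖z‖) +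
      Real.sinh (c * ‖z‖) * c / ‖z‖ * inner ℝ z y := by
  have hb : 0 ≤ b := (norm_nonneg y).trans hy
  have hcb : 1 ≤ Real.exp ((c * b) ^ 2) := Real.one_le_exp (sq_nonneg _)
  by_cases hz : z = 0
  · subst hz
    simp only [zero_add, norm_zero, mul_zero, Real.cosh_zero, mul_one, div_zero, zero_mul, add_zero]
    refine (Real.cosh_le_exp_half_sq _).trans (Real.exp_le_exp.2 ?_)
    have : (c * ‖y‖) ^ 2 ≤ (c * b) ^ 2 := by gcongr
    have := sq_nonneg (c * ‖y‖)
    linarith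
  by_cases hy0 : y = 0
  · subst hy0
    simp only [add_zero, inner_zero_right, mul_zero]
    exact le_mul_of_one_le_left (Real.cosh_pos _).le hcb
  have hzn : 0 < ‖z‖ := norm_pos_iff.2 hz
  have hyn : 0 < ‖y‖ := norm_pos_iff.2 hy0
  set t := inner ℝ z y / (‖z‖ * ‖y‖) with ht
  have htn : inner ℝ z y = t * (‖z‖ * ‖y‖) := by rw [ht]; field_simp
  have ht1 : |t| ≤ 1 := abs_real_inner_div_norm_mul_norm_le_one z y
  obtain ⟨ht2, ht3⟩ := abs_le.1 ht1
  -- With t the cosine of the angle between z and y, ‖z + y‖² is the combination of (‖z‖ + ‖y‖)² and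
  -- (‖z‖ - ‖y‖)² with weights (1 + t)/2 and (1 - t)/2.
  have h1 := cosh_le_of_sq_eq (v := c * ‖z + y‖) (p := c * ‖z‖ + c * ‖y‖)
    (q := c * ‖z‖ - c * ‖y‖) (w := (1 + t) / 2) (by linarith) (by linarith) (by
      rw [mul_pow, @norm_add_sq_real, htn]; ring)
  have h2 : (1 + t) / 2 * Real.cosh (c * ‖z‖ + c * ‖y‖) +
      (1 - (1 + t) / 2) * Real.cosh (c * ‖z‖ - c * ‖y‖) =
      Real.cosh (c * ‖z‖) * Real.cosh (c * ‖y‖) +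
        t * (Real.sinh (c * ‖z‖) * Real.sinh (c * ‖y‖)) := by
    rw [Real.cosh_add, Real.cosh_sub]; ring
  have hcz : 0 ≤ c * ‖z‖ := by positivity
  have hcy : 0 ≤ c * ‖y‖ := by positivity
  have hs0 : 0 ≤ Real.sinh (c * ‖z‖) := Real.sinh_nonneg_iff.2 hcz
  have hs1 : Real.sinh (c * ‖z‖) ≤ Real.cosh (c * ‖z‖) := by
    rw [← sub_nonneg, Real.cosh_sub_sinh]; positivity
  have hs2 : 0 ≤ Real.sinh (c * ‖y‖) - c * ‖y‖ := sub_nonneg.2 (Real.self_le_sinh_iff.2 hcy)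
  have h3 : t * (Real.sinh (c * ‖z‖) * (Real.sinh (c * ‖y‖) - c * ‖y‖)) ≤
      Real.cosh (c * ‖z‖) * (Real.sinh (c * ‖y‖) - c * ‖y‖) := by
    calc _ ≤ 1 * (Real.sinh (c * ‖z‖) * (Real.sinh (c * ‖y‖) - c * ‖y‖)) := by gcongr
      _ ≤ _ := by rw [one_mul]; gcongr
  have h4 : Real.cosh (c * ‖y‖) + Real.sinh (c * ‖y‖) = Real.exp (c * ‖y‖) :=
    Real.cosh_add_sinh _
  have h5 : Real.exp (c * ‖y‖) - c * ‖y‖ ≤ Real.exp ((c * b) ^ 2) :=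
    (exp_sub_self_mono hcy (by gcongr)).trans (exp_sub_self_le_exp_sq (by positivity))
  have h6 := mul_le_mul_of_nonneg_left h5 (Real.cosh_pos (c * ‖z‖)).le
  have h7 : Real.sinh (c * ‖z‖) * c / ‖z‖ * inner ℝ z y =
      t * (Real.sinh (c * ‖z‖) * (c * ‖y‖)) := by rw [htn]; field_simp
  rw [h7]
  rw [h2] at h1
  have h8 : Real.cosh (c * ‖z‖) * (Real.exp (c * ‖y‖) - c * ‖y‖) = Real.cosh (c * ‖z‖) *
      Real.cosh (c * ‖y‖) + Real.cosh (c * ‖z‖) * (Real.sinh (c * ‖y‖) - c * ‖y‖) := by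
    rw [← h4]; ring
  linarith

variable {X : Type*} [MeasurableSpace X] (ν : Measure X) [IsProbabilityMeasure ν]

lemma lintegral_cosh_le [CompleteSpace F] {f : X → F} (hf : StronglyMeasurable f) {R : ℝ}
    (hR : ∀ x, ‖f x‖ ≤ R) {c : ℝ} (hc : 0 ≤ c) (z : F) :
    ∫⁻ x, ENNReal.ofReal (Real.cosh (c * ‖z + (f x - ∫ y, f y ∂ν)‖)) ∂ν ≤
      ENNReal.ofReal (Real.exp ((c * (2 * R)) ^ 2) * Real.cosh (c * ‖z‖)) := by
  set m := ∫ y, f y ∂ν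
  have hint : Integrable f ν := Integrable.of_bound hf.aestronglyMeasurable R
    (Filter.Eventually.of_forall hR)
  have hm : ‖m‖ ≤ R := by
    have := norm_integral_le_of_norm_le_const (μ := ν) (Filter.Eventually.of_forall hR)
    simpa using this
  have hy : ∀ x, ‖f x - m‖ ≤ 2 * R := fun x => (norm_sub_le _ _).trans (by linarith [hR x])
  set K := Real.exp ((c * (2 * R)) ^ 2) * Real.cosh (c * ‖z‖)
  set w := Real.sinh (c * ‖z‖) * c / ‖z‖
  have hpt : ∀ x, Real.cosh (c * ‖z + (f x - m)‖) ≤ K + w * inner ℝ z (f x - m) :=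
    fun x => cosh_norm_add_le z (f x - m) hc (hy x)
  have hint2 : Integrable (fun x => f x - m) ν := hint.sub (integrable_const m)
  have hint3 : Integrable (fun x => w * inner ℝ z (f x - m)) ν :=
    (Integrable.const_inner z hint2).const_mul w
  calc _ ≤ ∫⁻ x, ENNReal.ofReal (K + w * inner ℝ z (f x - m)) ∂ν :=
        lintegral_mono fun x => ENNReal.ofReal_le_ofReal (hpt x)
    _ = ENNReal.ofReal (∫ x, (K + w * inner ℝ z (f x - m)) ∂ν) := by
        refine (ofReal_integral_eq_lintegral_ofReal ((integrable_const K).add hint3) ?_).symm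
        exact Filter.Eventually.of_forall fun x => (Real.cosh_pos _).le.trans (hpt x)
    _ = ENNReal.ofReal K := by
        congr 1
        have h4 : ∫ x, w * inner ℝ z (f x - m) ∂ν = 0 := by
          rw [integral_const_mul, integral_inner hint2, integral_sub hint (integrable_const m)]
          simp [m]
        rw [integral_add (integrable_const K) hint3, h4]
        simp

/-- The sum of `f` over a list, with the mean subtracted. -/
noncomputable def centeredSum (f : X → F) (l : List X) : F :=
  (l.map fun x => f x - ∫ y, f y ∂ν).sum

/-- The exponential supermartingale for the mean of a bounded function. -/
noncomputable def coshPotential (f : X → F) (R c : ℝ) (l : List X) : ENNReal :=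
  ENNReal.ofReal (Real.cosh (c * ‖centeredSum ν f l‖) *
    Real.exp (-((c * (2 * R)) ^ 2 * l.length)))

lemma coshPotential_nil (f : X → F) (R c : ℝ) : coshPotential ν f R c [] = 1 := by
  simp [coshPotential, centeredSum]

lemma lintegral_coshPotential_le [CompleteSpace F] {f : X → F} (hf : StronglyMeasurable f) {R : ℝ}
    (hR : ∀ x, ‖f x‖ ≤ R) {c : ℝ} (hc : 0 ≤ c) (l : List X) :
    ∫⁻ x, coshPotential ν f R c (l ++ [x]) ∂ν ≤ coshPotential ν f R c l := by
  set E := Real.exp (-((c * (2 * R)) ^ 2 * ((l.length : ℝ) + 1))) with hE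
  have h1 : ∀ x, coshPotential ν f R c (l ++ [x]) =
      ENNReal.ofReal (Real.cosh (c * ‖centeredSum ν f l + (f x - ∫ y, f y ∂ν)‖)) *
      ENNReal.ofReal E := by
    intro x
    rw [coshPotential, ENNReal.ofReal_mul (Real.cosh_pos _).le]
    simp [centeredSum, hE]
  simp_rw [h1]
  rw [lintegral_mul_const' _ _ ENNReal.ofReal_ne_top]
  calc _ ≤ ENNReal.ofReal (Real.exp ((c * (2 * R)) ^ 2) * Real.cosh (c * ‖centeredSum ν f l‖)) *
        ENNReal.ofReal E := by gcongr; exact lintegral_cosh_le ν hf hR hc _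
    _ = coshPotential ν f R c l := by
        rw [← ENNReal.ofReal_mul (mul_nonneg (Real.exp_pos _).le (Real.cosh_pos _).le),
          coshPotential]
        congr 1
        rw [mul_comm (Real.exp _), mul_assoc, hE, ← Real.exp_add]
        congr 2
        ring

open Classical in
/-- The number of elements of a list in `I`. -/
noncomputable def countIn (I : Set X) (l : List X) : ℝ :=
  (l.map fun x => if x ∈ I then (1 : ℝ) else 0).sum

/-- The exponential supermartingale for a count. -/
noncomputable def countPotential (I : Set X) (c : ℝ) (l : List X) : ENNReal :=
  ENNReal.ofReal (Real.exp (c * countIn I l - (Real.exp c - 1) * ν.real I * l.length))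

lemma countPotential_nil (I : Set X) (c : ℝ) : countPotential ν I c [] = 1 := by
  simp [countPotential, countIn]

/-- The moment generating function of an indicator is 1 + (exp c - 1) p ≤ exp ((exp c - 1) p). The
sign of c is free: positive c controls frequencies that are too large, negative c those that are too
small. -/
lemma lintegral_countPotential_le {I : Set X} (hI : MeasurableSet I) (c : ℝ) (l : List X) :
    ∫⁻ x, countPotential ν I c (l ++ [x]) ∂ν ≤ countPotential ν I c l := by
  classical
  set p := ν.real I
  have h0 : ∫⁻ x, ENNReal.ofReal (Real.exp (c * if x ∈ I then (1 : ℝ) else 0)) ∂ν ≤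
      ENNReal.ofReal (Real.exp ((Real.exp c - 1) * p)) := by
    have h1 : ∀ x, Real.exp (c * if x ∈ I then (1 : ℝ) else 0) =
        1 + (Real.exp c - 1) * I.indicator 1 x := by
      intro x
      by_cases hx : x ∈ I <;> simp [hx]
    have hint : Integrable (fun x => (1 : ℝ) + (Real.exp c - 1) * I.indicator 1 x) ν :=
      (integrable_const _).add (((integrable_const (1 : ℝ)).indicator hI).const_mul _)
    simp_rw [h1]
    rw [← ofReal_integral_eq_lintegral_ofReal hint]
    · refine ENNReal.ofReal_le_ofReal ?_
      have h3 : Integrable (fun x => (Real.exp c - 1) * I.indicator (1 : X → ℝ) x) ν :=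
        ((integrable_const (1 : ℝ)).indicator hI).const_mul _
      rw [integral_add (integrable_const _) h3, integral_const_mul, integral_indicator_one hI]
      simp only [integral_const, probReal_univ, smul_eq_mul, mul_one]
      have := Real.add_one_le_exp ((Real.exp c - 1) * p)
      linarith
    · refine Filter.Eventually.of_forall fun x => ?_
      show 0 ≤ 1 + (Real.exp c - 1) * I.indicator 1 x
      rw [← h1]; positivity
  set E := Real.exp (c * countIn I l - (Real.exp c - 1) * p * ((l.length : ℝ) + 1)) with hE
  have h1 : ∀ x, countPotential ν I c (l ++ [x]) =
      ENNReal.ofReal (Real.exp (c * if x ∈ I then (1 : ℝ) else 0)) * ENNReal.ofReal E := by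
    intro x
    rw [countPotential, ← ENNReal.ofReal_mul (Real.exp_pos _).le, hE, ← Real.exp_add]
    simp only [countIn, List.map_append, List.map_cons, List.map_nil, List.sum_append,
      List.sum_cons, List.sum_nil, List.length_append, List.length_cons, List.length_nil]
    congr 2
    push_cast
    ring
  simp_rw [h1]
  rw [lintegral_mul_const' _ _ ENNReal.ofReal_ne_top]
  calc _ ≤ ENNReal.ofReal (Real.exp ((Real.exp c - 1) * p)) * ENNReal.ofReal E := by gcongr
    _ = countPotential ν I c l := by
        rw [← ENNReal.ofReal_mul (Real.exp_pos _).le, countPotential, hE, ← Real.exp_add]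
        congr 2
        ring

/-- The mean of `f` over a list. -/
noncomputable def emp (f : X → F) (l : List X) : F := (l.length : ℝ)⁻¹ • (l.map f).sum

lemma emp_sub_integral {f : X → F} {l : List X} (hl : l ≠ []) :
    emp f l - ∫ y, f y ∂ν = (l.length : ℝ)⁻¹ • centeredSum ν f l := by
  have h1 : ∀ l : List X, centeredSum ν f l = (l.map f).sum - (l.length : ℝ) • ∫ y, f y ∂ν := by
    intro l
    induction l with
    | nil => simp [centeredSum]
    | cons x l ih =>
      have : centeredSum ν f (x :: l) = (f x - ∫ y, f y ∂ν) + centeredSum ν f l := by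
        simp [centeredSum]
      rw [this, ih]
      simp only [List.map_cons, List.sum_cons, List.length_cons, Nat.cast_add, Nat.cast_one,
        add_smul, one_smul]
      abel
  have h2 : (l.length : ℝ) ≠ 0 := by simpa using hl
  rw [h1, smul_sub, smul_smul, inv_mul_cancel₀ h2, one_smul]
  rfl

/-- The excess is bounded through x ≤ exp (a x) / a with a = n c. Unlike a tail bound, this controls
the mean of the excess, which can be summed over batches of all sizes. -/
lemma ofReal_excess_le (f : X → F) {R : ℝ} (hR : 0 < R) {Λ : ℝ} (hΛ : 1 ≤ Λ) {l : List X}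
    (hl : l ≠ []) :
    ENNReal.ofReal (‖emp f l - ∫ y, f y ∂ν‖ - 4 * R * √(Λ / l.length)) ≤
      ENNReal.ofReal (4 * R / √l.length * Real.exp (-Λ)) *
        coshPotential ν f R (√(Λ / l.length) / (2 * R)) l := by
  have hn : (0 : ℝ) < l.length := by exact_mod_cast List.length_pos_iff.2 hl
  set n : ℝ := (l.length : ℝ) with hnn
  set r := √(Λ / n) with hr
  have hr0 : 0 < r := Real.sqrt_pos.2 (by positivity)
  have hr2 : r ^ 2 = Λ / n := Real.sq_sqrt (by positivity)
  set c := r / (2 * R) with hcdef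
  have hc : 0 < c := by positivity
  rw [coshPotential, ← ENNReal.ofReal_mul (by positivity)]
  refine ENNReal.ofReal_le_ofReal ?_
  rw [emp_sub_integral ν hl, norm_smul, norm_inv, Real.norm_of_nonneg hn.le]
  set Z := ‖centeredSum ν f l‖
  have h1 : (c * (2 * R)) ^ 2 * n = Λ := by
    have : c * (2 * R) = r := by rw [hcdef]; field_simp
    rw [this, hr2]; field_simp
  rw [h1]
  -- The threshold 4 R r is set so that n c · 4 R r = 2 Λ: one Λ pays for the normalisation of the
  -- potential, the other survives as exp (-Λ).
  have h2 : n⁻¹ * Z - 4 * R * r ≤ 1 / (n * c) * Real.exp (c * Z - 2 * Λ) := by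
    have h3 : c * Z - 2 * Λ = (n * c) * (n⁻¹ * Z - 4 * R * r) := by
      have : n * c * (4 * R * r) = 2 * Λ := by
        have h5 : n * c * (4 * R * r) = 2 * (n * r ^ 2) := by rw [hcdef]; field_simp; ring
        rw [h5, hr2]; field_simp
      rw [mul_sub, this]; field_simp
    rw [h3, one_div, inv_mul_eq_div (n * c), le_div_iff₀ (by positivity)]
    have := Real.add_one_le_exp (n * c * (n⁻¹ * Z - 4 * R * r))
    linarith
  refine h2.trans ?_
  have h4 : Real.exp (c * Z) ≤ 2 * Real.cosh (c * Z) := by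
    rw [Real.cosh_eq]
    have := Real.exp_pos (-(c * Z))
    linarith
  have h5 : 1 / (n * c) * 2 ≤ 4 * R / √n := by
    have h6 : √n ≤ n * r := by
      have h7 : √n * √Λ = n * r := by
        rw [hr, Real.sqrt_div (by positivity)]
        have : n = √n * √n := (Real.mul_self_sqrt hn.le).symm
        have h8 : 0 < √n := Real.sqrt_pos.2 hn
        field_simp
        rw [Real.sq_sqrt hn.le]
      rw [← h7]
      exact le_mul_of_one_le_right (Real.sqrt_nonneg _) (Real.one_le_sqrt.2 hΛ)
    have h8 : 0 < √n := Real.sqrt_pos.2 hn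
    rw [hcdef]
    have : 1 / (n * (r / (2 * R))) * 2 = 4 * R / (n * r) := by field_simp; ring
    rw [this]
    gcongr
  calc 1 / (n * c) * Real.exp (c * Z - 2 * Λ)
      = 1 / (n * c) * (Real.exp (c * Z) * (Real.exp (-Λ) * Real.exp (-Λ))) := by
        rw [← Real.exp_add, ← Real.exp_add]; congr 2; ring
    _ ≤ 1 / (n * c) * (2 * Real.cosh (c * Z) * (Real.exp (-Λ) * Real.exp (-Λ))) := by gcongr
    _ = 1 / (n * c) * 2 * (Real.exp (-Λ) * (Real.cosh (c * Z) * Real.exp (-Λ))) := by ring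
    _ ≤ 4 * R / √n * (Real.exp (-Λ) * (Real.cosh (c * Z) * Real.exp (-Λ))) := by
        have := Real.cosh_pos (c * Z)
        gcongr
    _ = _ := by ring

/-- With the parameter 1/T, exp (1/T) - 1 ≤ (1/T)(1 + 1/T): a relative error 1/T in the probability
is traded for an additive error of order 1/n in place of 1/√n. It is used with T = H. -/
lemma ofReal_count_excess_le (I : Set X) {T : ℝ} (hT : 1 ≤ T) (Λ : ℝ) {l : List X}
    (hl : l ≠ []) :
    ENNReal.ofReal (countIn I l / l.length - (1 + 1 / T) * ν.real I - T * Λ / l.length) ≤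
      ENNReal.ofReal (T / l.length * Real.exp (-Λ)) * countPotential ν I (1 / T) l := by
  have hn : (0 : ℝ) < l.length := by exact_mod_cast List.length_pos_iff.2 hl
  set n : ℝ := (l.length : ℝ)
  have hT0 : 0 < T := by linarith
  set c := 1 / T with hc
  have hc0 : 0 < c := by positivity
  have hc1 : c ≤ 1 := by rw [hc, div_le_one hT0]; exact hT
  rw [countPotential, ← ENNReal.ofReal_mul (by positivity)]
  refine ENNReal.ofReal_le_ofReal ?_
  set p := ν.real I
  have hp : 0 ≤ p := measureReal_nonneg
  set N := countIn I l
  set x := N / n - (1 + c) * p - T * Λ / n with hx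
  have h1 : x ≤ T / n * Real.exp (n / T * x) := by
    have := Real.add_one_le_exp (n / T * x)
    have h3 : x = T / n * (n / T * x) := by field_simp
    nth_rewrite 1 [h3]
    gcongr
    linarith
  refine h1.trans ?_
  rw [mul_assoc, ← Real.exp_add]
  gcongr
  have h2 : Real.exp c - 1 ≤ c * (1 + c) := by
    have := (abs_le.1 (Real.abs_exp_sub_one_sub_id_le (x := c)
      (by rw [abs_of_nonneg hc0.le]; exact hc1))).2
    nlinarith
  have h3 : n / T * x = c * N - c * (1 + c) * p * n - Λ := by
    rw [hx, hc]; field_simp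
  rw [h3]
  have h4 : (Real.exp c - 1) * p * n ≤ c * (1 + c) * p * n := by gcongr
  linarith

/-- The counterpart with parameter -1/T, from 1 - exp (-c) ≥ c / (1 + c). -/
lemma ofReal_count_deficit_le (I : Set X) {T : ℝ} (hT : 1 ≤ T) (Λ : ℝ) {l : List X}
    (hl : l ≠ []) :
    ENNReal.ofReal (ν.real I / (1 + 1 / T) - countIn I l / l.length - T * Λ / l.length) ≤
      ENNReal.ofReal (T / l.length * Real.exp (-Λ)) * countPotential ν I (-(1 / T)) l := by
  have hn : (0 : ℝ) < l.length := by exact_mod_cast List.length_pos_iff.2 hl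
  set n : ℝ := (l.length : ℝ)
  have hT0 : 0 < T := by linarith
  set c := 1 / T with hc
  have hc0 : 0 < c := by positivity
  rw [countPotential, ← ENNReal.ofReal_mul (by positivity)]
  refine ENNReal.ofReal_le_ofReal ?_
  set p := ν.real I
  have hp : 0 ≤ p := measureReal_nonneg
  set N := countIn I l
  set x := p / (1 + c) - N / n - T * Λ / n with hx
  have h1 : x ≤ T / n * Real.exp (n / T * x) := by
    have := Real.add_one_le_exp (n / T * x)
    have h3 : x = T / n * (n / T * x) := by field_simp
    nth_rewrite 1 [h3]
    gcongr
    linarith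
  refine h1.trans ?_
  rw [mul_assoc, ← Real.exp_add]
  gcongr
  have h2 : c / (1 + c) ≤ 1 - Real.exp (-c) := by
    have h5 : Real.exp (-c) ≤ 1 / (1 + c) := by
      rw [Real.exp_neg, ← one_div]
      have := Real.add_one_le_exp c
      gcongr
      linarith
    have h6 : c / (1 + c) = 1 - 1 / (1 + c) := by field_simp; ring
    linarith
  have h3 : n / T * x = c / (1 + c) * p * n - c * N - Λ := by
    rw [hx, hc]; field_simp
  rw [h3]
  have h4 : c / (1 + c) * p * n ≤ (1 - Real.exp (-c)) * p * n := by gcongr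
  linarith

end Concentration

/-! ### Sums over dyadic scales -/

section DyadicSums

/-- The right side telescopes along y, y/2, y/4, …, which bounds the sum over all scales
independently of the starting point. -/
lemma mul_exp_neg_le (y : ℝ) :
    y * Real.exp (-y) ≤ 2 * (Real.exp (-(y / 2)) - Real.exp (-y)) := by
  have h1 : Real.exp (-(y / 2)) = Real.exp (-y) * Real.exp (y / 2) := by
    rw [← Real.exp_add]; congr 1; ring
  have h2 := Real.add_one_le_exp (y / 2)
  have h3 := Real.exp_pos (-y)
  rw [h1]
  nlinarith

lemma tsum_ofReal_le {f : ℕ → ℝ} (hf : ∀ j, 0 ≤ f j) {c : ℝ}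
    (h : ∀ J, ∑ j ∈ Finset.range J, f j ≤ c) : ∑' j, ENNReal.ofReal (f j) ≤ ENNReal.ofReal c := by
  refine ENNReal.tsum_le_of_sum_range_le fun J => ?_
  rw [← ENNReal.ofReal_sum_of_nonneg fun j _ => hf j]
  exact ENNReal.ofReal_le_ofReal (h J)

lemma sum_mul_exp_neg_le (T : ℝ) (J : ℕ) :
    ∑ j ∈ Finset.range J, T / 2 ^ j * Real.exp (-(T / 2 ^ j)) ≤ 2 := by
  have h1 : ∀ J, ∑ j ∈ Finset.range J, T / 2 ^ j * Real.exp (-(T / 2 ^ j)) ≤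
      2 * (Real.exp (-(T / 2 ^ J)) - Real.exp (-T)) := by
    intro J
    induction J with
    | zero => simp
    | succ J ih =>
      rw [Finset.sum_range_succ]
      have h2 := mul_exp_neg_le (T / 2 ^ J)
      have h3 : T / 2 ^ (J + 1) = T / 2 ^ J / 2 := by rw [pow_succ]; field_simp
      rw [h3]
      linarith
  rcases le_or_gt 0 T with hT | hT
  · have h2 : Real.exp (-(T / 2 ^ J)) ≤ 1 := Real.exp_le_one_iff.2 (by
      have : 0 ≤ T / 2 ^ J := by positivity
      linarith)
    have := h1 J
    have := Real.exp_pos (-T)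
    linarith
  · refine (Finset.sum_nonpos fun j _ => ?_).trans (by norm_num)
    exact mul_nonpos_of_nonpos_of_nonneg (div_nonpos_of_nonpos_of_nonneg hT.le (by positivity))
      (Real.exp_pos _).le

/-- Since (y/2) exp (-y/2) ≤ 1, half of the exponential absorbs one power of y and the previous sum
applies with T/2. -/
lemma sum_sq_mul_exp_neg_le {T : ℝ} (hT : 0 ≤ T) (J : ℕ) :
    ∑ j ∈ Finset.range J, (T / 2 ^ j) ^ 2 * Real.exp (-(T / 2 ^ j)) ≤ 8 := by
  have h1 : ∀ y : ℝ, 0 ≤ y → y ^ 2 * Real.exp (-y) ≤ 4 * (y / 2 * Real.exp (-(y / 2))) := by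
    intro y hy
    have h2 : Real.exp (-y) = Real.exp (-(y / 2)) * Real.exp (-(y / 2)) := by
      rw [← Real.exp_add]; congr 1; ring
    have h3 : y / 2 * Real.exp (-(y / 2)) ≤ 1 := by
      rw [Real.exp_neg, ← div_eq_mul_inv, div_le_one (Real.exp_pos _)]
      have := Real.add_one_le_exp (y / 2)
      linarith
    have h4 : 0 ≤ y / 2 * Real.exp (-(y / 2)) := by positivity
    calc y ^ 2 * Real.exp (-y) = 4 * ((y / 2 * Real.exp (-(y / 2))) *
          (y / 2 * Real.exp (-(y / 2)))) := by rw [h2]; ring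
      _ ≤ 4 * (y / 2 * Real.exp (-(y / 2))) := by nlinarith
  calc _ ≤ ∑ j ∈ Finset.range J, 4 * ((T / 2) / 2 ^ j * Real.exp (-((T / 2) / 2 ^ j))) := by
        refine Finset.sum_le_sum fun j _ => ?_
        rw [div_right_comm T 2]
        exact h1 _ (by positivity)
    _ ≤ 8 := by
        rw [← Finset.mul_sum]
        linarith [sum_mul_exp_neg_le (T / 2) J]

end DyadicSums

/-! ### Learners acting on coded histories; supermartingales along a run -/

section Histories

variable {S A O : Type*} {H : ℕ}

/-- The data of an episode, with the observations replaced by their codes. -/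
def digest (q : O → ℕ) (τ : Traj S A O H) : Traj S A ℕ H :=
  fun h => ((τ h).1, (τ h).2.1, q (τ h).2.2)

/-- The list of the digests of a run. -/
def hist (q : O → ℕ) {k : ℕ} (D : Fin k → Traj S A O H) : List (Traj S A ℕ H) :=
  List.ofFn fun i => digest q (D i)

lemma hist_snoc (q : O → ℕ) {k : ℕ} (D : Fin k → Traj S A O H) (τ : Traj S A O H) :
    hist q (Fin.snoc D τ : Fin (k + 1) → Traj S A O H) = hist q D ++ [digest q τ] := by
  simp only [hist]
  rw [List.ofFn_succ']
  simp

lemma length_hist (q : O → ℕ) {k : ℕ} (D : Fin k → Traj S A O H) : (hist q D).length = k := by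
  simp [hist]

lemma sampleAt_digest (q : O → ℕ) (s₀ : S) (τ : Traj S A O H) (h : Fin H) :
    sampleAt s₀ (digest q τ) h = Prod.map q id (sampleAt s₀ τ h) := rfl

/-- The episodes `K₀, …, K₀ + K - 1` of a run. -/
def window {T : Type*} (K₀ K : ℕ) (l : List T) : List T := (l.drop K₀).take K

open Classical in
/-- The samples at `(h, s, a)`, in the order in which they were observed. -/
noncomputable def samples (s₀ : S) (l : List (Traj S A ℕ H)) (h : Fin H) (s : S) (a : A) :
    List (ℕ × S) :=
  l.filterMap fun τ => if (τ h).1 = s ∧ (τ h).2.1 = a then some (sampleAt s₀ τ h) else none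

open Classical in
lemma samples_append_singleton (s₀ : S) (l : List (Traj S A ℕ H)) (τ : Traj S A ℕ H) (h : Fin H)
    (s : S) (a : A) : samples s₀ (l ++ [τ]) h s a =
      if (τ h).1 = s ∧ (τ h).2.1 = a then samples s₀ l h s a ++ [sampleAt s₀ τ h]
      else samples s₀ l h s a := by
  unfold samples
  rw [List.filterMap_append]
  split_ifs with hc <;> simp [hc]

variable [Fintype S] [Fintype A] [MeasurableSpace S] [DiscreteMeasurableSpace S]
  [MeasurableSpace A] [DiscreteMeasurableSpace A] [MeasurableSpace O]

lemma measurable_digest {q : O → ℕ} (hq : Measurable q) :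
    Measurable (digest q : Traj S A O H → Traj S A ℕ H) := by
  unfold digest
  fun_prop

/-- Coded histories of a given length form a countable discrete space, so every function of them is
measurable. This is why observations are coded by natural numbers: planning, selection and choice of
prefixes need no further measurability argument. -/
lemma measurable_comp_hist {β : Type*} [MeasurableSpace β] {q : O → ℕ} (hq : Measurable q)
    (f : List (Traj S A ℕ H) → β) (k : ℕ) :
    Measurable fun D : Fin k → Traj S A O H => f (hist q D) := by
  have h1 : Measurable fun D : Fin k → Traj S A O H => fun i => digest q (D i) :=
    measurable_pi_lambda _ fun i => (measurable_digest hq).comp (measurable_pi_apply i)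
  have h2 : Measurable fun E : Fin k → Traj S A ℕ H => f (List.ofFn E) := measurable_of_countable _
  exact h2.comp h1

lemma measurable_comp_digest {β : Type*} [MeasurableSpace β] {q : O → ℕ} (hq : Measurable q)
    (f : Traj S A ℕ H → β) : Measurable fun τ : Traj S A O H => f (digest q τ) :=
  (measurable_of_countable f).comp (measurable_digest hq)

/-- The learner that runs `pol l` and outputs `out l` when the digest of its data is `l`. -/
noncomputable def policyLearner {q : O → ℕ} (hq : Measurable q)
    (pol : List (Traj S A ℕ H) → Policy S A H)
    (out : List (Traj S A ℕ H) → ProbabilityMeasure (Policy S A H)) (m : ℕ) :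
    Learner S A O H m where
  explore k := Kernel.deterministic (fun D => pol (hist q D)) (measurable_comp_hist hq pol k)
  output := ⟨fun D => (out (hist q D) : Measure (Policy S A H)),
    measurable_comp_hist hq (fun l => (out l : Measure (Policy S A H))) m⟩
  explore_markov _ := inferInstance
  output_markov := ⟨fun D => (out (hist q D)).2⟩

variable {q : O → ℕ} (hq : Measurable q) (M : Env S A O H)
  (pol : List (Traj S A ℕ H) → Policy S A H)
  (out : List (Traj S A ℕ H) → ProbabilityMeasure (Policy S A H)) (m : ℕ)

lemma lintegral_runLaw_succ (Ψ : List (Traj S A ℕ H) → ENNReal) (k : ℕ) :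
    ∫⁻ D, Ψ (hist q D) ∂M.runLaw (policyLearner hq pol out m) (k + 1) =
      ∫⁻ D, ∫⁻ τ, Ψ (hist q D ++ [digest q τ]) ∂M.episode (pol (hist q D))
        ∂M.runLaw (policyLearner hq pol out m) k := by
  have h1 := measurable_comp_hist hq Ψ (k + 1)
  have h2 := measurable_run_snoc (S := S) (A := A) (O := O) H k
  rw [Env.runLaw, lintegral_map h1 h2]
  refine (Measure.lintegral_compProd (h1.comp h2)).trans ?_
  refine lintegral_congr fun D => ?_
  simp only [Function.comp_apply, hist_snoc]
  rw [Kernel.lintegral_comp, policyLearner, Kernel.lintegral_deterministic']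
  · exact Measurable.lintegral_kernel (measurable_comp_digest hq fun t => Ψ (hist q D ++ [t]))
  · exact measurable_comp_digest hq fun t => Ψ (hist q D ++ [t])

lemma lintegral_runLaw_le (Ψ : List (Traj S A ℕ H) → ENNReal)
    (hΨ : ∀ l, ∫⁻ τ, Ψ (l ++ [digest q τ]) ∂M.episode (pol l) ≤ Ψ l) (k : ℕ) :
    ∫⁻ D, Ψ (hist q D) ∂M.runLaw (policyLearner hq pol out m) k ≤ Ψ [] := by
  induction k with
  | zero =>
    simp only [Env.runLaw]
    rw [lintegral_dirac' _ (measurable_comp_hist hq Ψ 0)]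
    simp [hist]
  | succ k ih =>
    rw [lintegral_runLaw_succ]
    exact (lintegral_mono fun D => hΨ _).trans ih

/-- A supermartingale argument for the episodes of a window; the functional may depend on the
episodes before the window. -/
lemma lintegral_window_le {K₀ K : ℕ} {pol₀ : List (Traj S A ℕ H) → Policy S A H}
    (hpol : ∀ l : List (Traj S A ℕ H), K₀ ≤ l.length → l.length < K₀ + K →
      pol l = pol₀ (window K₀ K l))
    (ψ : List (Traj S A ℕ H) → List (Traj S A ℕ H) → ENNReal) (hψ : ∀ D, ψ D [] ≤ 1)
    (hstep : ∀ D w, ∫⁻ τ, ψ D (w ++ [digest q τ]) ∂M.episode (pol₀ w) ≤ ψ D w) (k : ℕ) :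
    ∫⁻ D, ψ ((hist q D).take K₀) (window K₀ K (hist q D))
      ∂M.runLaw (policyLearner hq pol out m) k ≤ 1 := by
  -- The process is 1 until the window opens, then follows ψ with the earlier data as a fixed
  -- parameter, and is frozen after the window closes.
  set Ψ : List (Traj S A ℕ H) → ENNReal := fun l =>
    if l.length ≤ K₀ then 1 else ψ (l.take K₀) (window K₀ K l) with hΨ
  have h1 : ∀ l, ψ (l.take K₀) (window K₀ K l) ≤ Ψ l := by
    intro l
    by_cases hl : l.length ≤ K₀
    · have : window K₀ K l = [] := by simp [window, List.drop_eq_nil_of_le hl]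
      simp only [hΨ, hl, if_true, this]
      exact hψ _
    · simp [hΨ, hl]
  have h3 := lintegral_runLaw_le hq M pol out m Ψ (fun l => ?_) k
  · refine (lintegral_mono fun D => h1 (hist q D)).trans (h3.trans ?_)
    simp [hΨ]
  · by_cases hl : l.length < K₀
    · have h4 : ∀ τ, Ψ (l ++ [digest q τ]) = 1 := fun τ => by
        simp only [hΨ, List.length_append, List.length_cons, List.length_nil]
        rw [if_pos (by omega)]
      have h5 : Ψ l = 1 := by simp [hΨ, hl.le]
      simp [h4, h5]
    · have hl' : K₀ ≤ l.length := by omega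
      refine le_trans ?_ (h1 l)
      have h4 : ∀ τ, Ψ (l ++ [digest q τ]) =
          ψ (l.take K₀) (window K₀ K (l ++ [digest q τ])) := fun τ => by
        simp only [hΨ, List.length_append, List.length_cons, List.length_nil]
        rw [if_neg (by omega), List.take_append_of_le_length hl']
      simp only [h4]
      have h6 : ∀ τ, (l ++ [digest q τ]).drop K₀ = l.drop K₀ ++ [digest q τ] := fun τ =>
        List.drop_append_of_le_length hl'
      by_cases hk : l.length < K₀ + K
      · have h5 : ∀ τ, window K₀ K (l ++ [digest q τ]) = window K₀ K l ++ [digest q τ] := fun τ => by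
          simp only [window, h6]
          rw [List.take_of_length_le (l := l.drop K₀) (by simp; omega),
            List.take_of_length_le (by simp; omega)]
        simp only [h5, hpol l hl' hk]
        exact hstep _ _
      · have h5 : ∀ τ, window K₀ K (l ++ [digest q τ]) = window K₀ K l := fun τ => by
          simp only [window, h6]
          rw [List.take_append_of_le_length (by simp; omega)]
        simp [h5]

/-- The law of the coded samples at `(h, s, a)`. -/
noncomputable def obsLaw (q : O → ℕ) (s₀ : S) (M : Env S A O H) (h : Fin H) (s : S) (a : A) :
    Measure (ℕ × S) :=
  (sampleLaw s₀ M.step h s a).map (Prod.map q id)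

omit hq in
lemma isProbabilityMeasure_obsLaw (hq : Measurable q) (s₀ : S) (h : Fin H) (s : S) (a : A) :
    IsProbabilityMeasure (obsLaw q s₀ M h s a) := by
  have := isProbabilityMeasure_sampleLaw s₀ M.step M.isProb h s a
  exact Measure.isProbabilityMeasure_map (hq.prodMap measurable_id).aemeasurable

include hq in
-- An episode either visits (s, a) at step h and appends a sample with the right conditional law, or
-- leaves the list alone; `lintegral_trajLaw_visit_le` treats both cases, with the current value of
-- the functional as the constant. Truncation to n samples stops the process.
lemma lintegral_samples_le (s₀ : S) (h : Fin H) (s : S) (a : A) (φ : List (ℕ × S) → ENNReal)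
    (hφ : ∀ l, ∫⁻ x, φ (l ++ [x]) ∂obsLaw q s₀ M h s a ≤ φ l) (n : ℕ)
    (w : List (Traj S A ℕ H)) (π : Policy S A H) :
    ∫⁻ τ, φ ((samples s₀ (w ++ [digest q τ]) h s a).take n) ∂M.episode π ≤
      φ ((samples s₀ w h s a).take n) := by
  classical
  have := isProbabilityMeasure_obsLaw M hq s₀ h s a
  set l := samples s₀ w h s a with hl
  have hmeas : ∀ f : ℕ × S → ENNReal, Measurable f := fun f => measurable_of_countable f
  have h1 : ∫⁻ x, φ ((l ++ [x]).take n) ∂obsLaw q s₀ M h s a ≤ φ (l.take n) := by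
    by_cases hn : l.length < n
    · have h2 : ∀ x, (l ++ [x]).take n = l ++ [x] := fun x =>
        List.take_of_length_le (by simp; omega)
      simp only [h2]
      rw [List.take_of_length_le (by omega)]
      exact hφ l
    · have h2 : ∀ x, (l ++ [x]).take n = l.take n := fun x =>
        List.take_append_of_le_length (by omega)
      simp [h2]
  rw [obsLaw, lintegral_map (hmeas _) (hq.prodMap measurable_id)] at h1
  have h3 := lintegral_trajLaw_visit_le s₀ M.step M.isProb π M.init h s a
    (g := fun x => φ ((l ++ [Prod.map q id x]).take n))
    ((hmeas fun x => φ ((l ++ [x]).take n)).comp (hq.prodMap measurable_id)) _ h1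
  refine le_trans (le_of_eq ?_) h3
  show ∫⁻ τ, _ ∂trajLaw H M.step π M.init = _
  refine lintegral_congr fun τ => ?_
  rw [samples_append_singleton]
  have h4 : ((digest q τ h).1 = s ∧ (digest q τ h).2.1 = a) ↔ ((τ h).1 = s ∧ (τ h).2.1 = a) :=
    Iff.rfl
  by_cases hc : (τ h).1 = s ∧ (τ h).2.1 = a
  · rw [if_pos (h4.2 hc), if_pos hc, sampleAt_digest]
  · rw [if_neg (fun h => hc (h4.1 h)), if_neg hc]

/-- The first argument of φ, the data before the window, allows the tested functions to be policies'
values chosen from an earlier window. -/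
lemma lintegral_window_samples_le (s₀ : S) {K₀ K : ℕ} {pol₀ : List (Traj S A ℕ H) → Policy S A H}
    (hpol : ∀ l : List (Traj S A ℕ H), K₀ ≤ l.length → l.length < K₀ + K →
      pol l = pol₀ (window K₀ K l)) (h : Fin H) (s : S) (a : A)
    (φ : List (Traj S A ℕ H) → List (ℕ × S) → ENNReal) (hφ0 : ∀ D, φ D [] ≤ 1)
    (hφ : ∀ D l, ∫⁻ x, φ D (l ++ [x]) ∂obsLaw q s₀ M h s a ≤ φ D l) (n k : ℕ) :
    ∫⁻ D, φ ((hist q D).take K₀) ((samples s₀ (window K₀ K (hist q D)) h s a).take n)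
      ∂M.runLaw (policyLearner hq pol out m) k ≤ 1 :=
  lintegral_window_le hq M pol out m hpol
    (fun D w => φ D ((samples s₀ w h s a).take n)) (fun D => by simpa [samples] using hφ0 D)
    (fun D w => lintegral_samples_le hq M s₀ h s a (φ D) (hφ D) n w (pol₀ w)) k

end Histories

/-! ### Simultaneous deviation bounds at all pairs and all scales -/

section Confidence

variable {S A O : Type*} {H : ℕ} [Fintype S] [Fintype A] [MeasurableSpace S]
  [DiscreteMeasurableSpace S] [MeasurableSpace A] [DiscreteMeasurableSpace A] [MeasurableSpace O]

/-- The logarithmic factor of the deviations of an average of `4 ^ j` samples. -/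
noncomputable def devLog (H : ℕ) (B : ℝ) (j : ℕ) : ℝ := B + H / 2 ^ j

lemma sqrt_four_pow (j : ℕ) : √(((4 ^ j : ℕ) : ℝ)) = 2 ^ j := by
  have : (((4 ^ j : ℕ) : ℝ)) = (2 ^ j) ^ 2 := by
    push_cast
    rw [← pow_mul, mul_comm, pow_mul]
    norm_num
  rw [this, Real.sqrt_sq (by positivity)]

/-- The set of samples with next state `s'`. -/
def nextIs (s' : S) : Set (ℕ × S) := {x | x.2 = s'}

lemma measurableSet_nextIs (s' : S) : MeasurableSet (nextIs s') :=
  (Set.to_countable _).measurableSet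

open Classical in
/-- The unit vector of the next state. -/
noncomputable def nextVec (x : ℕ × S) : EuclideanSpace ℝ S := EuclideanSpace.single x.2 1

lemma norm_nextVec (x : ℕ × S) : ‖nextVec x‖ ≤ 1 := by
  classical
  simp [nextVec]

lemma nextVec_apply (x : ℕ × S) (s' : S) :
    nextVec x s' = (nextIs s').indicator (1 : ℕ × S → ℝ) x := by
  classical
  simp only [nextVec, PiLp.single_apply, nextIs, Set.indicator_apply, Set.mem_ofPred_eq,
    Pi.one_apply]
  congr 1
  exact propext eq_comm

lemma emp_nextVec_apply (l : List (ℕ × S)) (s' : S) :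
    emp nextVec l s' = countIn (nextIs s') l / l.length := by
  have h1 : ∀ l : List (ℕ × S), (l.map nextVec).sum s' = countIn (nextIs s') l := by
    intro l
    induction l with
    | nil => simp [countIn]
    | cons x l ih =>
      have h2 : countIn (nextIs s') (x :: l) =
          (nextIs s').indicator (1 : ℕ × S → ℝ) x + countIn (nextIs s') l := by
        classical
        simp only [countIn, List.map_cons, List.sum_cons, Set.indicator_apply, Pi.one_apply]
      rw [h2, ← ih, ← nextVec_apply]
      simp
  rw [emp, PiLp.smul_apply, h1, smul_eq_mul, inv_mul_eq_div]

lemma integral_nextVec_apply (ν : Measure (ℕ × S)) [IsProbabilityMeasure ν] (s' : S) :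
    (∫ x, nextVec x ∂ν) s' = ν.real (nextIs s') := by
  have hint : Integrable (nextVec : ℕ × S → EuclideanSpace ℝ S) ν :=
    Integrable.of_bound (StronglyMeasurable.of_discrete).aestronglyMeasurable 1
      (Filter.Eventually.of_forall norm_nextVec)
  have h1 := (EuclideanSpace.proj (𝕜 := ℝ) s' : EuclideanSpace ℝ S →L[ℝ] ℝ).integral_comp_comm hint
  have h2 : ∀ x : ℕ × S, (EuclideanSpace.proj (𝕜 := ℝ) s' : EuclideanSpace ℝ S →L[ℝ] ℝ) (nextVec x)
      = (nextIs s').indicator (1 : ℕ × S → ℝ) x := fun x => nextVec_apply x s'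
  simp_rw [h2] at h1
  rw [integral_indicator_one (measurableSet_nextIs s')] at h1
  exact h1.symm

/-- Passes from the Euclidean deviation of the frequency vector, for which the bound is free of the
dimension, to its L¹ deviation. -/
lemma sum_abs_le_sqrt_mul_norm (v : EuclideanSpace ℝ S) :
    ∑ s', |v s'| ≤ √(Fintype.card S) * ‖v‖ := by
  rw [EuclideanSpace.norm_eq, ← Real.sqrt_mul (Nat.cast_nonneg _)]
  refine Real.le_sqrt_of_sq_le ?_
  have := sq_sum_le_card_mul_sum_sq (s := Finset.univ) (f := fun s' => |v s'|)
  simpa using this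

section Cells

variable {F : Type*} [NormedAddCommGroup F] [InnerProductSpace ℝ F] [CompleteSpace F]
  {q : O → ℕ} (hq : Measurable q) (M : Env S A O H)
  (pol : List (Traj S A ℕ H) → Policy S A H)
  (out : List (Traj S A ℕ H) → ProbabilityMeasure (Policy S A H)) (m k : ℕ)
  (s₀ : S) {K₀ K : ℕ} {pol₀ : List (Traj S A ℕ H) → Policy S A H}

/-- The sum over the scales `j` of a functional of the first `4 ^ j` elements of a list. -/
noncomputable def scaleSum {X : Type*} (G : ℕ → List X → ENNReal) (l : List X) : ENNReal :=
  ∑' j, if (l.take (4 ^ j)).length = 4 ^ j then G j (l.take (4 ^ j)) else 0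

include hq in
-- A batch counts only when it is complete, and then its excess is dominated by a potential stopped
-- at 4 ^ j samples, whose mean is at most 1. The coefficients `b j` are summable, so infinitely
-- many scales cost no more than a constant number of them.
lemma lintegral_scaleSum_le (hpol : ∀ l : List (Traj S A ℕ H), K₀ ≤ l.length →
      l.length < K₀ + K → pol l = pol₀ (window K₀ K l)) (h : Fin H) (s : S) (a : A)
    (G : List (Traj S A ℕ H) → ℕ → List (ℕ × S) → ENNReal)
    (φ : List (Traj S A ℕ H) → ℕ → List (ℕ × S) → ENNReal) (b : ℕ → ℝ)
    (hb : ∀ j, 0 ≤ b j) (hφ0 : ∀ D j, φ D j [] ≤ 1)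
    (hφ : ∀ D j l, ∫⁻ x, φ D j (l ++ [x]) ∂obsLaw q s₀ M h s a ≤ φ D j l)
    (hG : ∀ D j l, l.length = 4 ^ j → G D j l ≤ ENNReal.ofReal (b j) * φ D j l) {c : ℝ}
    (hc : ∀ J, ∑ j ∈ Finset.range J, b j ≤ c) :
    ∫⁻ D, scaleSum (G ((hist q D).take K₀)) (samples s₀ (window K₀ K (hist q D)) h s a)
      ∂M.runLaw (policyLearner hq pol out m) k ≤ ENNReal.ofReal c := by
  unfold scaleSum
  rw [lintegral_tsum]
  · refine le_trans (ENNReal.tsum_le_tsum fun j => ?_) (tsum_ofReal_le hb hc)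
    have h1 := lintegral_window_samples_le hq M pol out m s₀ hpol h s a (fun D l => φ D j l)
      (fun D => hφ0 D j) (fun D l => hφ D j l) (4 ^ j) k
    calc _ ≤ ∫⁻ D, ENNReal.ofReal (b j) * φ ((hist q D).take K₀) j
          ((samples s₀ (window K₀ K (hist q D)) h s a).take (4 ^ j))
          ∂M.runLaw (policyLearner hq pol out m) k := by
          refine lintegral_mono fun D => ?_
          dsimp only
          split_ifs with hl
          · exact hG _ _ _ hl
          · exact zero_le
      _ ≤ ENNReal.ofReal (b j) * 1 := by
          rw [lintegral_const_mul' _ _ ENNReal.ofReal_ne_top]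
          gcongr
      _ = ENNReal.ofReal (b j) := mul_one _
  · intro j
    exact (measurable_comp_hist hq (fun L =>
      if ((samples s₀ (window K₀ K L) h s a).take (4 ^ j)).length = 4 ^ j then
        G (L.take K₀) j ((samples s₀ (window K₀ K L) h s a).take (4 ^ j)) else 0) k).aemeasurable

/-- The excess of the deviation of an average of `4 ^ j` samples over its typical size. -/
noncomputable def devExcess (ν : Measure (ℕ × S)) (f : ℕ × S → F) (H : ℕ) (R B : ℝ) (j : ℕ)
    (l : List (ℕ × S)) : ENNReal :=
  ENNReal.ofReal (‖emp f l - ∫ y, f y ∂ν‖ - 4 * R * √(devLog H B j / 4 ^ j))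

/-- The excess of a frequency over its typical size. -/
noncomputable def freqExcess (ν : Measure (ℕ × S)) (I : Set (ℕ × S)) (H : ℕ) (B : ℝ) (j : ℕ)
    (l : List (ℕ × S)) : ENNReal :=
  ENNReal.ofReal (countIn I l / l.length - (1 + 1 / (H : ℝ)) * ν.real I -
    H * devLog H B j / 4 ^ j)

/-- The excess of a probability over the typical size, given the frequency. -/
noncomputable def freqDeficit (ν : Measure (ℕ × S)) (I : Set (ℕ × S)) (H : ℕ) (B : ℝ) (j : ℕ)
    (l : List (ℕ × S)) : ENNReal :=
  ENNReal.ofReal (ν.real I / (1 + 1 / (H : ℝ)) - countIn I l / l.length -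
    H * devLog H B j / 4 ^ j)

lemma one_le_devLog {B : ℝ} (hB : 1 ≤ B) (j : ℕ) : 1 ≤ devLog H B j := by
  have : (0 : ℝ) ≤ H / 2 ^ j := by positivity
  unfold devLog
  linarith

lemma exp_neg_devLog (H : ℕ) (B : ℝ) (j : ℕ) :
    Real.exp (-devLog H B j) = Real.exp (-B) * Real.exp (-((H : ℝ) / 2 ^ j)) := by
  rw [← Real.exp_add, devLog]; congr 1; ring

variable (hpol : ∀ l : List (Traj S A ℕ H), K₀ ≤ l.length →
      l.length < K₀ + K → pol l = pol₀ (window K₀ K l)) (h : Fin H) (s : S) (a : A)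

include hq hpol in
-- Scale j contributes 4 R / 2 ^ j · exp (-B) exp (-H / 2 ^ j), and the dyadic sum gives 1/H times a
-- constant. The factor 1/H offsets the range R = H of the tested functions, so that the sum over
-- the H steps costs a single factor H, as a logarithm of H/ε requires.
lemma lintegral_devExcess_le (hH : 0 < H) (f : List (Traj S A ℕ H) → ℕ × S → F) {R B : ℝ}
    (hR : 0 < R) (hB : 1 ≤ B) (hf : ∀ D x, ‖f D x‖ ≤ R) :
    ∫⁻ D, scaleSum (devExcess (obsLaw q s₀ M h s a) (f ((hist q D).take K₀)) H R B)
      (samples s₀ (window K₀ K (hist q D)) h s a) ∂M.runLaw (policyLearner hq pol out m) k ≤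
      ENNReal.ofReal (8 * R / H * Real.exp (-B)) := by
  have hHr : (0 : ℝ) < H := by exact_mod_cast hH
  have := isProbabilityMeasure_obsLaw M hq s₀ h s a
  have hn : ∀ j : ℕ, ((4 ^ j : ℕ) : ℝ) = 4 ^ j := fun j => by push_cast; rfl
  refine lintegral_scaleSum_le hq M pol out m k s₀ hpol h s a
    (fun D => devExcess (obsLaw q s₀ M h s a) (f D) H R B)
    (fun D j => coshPotential (obsLaw q s₀ M h s a) (f D) R (√(devLog H B j / 4 ^ j) / (2 * R)))
    (fun j => 4 * R / 2 ^ j * Real.exp (-devLog H B j)) (fun j => by positivity)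
    (fun D j => (coshPotential_nil _ _ _ _).le)
    (fun D j l => lintegral_coshPotential_le _ StronglyMeasurable.of_discrete (hf D)
      (by positivity) l) (fun D j l hl => ?_) fun J => ?_
  · have hl0 : l ≠ [] := by rintro rfl; simp at hl; exact absurd hl.symm (by positivity)
    have h1 := ofReal_excess_le (obsLaw q s₀ M h s a) (f D) hR (one_le_devLog (H := H) hB j) hl0
    rw [hl, sqrt_four_pow, hn] at h1
    exact h1
  · simp_rw [exp_neg_devLog]
    have h1 := sum_mul_exp_neg_le (H : ℝ) J
    calc _ = 4 * R / H * Real.exp (-B) * ∑ j ∈ Finset.range J,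
          (H : ℝ) / 2 ^ j * Real.exp (-((H : ℝ) / 2 ^ j)) := by
          rw [Finset.mul_sum]
          refine Finset.sum_congr rfl fun j _ => ?_
          field_simp
      _ ≤ 4 * R / H * Real.exp (-B) * 2 := by gcongr
      _ = _ := by ring

lemma sum_freq_bound_le (hH : 0 < H) (B : ℝ) (J : ℕ) :
    ∑ j ∈ Finset.range J, (H : ℝ) / 4 ^ j * Real.exp (-devLog H B j) ≤
      8 / H * Real.exp (-B) := by
  have hHr : (0 : ℝ) < H := by exact_mod_cast hH
  simp_rw [exp_neg_devLog]
  have h1 := sum_sq_mul_exp_neg_le hHr.le J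
  calc _ = 1 / H * Real.exp (-B) * ∑ j ∈ Finset.range J,
        ((H : ℝ) / 2 ^ j) ^ 2 * Real.exp (-((H : ℝ) / 2 ^ j)) := by
        rw [Finset.mul_sum]
        refine Finset.sum_congr rfl fun j _ => ?_
        have : (4 : ℝ) ^ j = (2 ^ j) ^ 2 := by rw [← pow_mul, mul_comm, pow_mul]; norm_num
        rw [this]
        field_simp
    _ ≤ 1 / H * Real.exp (-B) * 8 := by gcongr
    _ = _ := by ring

include hq hpol in
lemma lintegral_freqExcess_le (hH : 0 < H) (s' : S) (B : ℝ) :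
    ∫⁻ D, scaleSum (freqExcess (obsLaw q s₀ M h s a) (nextIs s') H B)
      (samples s₀ (window K₀ K (hist q D)) h s a) ∂M.runLaw (policyLearner hq pol out m) k ≤
      ENNReal.ofReal (8 / H * Real.exp (-B)) := by
  have hHr : (1 : ℝ) ≤ H := by exact_mod_cast hH
  have := isProbabilityMeasure_obsLaw M hq s₀ h s a
  have hn : ∀ j : ℕ, ((4 ^ j : ℕ) : ℝ) = 4 ^ j := fun j => by push_cast; rfl
  refine lintegral_scaleSum_le hq M pol out m k s₀ hpol h s a
    (fun _ => freqExcess (obsLaw q s₀ M h s a) (nextIs s') H B)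
    (fun _ _ => countPotential (obsLaw q s₀ M h s a) (nextIs s') (1 / (H : ℝ)))
    (fun j => (H : ℝ) / 4 ^ j * Real.exp (-devLog H B j)) (fun j => by positivity)
    (fun D j => (countPotential_nil _ _ _).le)
    (fun D j l => lintegral_countPotential_le _ (measurableSet_nextIs s') _ l)
    (fun D j l hl => ?_) (sum_freq_bound_le hH B)
  have hl0 : l ≠ [] := by rintro rfl; simp at hl; exact absurd hl.symm (by positivity)
  have h1 := ofReal_count_excess_le (obsLaw q s₀ M h s a) (nextIs s') hHr (devLog H B j) hl0
  unfold freqExcess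
  rw [hl, hn] at h1
  rw [hl, hn]
  exact h1

include hq hpol in
lemma lintegral_freqDeficit_le (hH : 0 < H) (s' : S) (B : ℝ) :
    ∫⁻ D, scaleSum (freqDeficit (obsLaw q s₀ M h s a) (nextIs s') H B)
      (samples s₀ (window K₀ K (hist q D)) h s a) ∂M.runLaw (policyLearner hq pol out m) k ≤
      ENNReal.ofReal (8 / H * Real.exp (-B)) := by
  have hHr : (1 : ℝ) ≤ H := by exact_mod_cast hH
  have := isProbabilityMeasure_obsLaw M hq s₀ h s a
  have hn : ∀ j : ℕ, ((4 ^ j : ℕ) : ℝ) = 4 ^ j := fun j => by push_cast; rfl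
  refine lintegral_scaleSum_le hq M pol out m k s₀ hpol h s a
    (fun _ => freqDeficit (obsLaw q s₀ M h s a) (nextIs s') H B)
    (fun _ _ => countPotential (obsLaw q s₀ M h s a) (nextIs s') (-(1 / (H : ℝ))))
    (fun j => (H : ℝ) / 4 ^ j * Real.exp (-devLog H B j)) (fun j => by positivity)
    (fun D j => (countPotential_nil _ _ _).le)
    (fun D j l => lintegral_countPotential_le _ (measurableSet_nextIs s') _ l)
    (fun D j l hl => ?_) (sum_freq_bound_le hH B)
  have hl0 : l ≠ [] := by rintro rfl; simp at hl; exact absurd hl.symm (by positivity)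
  have h1 := ofReal_count_deficit_le (obsLaw q s₀ M h s a) (nextIs s') hHr (devLog H B j) hl0
  unfold freqDeficit
  rw [hl, hn] at h1
  rw [hl, hn]
  exact h1

end Cells

section Confident

variable {F : Type*} [NormedAddCommGroup F] [InnerProductSpace ℝ F] [CompleteSpace F]
  {Θ : Type*} [Fintype Θ]

/-- The averages of the functions `f θ h` over samples, and the frequencies of the next states, are
close to the means and to the probabilities, up to errors with a total of at most `ε`. -/
def Confident (s₀ : S) (ν : Fin H → S → A → Measure (ℕ × S)) (f : Θ → Fin H → ℕ × S → F)
    (D B ε : ℝ) (w : List (Traj S A ℕ H)) : Prop :=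
  ∃ e : Fin H → ℝ, (∀ h, 0 ≤ e h) ∧ ∑ h, e h ≤ ε ∧ ∀ h s a j l,
    l = (samples s₀ w h s a).take (4 ^ j) → l.length = 4 ^ j →
    (∀ θ, ‖emp (f θ h) l - ∫ x, f θ h x ∂ν h s a‖ ≤
      4 * H * √(devLog H (D * B) j / 4 ^ j) + e h) ∧
    2 * H * ∑ s', |countIn (nextIs s') l / l.length - (ν h s a).real (nextIs s')| ≤
      8 * H * √(Fintype.card S) * √(devLog H B j / 4 ^ j) + e h ∧
    ∀ g : S → ℝ, (∀ s', 0 ≤ g s' ∧ g s' ≤ 2 * H) →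
      ∑ s', countIn (nextIs s') l / l.length * g s' ≤
        (1 + 1 / (H : ℝ)) * ∑ s', (ν h s a).real (nextIs s') * g s' +
          4 * H ^ 2 * Fintype.card S * devLog H B j / 4 ^ j + e h ∧
      ∑ s', (ν h s a).real (nextIs s') * g s' ≤
        (1 + 1 / (H : ℝ)) * ∑ s', countIn (nextIs s') l / l.length * g s' +
          4 * H ^ 2 * Fintype.card S * devLog H B j / 4 ^ j + e h

/-- The total excess at `(h, s, a)`. -/
noncomputable def cellExcess (s₀ : S) (ν : Fin H → S → A → Measure (ℕ × S))
    (f : Θ → Fin H → ℕ × S → F) (D B : ℝ) (h : Fin H) (s : S) (a : A)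
    (w : List (Traj S A ℕ H)) : ENNReal :=
  (∑ θ, scaleSum (devExcess (ν h s a) (f θ h) H H (D * B)) (samples s₀ w h s a)) +
    ENNReal.ofReal (2 * H * √(Fintype.card S)) *
      scaleSum (devExcess (ν h s a) nextVec H 1 B) (samples s₀ w h s a) +
    ENNReal.ofReal (4 * H) *
      (∑ s', scaleSum (freqExcess (ν h s a) (nextIs s') H B) (samples s₀ w h s a)) +
    ENNReal.ofReal (4 * H) *
      (∑ s', scaleSum (freqDeficit (ν h s a) (nextIs s') H B) (samples s₀ w h s a))

/-- The total excess at step `h`. -/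
noncomputable def totalExcess (s₀ : S) (ν : Fin H → S → A → Measure (ℕ × S))
    (f : Θ → Fin H → ℕ × S → F) (D B : ℝ) (h : Fin H) (w : List (Traj S A ℕ H)) : ENNReal :=
  ∑ s, ∑ a, cellExcess s₀ ν f D B h s a w

lemma le_toReal_of_ofReal_le {x : ℝ} {y : ENNReal} (hy : y ≠ ⊤) (h : ENNReal.ofReal x ≤ y) :
    x ≤ y.toReal :=
  (ENNReal.ofReal_le_iff_le_toReal hy).1 h

lemma le_scaleSum {X : Type*} (G : ℕ → List X → ENNReal) (L l : List X) (j : ℕ)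
    (hl : l = L.take (4 ^ j)) (hj : l.length = 4 ^ j) : G j l ≤ scaleSum G L := by
  have h1 := ENNReal.le_tsum (f := fun j =>
    if (L.take (4 ^ j)).length = 4 ^ j then G j (L.take (4 ^ j)) else 0) j
  subst hl
  simpa [scaleSum, hj] using h1

/-- The total excess at step h serves as the error `e h`: it dominates each single excess at that
step, and for the frequencies also the weighted sum of the excesses over all next states. -/
lemma confident_of_totalExcess_le (hH : 0 < H) (s₀ : S) (ν : Fin H → S → A → Measure (ℕ × S))
    (hν : ∀ h s a, IsProbabilityMeasure (ν h s a))
    (f : Θ → Fin H → ℕ × S → F) {D B ε : ℝ} (hB : 0 ≤ B) (w : List (Traj S A ℕ H))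
    (hε : ∑ h, totalExcess s₀ ν f D B h w ≤ ENNReal.ofReal ε) :
    0 ≤ ε → Confident s₀ ν f D B ε w := by
  intro hε0
  have hHr : (1 : ℝ) ≤ H := by exact_mod_cast hH
  have hfin : ∀ h, totalExcess s₀ ν f D B h w ≠ ⊤ := fun h =>
    ne_top_of_le_ne_top ENNReal.ofReal_ne_top
      ((Finset.single_le_sum (f := fun h => totalExcess s₀ ν f D B h w)
        (fun _ _ => zero_le) (Finset.mem_univ h)).trans hε)
  refine ⟨fun h => (totalExcess s₀ ν f D B h w).toReal, fun h => ENNReal.toReal_nonneg, ?_, ?_⟩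
  · rw [← ENNReal.toReal_sum fun h _ => hfin h]
    exact ENNReal.toReal_le_of_le_ofReal hε0 hε
  intro h s a j l hl hlen
  have hprob := hν h s a
  have hcell : cellExcess s₀ ν f D B h s a w ≤ totalExcess s₀ ν f D B h w :=
    (Finset.single_le_sum (f := fun a => cellExcess s₀ ν f D B h s a w)
      (fun _ _ => zero_le) (Finset.mem_univ a)).trans
    (Finset.single_le_sum (f := fun s => ∑ a, cellExcess s₀ ν f D B h s a w)
      (fun _ _ => zero_le) (Finset.mem_univ s))
  unfold cellExcess at hcell
  set Ex := totalExcess s₀ ν f D B h w with hEx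
  have hΛ0 : 0 ≤ devLog H B j := by unfold devLog; positivity
  have hsum : ∀ G : S → ℕ → List (ℕ × S) → ENNReal,
      ENNReal.ofReal (4 * H) * (∑ s', scaleSum (G s') (samples s₀ w h s a)) ≤ Ex →
      ∀ x : S → ℝ, (∀ s', ENNReal.ofReal (x s') ≤ G s' j l) →
      4 * H * ∑ s', max (x s') 0 ≤ Ex.toReal := by
    intro G hG x hx
    refine le_toReal_of_ofReal_le (hfin h) (le_trans ?_ hG)
    rw [ENNReal.ofReal_mul (by positivity), ENNReal.ofReal_sum_of_nonneg
      fun s' _ => le_max_right _ _]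
    gcongr with s'
    refine le_trans ?_ (le_scaleSum (G s') _ l j hl hlen)
    refine le_trans (le_of_eq ?_) (hx s')
    rcases le_total (x s') 0 with h0 | h0
    · rw [max_eq_right h0, ENNReal.ofReal_of_nonpos h0, ENNReal.ofReal_zero]
    · rw [max_eq_left h0]
  refine ⟨fun θ => ?_, ?_, fun g hg => ⟨?_, ?_⟩⟩
  · have h1 : devExcess (ν h s a) (f θ h) H H (D * B) j l ≤ Ex :=
      (((le_scaleSum _ _ l j hl hlen).trans (Finset.single_le_sum (f := fun θ =>
        scaleSum (devExcess (ν h s a) (f θ h) H H (D * B)) (samples s₀ w h s a))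
        (fun _ _ => zero_le) (Finset.mem_univ θ))).trans
        (le_self_add.trans (le_self_add.trans le_self_add))).trans hcell
    have := le_toReal_of_ofReal_le (hfin h) h1
    linarith
  · have h1 : ENNReal.ofReal (2 * H * √(Fintype.card S)) *
        devExcess (ν h s a) nextVec H 1 B j l ≤ Ex := by
      refine le_trans (mul_le_mul_right (le_scaleSum (devExcess (ν h s a) nextVec H 1 B) _ l j hl hlen) _) ?_
      exact (le_add_self.trans (le_self_add.trans le_self_add)).trans hcell
    rw [devExcess, ← ENNReal.ofReal_mul (by positivity)] at h1
    have h2 := le_toReal_of_ofReal_le (hfin h) h1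
    have h3 := sum_abs_le_sqrt_mul_norm (emp nextVec l - ∫ x, nextVec x ∂ν h s a)
    have h4 : ∀ s', (emp nextVec l - ∫ x, nextVec x ∂ν h s a) s' =
        countIn (nextIs s') l / l.length - (ν h s a).real (nextIs s') := fun s' => by
      rw [PiLp.sub_apply, emp_nextVec_apply, integral_nextVec_apply]
    simp_rw [h4] at h3
    have h5 := mul_le_mul_of_nonneg_left h3 (by positivity : (0 : ℝ) ≤ 2 * H)
    linarith
  · set x : S → ℝ := fun s' => countIn (nextIs s') l / l.length -
      (1 + 1 / (H : ℝ)) * (ν h s a).real (nextIs s') - H * devLog H B j / 4 ^ j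
    have h1 := hsum (fun s' => freqExcess (ν h s a) (nextIs s') H B)
      ((le_add_self.trans le_self_add).trans hcell) x fun s' => le_rfl
    have h2 : ∀ s', countIn (nextIs s') l / l.length * g s' ≤
        (1 + 1 / (H : ℝ)) * ((ν h s a).real (nextIs s') * g s') +
        2 * H * (H * devLog H B j / 4 ^ j) + 2 * H * max (x s') 0 := by
      intro s'
      obtain ⟨hg0, hg1⟩ := hg s'
      have h3 : countIn (nextIs s') l / l.length = (1 + 1 / (H : ℝ)) * (ν h s a).real (nextIs s') +
        (H * devLog H B j / 4 ^ j) + x s' := by simp only [x]; ring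
      have h4 : (H * devLog H B j / 4 ^ j + x s') * g s' ≤
          (H * devLog H B j / 4 ^ j + max (x s') 0) * (2 * H) := by
        have h5 : (0 : ℝ) ≤ H * devLog H B j / 4 ^ j := by positivity
        calc _ ≤ (H * devLog H B j / 4 ^ j + max (x s') 0) * g s' := by
              gcongr; exact le_max_left _ _
          _ ≤ _ := by
              have := le_max_right (x s') 0
              gcongr
      rw [h3]
      linarith
    have h3 := Finset.sum_le_sum fun s' (_ : s' ∈ Finset.univ) => h2 s'
    simp only [Finset.sum_add_distrib, ← Finset.mul_sum, Finset.sum_const, Finset.card_univ,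
      nsmul_eq_mul] at h3
    have h4 : 0 ≤ ∑ s', max (x s') 0 := Finset.sum_nonneg fun s' _ => le_max_right _ _
    have h5 : 0 ≤ (H : ℝ) * ∑ s', max (x s') 0 := by positivity
    have h6 : (Fintype.card S : ℝ) * (2 * H * (H * devLog H B j / 4 ^ j)) =
      2 * (H ^ 2 * Fintype.card S * devLog H B j / 4 ^ j) := by ring
    have h7 : (0 : ℝ) ≤ H ^ 2 * Fintype.card S * devLog H B j / 4 ^ j := by positivity
    have h8 : 4 * (H : ℝ) ^ 2 * Fintype.card S * devLog H B j / 4 ^ j =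
      4 * (H ^ 2 * Fintype.card S * devLog H B j / 4 ^ j) := by ring
    rw [h8]
    linarith
  · set x : S → ℝ := fun s' => (ν h s a).real (nextIs s') / (1 + 1 / (H : ℝ)) -
      countIn (nextIs s') l / l.length - H * devLog H B j / 4 ^ j
    have h1 := hsum (fun s' => freqDeficit (ν h s a) (nextIs s') H B)
      (le_add_self.trans hcell) x fun s' => le_rfl
    have hρ0 : (0 : ℝ) < 1 + 1 / (H : ℝ) := by positivity
    -- Solving the deficit for the probability multiplies by 1 + 1/H ≤ 2; together with g ≤ 2 H this
    -- is the weight 4 H in `cellExcess`.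
    have hρ2 : 1 + 1 / (H : ℝ) ≤ 2 := by
      have : 1 / (H : ℝ) ≤ 1 := by rw [div_le_one (by linarith)]; exact hHr
      linarith
    have h2 : ∀ s', (ν h s a).real (nextIs s') * g s' ≤
        (1 + 1 / (H : ℝ)) * (countIn (nextIs s') l / l.length * g s') +
        4 * H * (H * devLog H B j / 4 ^ j) + 4 * H * max (x s') 0 := by
      intro s'
      obtain ⟨hg0, hg1⟩ := hg s'
      have h3 : (ν h s a).real (nextIs s') = (1 + 1 / (H : ℝ)) * (countIn (nextIs s') l / l.length +
        (H * devLog H B j / 4 ^ j) + x s') := by simp only [x]; field_simp; ring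
      have h4 : (1 + 1 / (H : ℝ)) * (H * devLog H B j / 4 ^ j + x s') * g s' ≤
          2 * (H * devLog H B j / 4 ^ j + max (x s') 0) * (2 * H) := by
        have h5 : (0 : ℝ) ≤ H * devLog H B j / 4 ^ j := by positivity
        have := le_max_right (x s') 0
        calc _ ≤ (1 + 1 / (H : ℝ)) * (H * devLog H B j / 4 ^ j + max (x s') 0) * g s' := by
              gcongr; exact le_max_left _ _
          _ ≤ _ := by gcongr
      rw [h3]
      linarith
    have h3 := Finset.sum_le_sum fun s' (_ : s' ∈ Finset.univ) => h2 s'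
    simp only [Finset.sum_add_distrib, ← Finset.mul_sum, Finset.sum_const, Finset.card_univ,
      nsmul_eq_mul] at h3
    have h6 : (Fintype.card S : ℝ) * (4 * H * (H * devLog H B j / 4 ^ j)) =
      4 * H ^ 2 * Fintype.card S * devLog H B j / 4 ^ j := by ring
    linarith

variable {q : O → ℕ} (hq : Measurable q) (M : Env S A O H)
  (pol : List (Traj S A ℕ H) → Policy S A H)
  (out : List (Traj S A ℕ H) → ProbabilityMeasure (Policy S A H)) (m k : ℕ)
  (s₀ : S) {K₀ K : ℕ} {pol₀ : List (Traj S A ℕ H) → Policy S A H}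

include hq in
-- Markov's inequality for the expected total excess. The number p bounds both exp (-B), for the
-- transitions, and the sum over Θ of exp (-D B), for the tested functions.
lemma measure_not_confident_le (hH : 0 < H) [Nonempty S]
    (hpol : ∀ l : List (Traj S A ℕ H), K₀ ≤ l.length →
      l.length < K₀ + K → pol l = pol₀ (window K₀ K l))
    (f : List (Traj S A ℕ H) → Θ → Fin H → ℕ × S → F) (hf : ∀ D θ h x, ‖f D θ h x‖ ≤ H)
    {D B p ε : ℝ} (hB : 1 ≤ B) (hD : 1 ≤ D) (hε : 0 < ε)
    (hp : Real.exp (-B) ≤ p) (hΘ : Fintype.card Θ * Real.exp (-(D * B)) ≤ p) :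
    M.runLaw (policyLearner hq pol out m) k
      {X | ¬ Confident s₀ (obsLaw q s₀ M) (f ((hist q X).take K₀)) D B ε
        (window K₀ K (hist q X))} ≤
      ENNReal.ofReal (88 * H * Fintype.card S ^ 2 * Fintype.card A * p / ε) := by
  set μ := M.runLaw (policyLearner hq pol out m) k
  set ν := obsLaw q s₀ M
  have hHr : (0 : ℝ) < H := by exact_mod_cast hH
  have hS1 : (1 : ℝ) ≤ Fintype.card S := by exact_mod_cast Fintype.card_pos
  have hp0 : 0 ≤ p := (Real.exp_pos _).le.trans hp
  have hDB : 1 ≤ D * B := by nlinarith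
  have hν : ∀ h s a, IsProbabilityMeasure (ν h s a) := isProbabilityMeasure_obsLaw M hq s₀
  have hmeas : ∀ G : List (Traj S A ℕ H) → ENNReal, Measurable fun X : Fin k → Traj S A O H =>
    G (hist q X) := fun G => measurable_comp_hist hq G k
  have hcell : ∀ h s a, ∫⁻ X, cellExcess s₀ ν (f ((hist q X).take K₀)) D B h s a
      (window K₀ K (hist q X)) ∂μ ≤ ENNReal.ofReal (88 * Fintype.card S * p) := by
    intro h s a
    have m1 : ∀ θ, Measurable fun X : Fin k → Traj S A O H =>
        scaleSum (devExcess (ν h s a) (f ((hist q X).take K₀) θ h) H H (D * B))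
        (samples s₀ (window K₀ K (hist q X)) h s a) := fun θ => hmeas fun L =>
        scaleSum (devExcess (ν h s a) (f (L.take K₀) θ h) H H (D * B))
        (samples s₀ (window K₀ K L) h s a)
    have m2 : Measurable fun X : Fin k → Traj S A O H =>
        scaleSum (devExcess (ν h s a) nextVec H 1 B) (samples s₀ (window K₀ K (hist q X)) h s a) :=
      hmeas fun L =>
        scaleSum (devExcess (ν h s a) nextVec H 1 B) (samples s₀ (window K₀ K L) h s a)
    have m3 : ∀ s', Measurable fun X : Fin k → Traj S A O H =>
        scaleSum (freqExcess (ν h s a) (nextIs s') H B)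
        (samples s₀ (window K₀ K (hist q X)) h s a) := fun s' => hmeas fun L =>
        scaleSum (freqExcess (ν h s a) (nextIs s') H B) (samples s₀ (window K₀ K L) h s a)
    have m4 : ∀ s', Measurable fun X : Fin k → Traj S A O H =>
        scaleSum (freqDeficit (ν h s a) (nextIs s') H B)
        (samples s₀ (window K₀ K (hist q X)) h s a) := fun s' => hmeas fun L =>
        scaleSum (freqDeficit (ν h s a) (nextIs s') H B) (samples s₀ (window K₀ K L) h s a)
    have m1' := Finset.measurable_fun_sum (Finset.univ : Finset Θ) fun θ _ => m1 θ
    have m3' := Finset.measurable_fun_sum (Finset.univ : Finset S) fun s' _ => m3 s'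
    have m4' := Finset.measurable_fun_sum (Finset.univ : Finset S) fun s' _ => m4 s'
    unfold cellExcess
    rw [lintegral_add_right _ (m4'.const_mul _), lintegral_add_right _ (m3'.const_mul _),
      lintegral_add_right _ (m2.const_mul _), lintegral_const_mul _ m2,
      lintegral_const_mul _ m3', lintegral_const_mul _ m4',
      lintegral_finsetSum _ fun θ _ => m1 θ, lintegral_finsetSum _ fun s' _ => m3 s',
      lintegral_finsetSum _ fun s' _ => m4 s']
    have b1 : ∑ θ, ∫⁻ X, scaleSum (devExcess (ν h s a) (f ((hist q X).take K₀) θ h) H H (D * B))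
        (samples s₀ (window K₀ K (hist q X)) h s a) ∂μ ≤ ENNReal.ofReal (8 * p) := by
      calc _ ≤ ∑ θ : Θ, ENNReal.ofReal (8 * H / H * Real.exp (-(D * B))) :=
            Finset.sum_le_sum fun θ _ => lintegral_devExcess_le hq M pol out m k s₀ hpol h s a hH
              (fun L => f L θ h) hHr hDB fun L x => hf L θ h x
        _ = ENNReal.ofReal (8 * (Fintype.card Θ * Real.exp (-(D * B)))) := by
            rw [Finset.sum_const, nsmul_eq_mul, Finset.card_univ, ← ENNReal.ofReal_natCast,
              ← ENNReal.ofReal_mul (by positivity)]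
            congr 1
            field_simp
        _ ≤ _ := ENNReal.ofReal_le_ofReal (by linarith)
    have b2 : ENNReal.ofReal (2 * H * √(Fintype.card S)) * ∫⁻ X,
        scaleSum (devExcess (ν h s a) nextVec H 1 B)
        (samples s₀ (window K₀ K (hist q X)) h s a) ∂μ ≤
        ENNReal.ofReal (16 * Fintype.card S * p) := by
      refine (mul_le_mul_right (lintegral_devExcess_le hq M pol out m k s₀ hpol h s a hH
        (fun _ => nextVec) one_pos hB fun _ => norm_nextVec) _).trans ?_
      rw [← ENNReal.ofReal_mul (by positivity)]
      refine ENNReal.ofReal_le_ofReal ?_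
      have h1 : √(Fintype.card S : ℝ) ≤ Fintype.card S := by
        rw [Real.sqrt_le_left (by positivity)]; nlinarith
      calc _ = 16 * √(Fintype.card S : ℝ) * Real.exp (-B) := by field_simp; ring
        _ ≤ _ := by gcongr
    have b3 : ∀ G : S → ℕ → List (ℕ × S) → ENNReal, (∀ s', ∫⁻ X, scaleSum (G s')
        (samples s₀ (window K₀ K (hist q X)) h s a) ∂μ ≤ ENNReal.ofReal (8 / H * Real.exp (-B))) →
        ENNReal.ofReal (4 * H) * ∑ s', ∫⁻ X, scaleSum (G s')
        (samples s₀ (window K₀ K (hist q X)) h s a) ∂μ ≤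
        ENNReal.ofReal (32 * Fintype.card S * p) := by
      intro G hG
      calc _ ≤ ENNReal.ofReal (4 * H) * ∑ s' : S, ENNReal.ofReal (8 / H * Real.exp (-B)) := by
            gcongr with s'
            exact hG s'
        _ = ENNReal.ofReal (32 * Fintype.card S * Real.exp (-B)) := by
            rw [Finset.sum_const, nsmul_eq_mul, Finset.card_univ, ← ENNReal.ofReal_natCast,
              ← ENNReal.ofReal_mul (by positivity), ← ENNReal.ofReal_mul (by positivity)]
            congr 1
            field_simp
            ring
        _ ≤ _ := ENNReal.ofReal_le_ofReal (by gcongr)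
    have b3' := b3 _ fun s' => lintegral_freqExcess_le hq M pol out m k s₀ hpol h s a hH s' B
    have b4' := b3 _ fun s' => lintegral_freqDeficit_le hq M pol out m k s₀ hpol h s a hH s' B
    -- 8 for the tested functions, 16 for the L¹ deviation, and 32 for each side of the frequencies:
    -- 88 in all.
    refine (add_le_add (add_le_add (add_le_add b1 b2) b3') b4').trans ?_
    rw [← ENNReal.ofReal_add (by positivity) (by positivity),
      ← ENNReal.ofReal_add (by positivity) (by positivity),
      ← ENNReal.ofReal_add (by positivity) (by positivity)]
    refine ENNReal.ofReal_le_ofReal ?_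
    have : p ≤ Fintype.card S * p := le_mul_of_one_le_left hp0 hS1
    linarith
  have htot : ∫⁻ X, ∑ h, totalExcess s₀ ν (f ((hist q X).take K₀)) D B h
      (window K₀ K (hist q X)) ∂μ ≤
      ENNReal.ofReal (88 * H * Fintype.card S ^ 2 * Fintype.card A * p) := by
    rw [lintegral_finsetSum]
    · have h1 : ∀ h : Fin H, ∫⁻ X, totalExcess s₀ ν (f ((hist q X).take K₀)) D B h
          (window K₀ K (hist q X)) ∂μ ≤
          ∑ s : S, ∑ a : A, ENNReal.ofReal (88 * Fintype.card S * p) := by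
        intro h
        unfold totalExcess
        rw [lintegral_finsetSum]
        · refine Finset.sum_le_sum fun s _ => ?_
          rw [lintegral_finsetSum]
          · exact Finset.sum_le_sum fun a _ => hcell h s a
          · intro a _
            exact hmeas fun L => cellExcess s₀ ν (f (L.take K₀)) D B h s a (window K₀ K L)
        · intro s _
          exact hmeas fun L => ∑ a, cellExcess s₀ ν (f (L.take K₀)) D B h s a (window K₀ K L)
      refine (Finset.sum_le_sum fun h _ => h1 h).trans (le_of_eq ?_)
      simp only [Finset.sum_const, nsmul_eq_mul, Finset.card_univ, Fintype.card_fin]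
      rw [← ENNReal.ofReal_natCast, ← ENNReal.ofReal_natCast, ← ENNReal.ofReal_natCast,
        ← ENNReal.ofReal_mul (by positivity), ← ENNReal.ofReal_mul (by positivity),
        ← ENNReal.ofReal_mul (by positivity)]
      congr 1
      ring
    · intro h _
      exact hmeas fun L => totalExcess s₀ ν (f (L.take K₀)) D B h (window K₀ K L)
  calc _ ≤ μ {X | ENNReal.ofReal ε ≤ ∑ h, totalExcess s₀ ν (f ((hist q X).take K₀)) D B h
        (window K₀ K (hist q X))} := by
        refine measure_mono fun X hX => ?_
        rw [Set.mem_ofPred_eq] at hX ⊢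
        by_contra hlt
        exact hX (confident_of_totalExcess_le hH s₀ ν hν _ (by linarith) _ (not_le.1 hlt).le hε.le)
    _ ≤ (∫⁻ X, ∑ h, totalExcess s₀ ν (f ((hist q X).take K₀)) D B h
        (window K₀ K (hist q X)) ∂μ) / ENNReal.ofReal ε := by
        refine meas_ge_le_lintegral_div ?_ (by simpa using hε) ENNReal.ofReal_ne_top
        exact (hmeas fun L => ∑ h, totalExcess s₀ ν (f (L.take K₀)) D B h
          (window K₀ K L)).aemeasurable
    _ ≤ ENNReal.ofReal (88 * H * Fintype.card S ^ 2 * Fintype.card A * p) / ENNReal.ofReal ε := by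
        gcongr
    _ = _ := (ENNReal.ofReal_div_of_pos hε).symm

end Confident

end Confidence

/-! ### Sums of bonuses over successive visits -/

section BonusSums

/-- The bonus for the deviation of averages of `N` samples, with `Λ` and `n` at the scale of `N`. -/
noncomputable def bonus₁ (H : ℕ) (D B : ℝ) (N : ℕ) : ℝ :=
  if N = 0 then 2 * H else 8 * H * √D * √(devLog H B (Nat.log 4 N) / 4 ^ Nat.log 4 N)

/-- The bonus for the deviation of transition frequencies from `N` samples. -/
noncomputable def bonus₂ (H : ℕ) (nS B : ℝ) (N : ℕ) : ℝ :=
  if N = 0 then 0 else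
    min (8 * H * √nS * √(devLog H B (Nat.log 4 N) / 4 ^ Nat.log 4 N))
      (4 * H ^ 2 * nS * devLog H B (Nat.log 4 N) / 4 ^ Nat.log 4 N)

/-- The total bonus. -/
noncomputable def bonus (H : ℕ) (nS D B : ℝ) (N : ℕ) : ℝ := bonus₁ H D B N + bonus₂ H nS B N

/-- The clipped and enlarged bonus. -/
noncomputable def bigBonus (H : ℕ) (nS D B : ℝ) (N : ℕ) : ℝ :=
  min (2 * (H : ℝ)) (4 * bonus H nS D B N)

variable {H : ℕ} {nS D B : ℝ}

lemma devLog_nonneg (hB : 0 ≤ B) (j : ℕ) : 0 ≤ devLog H B j := by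
  unfold devLog; positivity

lemma bonus₁_nonneg (N : ℕ) : 0 ≤ bonus₁ H D B N := by
  unfold bonus₁; split_ifs <;> positivity

lemma bonus₂_nonneg (hS : 0 ≤ nS) (hB : 0 ≤ B) (N : ℕ) : 0 ≤ bonus₂ H nS B N := by
  unfold bonus₂
  have := devLog_nonneg (H := H) hB (Nat.log 4 N)
  split_ifs
  · exact le_rfl
  · exact le_min (by positivity) (by positivity)

lemma bonus_nonneg (hS : 0 ≤ nS) (hB : 0 ≤ B) (N : ℕ) : 0 ≤ bonus H nS D B N :=
  add_nonneg (bonus₁_nonneg N) (bonus₂_nonneg hS hB N)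

lemma bigBonus_nonneg (hS : 0 ≤ nS) (hB : 0 ≤ B) (N : ℕ) : 0 ≤ bigBonus H nS D B N :=
  le_min (by positivity) (by have := bonus_nonneg (H := H) (D := D) hS hB N; positivity)

lemma bigBonus_le (N : ℕ) : bigBonus H nS D B N ≤ 2 * H := min_le_left _ _

lemma inv_sqrt_le (i : ℕ) : 1 / √((i : ℝ) + 1) ≤ 2 * (√((i : ℝ) + 1) - √(i : ℝ)) := by
  have hi : (0 : ℝ) ≤ i := Nat.cast_nonneg i
  set x := √((i : ℝ) + 1)
  set y := √(i : ℝ)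
  have hx : x ^ 2 = i + 1 := Real.sq_sqrt (by positivity)
  have hy : y ^ 2 = i := Real.sq_sqrt hi
  have hx0 : 0 < x := Real.sqrt_pos.2 (by positivity)
  rw [div_le_iff₀ hx0]
  nlinarith [sq_nonneg (x - y)]

lemma inv_rpow_three_quarters_le (i : ℕ) :
    1 / (√((i : ℝ) + 1) * √√((i : ℝ) + 1)) ≤ 4 * (√√((i : ℝ) + 1) - √√(i : ℝ)) := by
  have hi : (0 : ℝ) ≤ i := Nat.cast_nonneg i
  set u := √√((i : ℝ) + 1)
  set v := √√(i : ℝ)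
  have hu2 : u ^ 2 = √((i : ℝ) + 1) := Real.sq_sqrt (Real.sqrt_nonneg _)
  have hv2 : v ^ 2 = √(i : ℝ) := Real.sq_sqrt (Real.sqrt_nonneg _)
  have hu4 : u ^ 4 = i + 1 := by
    rw [show u ^ 4 = (u ^ 2) ^ 2 by ring, hu2, Real.sq_sqrt (by positivity)]
  have hv4 : v ^ 4 = i := by
    rw [show v ^ 4 = (v ^ 2) ^ 2 by ring, hv2, Real.sq_sqrt hi]
  have hu0 : 0 < u := Real.sqrt_pos.2 (Real.sqrt_pos.2 (by positivity))
  have hv0 : 0 ≤ v := Real.sqrt_nonneg _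
  have hvu : v ≤ u := Real.sqrt_le_sqrt (Real.sqrt_le_sqrt (by linarith))
  rw [← hu2, div_le_iff₀ (by positivity)]
  have h1 : v ^ 2 ≤ u ^ 2 := by gcongr
  have h2 : v ^ 3 ≤ u ^ 3 := by gcongr
  have h3 : u ^ 2 * v ≤ u ^ 3 := by nlinarith
  have h4 : u * v ^ 2 ≤ u ^ 3 := by nlinarith
  have h5 : (u - v) * (u ^ 3 + u ^ 2 * v + u * v ^ 2 + v ^ 3) = 1 := by nlinarith
  have h6 : (u - v) * (u ^ 3 + u ^ 2 * v + u * v ^ 2 + v ^ 3) ≤ (u - v) * (4 * u ^ 3) :=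
    mul_le_mul_of_nonneg_left (by linarith) (by linarith)
  calc (1 : ℝ) ≤ (u - v) * (4 * u ^ 3) := by linarith
    _ = 4 * (u - v) * (u ^ 2 * u) := by ring

lemma sum_ite_lt_le {f g : ℕ → ℝ} (hg : Monotone g) (hg0 : 0 ≤ g 0)
    (hf : ∀ i, f (i + 1) ≤ g (i + 1) - g i) (x : ℝ) {c : ℝ} (hc0 : 0 ≤ c)
    (hc : ∀ i : ℕ, (i : ℝ) ≤ x → g i ≤ c) (T : ℕ) :
    ∑ i ∈ Finset.range T, (if ((i + 1 : ℕ) : ℝ) < x then f (i + 1) else 0) ≤ min (g T) c := by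
  induction T with
  | zero => simp [hg0, hc0]
  | succ T ih =>
    rw [Finset.sum_range_succ]
    have h1 := ih.trans (min_le_left _ _)
    have h2 := ih.trans (min_le_right _ _)
    split_ifs with hx
    · have := hf T
      have h3 := hc (T + 1) hx.le
      refine le_min ?_ ?_ <;> linarith
    · have := hg (Nat.le_succ T)
      refine le_min ?_ ?_ <;> simp only [add_zero] <;> linarith

lemma sum_ite_ge_inv_le {x : ℝ} (hx : 1 ≤ x) (T : ℕ) :
    ∑ i ∈ Finset.range T, (if ((i + 1 : ℕ) : ℝ) < x then 0 else 1 / ((i + 1 : ℕ) : ℝ)) ≤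
      if (T : ℝ) < x then 0 else 1 + Real.log (T / x) := by
  induction T with
  | zero => simp [show (0 : ℝ) < x by linarith]
  | succ T ih =>
    rw [Finset.sum_range_succ]
    by_cases h1 : ((T + 1 : ℕ) : ℝ) < x
    · have h2 : (T : ℝ) < x := by push_cast at h1; linarith
      rw [if_pos h2] at ih
      rw [if_pos h1, if_pos h1]
      linarith
    · rw [if_neg h1, if_neg h1]
      rw [not_lt] at h1
      have hT1 : (1 : ℝ) ≤ ((T + 1 : ℕ) : ℝ) := by push_cast; linarith [Nat.cast_nonneg (α := ℝ) T]
      by_cases h2 : (T : ℝ) < x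
      · rw [if_pos h2] at ih
        have h3 : 0 ≤ Real.log (((T + 1 : ℕ) : ℝ) / x) :=
          Real.log_nonneg (by rw [le_div_iff₀ (by linarith)]; linarith)
        have h4 : 1 / ((T + 1 : ℕ) : ℝ) ≤ 1 := by rw [div_le_one (by linarith)]; exact hT1
        linarith
      · rw [if_neg h2] at ih
        rw [not_lt] at h2
        have hT : (0 : ℝ) < T := by linarith
        have h3 : Real.log (((T + 1 : ℕ) : ℝ) / x) =
            Real.log ((T : ℝ) / x) + Real.log (((T + 1 : ℕ) : ℝ) / T) := by
          rw [← Real.log_mul (by positivity) (by positivity)]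
          congr 1
          field_simp
        have h4 := Real.one_sub_inv_le_log_of_pos (x := ((T + 1 : ℕ) : ℝ) / T) (by positivity)
        have h5 : 1 - (((T + 1 : ℕ) : ℝ) / T)⁻¹ = 1 / ((T + 1 : ℕ) : ℝ) := by
          rw [inv_div]; field_simp; push_cast; ring
        rw [h5] at h4
        linarith

lemma four_pow_log_bounds {N : ℕ} (hN : N ≠ 0) :
    (4 : ℝ) ^ Nat.log 4 N ≤ N ∧ (N : ℝ) ≤ 4 * 4 ^ Nat.log 4 N := by
  constructor
  · exact_mod_cast Nat.pow_log_le_self 4 hN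
  · have := (Nat.lt_pow_succ_log_self (by norm_num : 1 < 4) N).le
    rw [pow_succ] at this
    have h : (N : ℝ) ≤ ((4 ^ Nat.log 4 N * 4 : ℕ) : ℝ) := by exact_mod_cast this
    push_cast at h
    linarith

lemma sqrt_add_le_sqrt_add_sqrt {a b : ℝ} (ha : 0 ≤ a) (hb : 0 ≤ b) : √(a + b) ≤ √a + √b := by
  rw [Real.sqrt_le_left (by positivity), add_sq, Real.sq_sqrt ha, Real.sq_sqrt hb]
  have : 0 ≤ 2 * √a * √b := by positivity
  linarith

/-- From N ≤ 4 · 4 ^ j one gets 4 ^ j ≥ N/4 and 2 ^ j ≥ √N / 2, so the parts B and H / 2 ^ j of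
`devLog` decay like N^(-1/2) and N^(-3/4). -/
lemma sqrt_devLog_div_le (hB : 0 ≤ B) {N : ℕ} (hN : N ≠ 0) :
    √(devLog H B (Nat.log 4 N) / 4 ^ Nat.log 4 N) ≤
      2 * √B * (1 / √N) + 3 * √H * (1 / (√N * √√N)) := by
  obtain ⟨-, hN4⟩ := four_pow_log_bounds hN
  set j := Nat.log 4 N
  have hNpos : (0 : ℝ) < N := by positivity
  set v := √√(N : ℝ)
  have hv0 : 0 < v := Real.sqrt_pos.2 (Real.sqrt_pos.2 hNpos)
  have hv2 : v ^ 2 = √(N : ℝ) := Real.sq_sqrt (Real.sqrt_nonneg _)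
  have hv4 : v ^ 4 = N := by
    rw [show v ^ 4 = (v ^ 2) ^ 2 by ring, hv2, Real.sq_sqrt hNpos.le]
  set t : ℝ := 2 ^ j
  have ht : 0 < t := by positivity
  have h4 : (4 : ℝ) ^ j = t ^ 2 := by simp only [t]; rw [← pow_mul, mul_comm, pow_mul]; norm_num
  have hvt : v ^ 2 ≤ 2 * t := by
    rw [h4, ← hv4] at hN4
    nlinarith [sq_nonneg v]
  rw [← hv2]
  have e1 : devLog H B j / 4 ^ j = B / t ^ 2 + H / t ^ 3 := by
    rw [devLog, h4, show (2 : ℝ) ^ j = t from rfl]; field_simp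
  rw [e1]
  refine (sqrt_add_le_sqrt_add_sqrt (by positivity) (by positivity)).trans (add_le_add ?_ ?_)
  · rw [Real.sqrt_le_left (by positivity)]
    have : (2 * √B * (1 / v ^ 2)) ^ 2 = B * (4 / v ^ 4) := by
      rw [mul_pow, mul_pow, Real.sq_sqrt hB]; field_simp; ring
    rw [this, div_eq_mul_one_div]
    refine mul_le_mul_of_nonneg_left ?_ (by positivity)
    rw [div_le_div_iff₀ (by positivity) (by positivity)]
    nlinarith [sq_nonneg v]
  · rw [Real.sqrt_le_left (by positivity)]
    have : (3 * √(H : ℝ) * (1 / (v ^ 2 * v))) ^ 2 = H * (9 / (v ^ 2) ^ 3) := by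
      rw [mul_pow, mul_pow, Real.sq_sqrt (Nat.cast_nonneg _)]; field_simp; ring
    rw [this, div_eq_mul_one_div]
    refine mul_le_mul_of_nonneg_left ?_ (by positivity)
    rw [div_le_div_iff₀ (by positivity) (by positivity)]
    have : (v ^ 2) ^ 3 ≤ (2 * t) ^ 3 := by gcongr
    nlinarith [pow_pos ht 3]

lemma monotone_sqrt_cast : Monotone fun i : ℕ => √(i : ℝ) := fun _ _ h =>
  Real.sqrt_le_sqrt (by exact_mod_cast h)

lemma sum_inv_sqrt_le (T : ℕ) :
    ∑ i ∈ Finset.range T, 1 / √((i + 1 : ℕ) : ℝ) ≤ 2 * √(T : ℝ) := by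
  induction T with
  | zero => simp
  | succ T ih =>
    rw [Finset.sum_range_succ]
    have := inv_sqrt_le T
    push_cast at *
    linarith

lemma sum_inv_rpow_three_quarters_le (T : ℕ) :
    ∑ i ∈ Finset.range T, 1 / (√((i + 1 : ℕ) : ℝ) * √√((i + 1 : ℕ) : ℝ)) ≤ 4 * √√(T : ℝ) := by
  induction T with
  | zero => simp
  | succ T ih =>
    rw [Finset.sum_range_succ]
    have := inv_rpow_three_quarters_le T
    push_cast at *
    linarith

/-- The terms of order N^(-3/4) sum to a multiple of √H T^(1/4) ≤ (H + √T) / 2; thus the summand H /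
2 ^ j of `devLog` costs only a constant and a multiple of the main term. -/
lemma sum_bonus₁_le (hH : 1 ≤ H) (hB : 1 ≤ B) (T : ℕ) :
    ∑ i ∈ Finset.range T, bonus₁ H D B (i + 1) ≤
      80 * H * √D * √B * √T + 48 * H ^ 2 * √D := by
  have h1 : ∀ i, bonus₁ H D B (i + 1) ≤ 8 * H * √D * (2 * √B * (1 / √((i + 1 : ℕ) : ℝ)) +
      3 * √H * (1 / (√((i + 1 : ℕ) : ℝ) * √√((i + 1 : ℕ) : ℝ)))) := by
    intro i
    rw [bonus₁, if_neg (by omega)]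
    exact mul_le_mul_of_nonneg_left (sqrt_devLog_div_le (by linarith) (by omega)) (by positivity)
  refine (Finset.sum_le_sum fun i _ => h1 i).trans ?_
  rw [← Finset.mul_sum, Finset.sum_add_distrib, ← Finset.mul_sum, ← Finset.mul_sum]
  have h2 := sum_inv_sqrt_le T
  have h3 := sum_inv_rpow_three_quarters_le T
  have h4 : √(H : ℝ) * √√(T : ℝ) ≤ (H + √T) / 2 := by
    have e1 := Real.sq_sqrt (Nat.cast_nonneg (α := ℝ) H)
    have e2 := Real.sq_sqrt (Real.sqrt_nonneg (T : ℝ))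
    nlinarith [sq_nonneg (√(H : ℝ) - √√(T : ℝ))]
  have hB1 : 1 ≤ √B := Real.one_le_sqrt.2 hB
  calc _ ≤ 8 * H * √D * (2 * √B * (2 * √T) + 3 * √H * (4 * √√T)) := by gcongr
    _ = 8 * H * √D * (4 * √B * √T + 12 * (√H * √√T)) := by ring
    _ ≤ 8 * H * √D * (4 * √B * √T + 12 * ((H + √T) / 2)) := by gcongr
    _ ≤ 8 * H * √D * (4 * √B * √T + 12 * ((H + √B * √T) / 2)) := by
        gcongr
        nlinarith [Real.sqrt_nonneg (T : ℝ)]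
    _ = _ := by ring

/-- Few samples are charged the square-root bonus, many samples the bonus of order 1/N. The
resulting logarithm of T is replaced by log |S| and a multiple of √T that lies below the main term
of the first bonus. -/
lemma sum_bonus₂_le (hH : 1 ≤ H) (hB : 1 ≤ B) (hS : 1 ≤ nS) (T : ℕ) :
    ∑ i ∈ Finset.range T, bonus₂ H nS B (i + 1) ≤
      176 * H ^ 2 * nS * B * (1 + Real.log nS) + 96 * H * √B * √T := by
  have hH' : (1 : ℝ) ≤ H := by exact_mod_cast hH
  -- Up to constants, the number of samples at which the two expressions in `bonus₂` are equal; both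
  -- parts of the sum are then of order x at the crossover.
  set x : ℝ := H ^ 2 * nS * B with hx
  have hx1 : 1 ≤ x := by
    have := one_le_mul_of_one_le_of_one_le (one_le_mul_of_one_le_of_one_le
      (one_le_pow₀ (n := 2) hH') hS) hB
    exact this
  have hls : 0 ≤ Real.log nS := Real.log_nonneg hS
  have hsx : √x = H * √nS * √B := by
    rw [hx, Real.sqrt_mul (by positivity), Real.sqrt_mul (by positivity),
      Real.sqrt_sq (by positivity)]
  have key : ∀ i, bonus₂ H nS B (i + 1) ≤
      16 * H * √nS * √B * (if ((i + 1 : ℕ) : ℝ) < x then 1 / √((i + 1 : ℕ) : ℝ) else 0) +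
      24 * H * √nS * √H * (if ((i + 1 : ℕ) : ℝ) < x then
        1 / (√((i + 1 : ℕ) : ℝ) * √√((i + 1 : ℕ) : ℝ)) else 0) +
      48 * H ^ 2 * nS * B * (if ((i + 1 : ℕ) : ℝ) < x then 0 else 1 / ((i + 1 : ℕ) : ℝ)) := by
    intro i
    rw [bonus₂, if_neg (by omega)]
    split_ifs with h
    · refine (min_le_left _ _).trans ?_
      have := sqrt_devLog_div_le (H := H) (B := B) (N := i + 1) (by linarith) (by omega)
      refine (mul_le_mul_of_nonneg_left this (by positivity)).trans (le_of_eq ?_)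
      ring
    · refine (min_le_right _ _).trans ?_
      obtain ⟨-, hN4⟩ := four_pow_log_bounds (N := i + 1) (by omega)
      set j := Nat.log 4 (i + 1)
      rw [not_lt] at h
      have h4 : (4 : ℝ) ^ j = (2 ^ j) ^ 2 := by rw [← pow_mul, mul_comm, pow_mul]; norm_num
      have hHj : (H : ℝ) ≤ 2 * 2 ^ j := by
        have : (H : ℝ) ^ 2 ≤ (2 * 2 ^ j) ^ 2 := by
          have e : (H : ℝ) ^ 2 ≤ x := by
            have := one_le_mul_of_one_le_of_one_le hS hB
            rw [hx, mul_assoc]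
            nlinarith [sq_nonneg (H : ℝ)]
          rw [mul_pow, ← h4]
          linarith
        exact (pow_le_pow_iff_left₀ (by positivity) (by positivity) (by norm_num)).1 this
      have hd : devLog H B j ≤ 3 * B := by
        rw [devLog]
        have : (H : ℝ) / 2 ^ j ≤ 2 := by rw [div_le_iff₀ (by positivity)]; exact hHj
        linarith
      have hNp : (0 : ℝ) < ((i + 1 : ℕ) : ℝ) := by positivity
      calc 4 * H ^ 2 * nS * devLog H B j / 4 ^ j
          ≤ 4 * H ^ 2 * nS * (3 * B) / (((i + 1 : ℕ) : ℝ) / 4) := by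
            gcongr
            linarith
        _ = _ := by field_simp; ring
  refine (Finset.sum_le_sum fun i _ => key i).trans ?_
  rw [Finset.sum_add_distrib, Finset.sum_add_distrib, ← Finset.mul_sum, ← Finset.mul_sum,
    ← Finset.mul_sum]
  have s1 := (sum_ite_lt_le (f := fun i => 1 / √(i : ℝ)) (g := fun i => 2 * √(i : ℝ))
    (fun _ _ h => mul_le_mul_of_nonneg_left (monotone_sqrt_cast h) (by norm_num)) (by simp)
    (fun i => by have := inv_sqrt_le i; push_cast; linarith) x (c := 2 * √x) (by positivity)
    (fun i hi => by gcongr) T).trans (min_le_right _ _)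
  have s2 := (sum_ite_lt_le (f := fun i => 1 / (√(i : ℝ) * √√(i : ℝ)))
    (g := fun i => 4 * √√(i : ℝ))
    (fun _ _ h => mul_le_mul_of_nonneg_left (Real.sqrt_le_sqrt (monotone_sqrt_cast h))
      (by norm_num)) (by simp)
    (fun i => by have := inv_rpow_three_quarters_le i; push_cast; linarith) x (c := 4 * √√x)
    (by positivity) (fun i hi => by gcongr) T).trans (min_le_right _ _)
  have s3 := sum_ite_ge_inv_le hx1 T
  have s3' : (if (T : ℝ) < x then 0 else 1 + Real.log (T / x)) ≤
      1 + Real.log nS + 2 * (√T / (H * nS * √B)) := by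
    have hq : 0 ≤ √T / (H * nS * √B) := by positivity
    split_ifs with h
    · linarith
    · rw [not_lt] at h
      have hT : (0 : ℝ) < T := by linarith
      -- The square is arranged so that log y ≤ y - 1, applied to its base, produces √T with the
      -- coefficient that cancels H nS √B below.
      have e1 : (T : ℝ) / x = nS * (√T / (H * nS * √B)) ^ 2 := by
        rw [div_pow, mul_pow, mul_pow, Real.sq_sqrt hT.le, Real.sq_sqrt (by linarith), hx]
        field_simp
      have hpos : 0 < √T / (H * nS * √B) := by
        have := Real.sqrt_pos.2 hT
        have := Real.sqrt_pos.2 (show 0 < B by linarith)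
        positivity
      rw [e1, Real.log_mul (by positivity) (by positivity), Real.log_pow]
      have := Real.log_le_sub_one_of_pos hpos
      push_cast
      linarith
  have hB1 : 0 < √B := Real.sqrt_pos.2 (by linarith)
  have hBs : √B ^ 2 = B := Real.sq_sqrt (by linarith)
  have hSs : √nS ^ 2 = nS := Real.sq_sqrt (by linarith)
  have t1 : 16 * H * √nS * √B * (2 * √x) = 32 * (H ^ 2 * nS * B) := by
    rw [hsx, ← hBs, ← hSs]; simp only [Real.sqrt_sq (Real.sqrt_nonneg _)]; ring
  have t2 : 24 * H * √nS * √H * (4 * √√x) ≤ 96 * (H ^ 2 * nS * B) := by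
    have e1 : √(H : ℝ) * √√x = √(H * √x) := (Real.sqrt_mul (by positivity) _).symm
    have hS1 : 1 ≤ √nS := Real.one_le_sqrt.2 hS
    have hB2 : 1 ≤ √B := Real.one_le_sqrt.2 hB
    have e2 : √(H * √x) ≤ H * √nS * B := by
      rw [Real.sqrt_le_left (by positivity), hsx]
      have : (√nS * √B : ℝ) ≤ (√nS * B) ^ 2 := by
        rw [← hBs]
        have h1 : √nS * √B ≤ √nS ^ 2 * (√B) ^ 4 := by
          have a1 : √nS ≤ √nS ^ 2 := le_self_pow₀ hS1 (by norm_num)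
          have a2 : √B ≤ √B ^ 4 := le_self_pow₀ hB2 (by norm_num)
          exact mul_le_mul a1 a2 (by positivity) (by positivity)
        simp only [Real.sqrt_sq (Real.sqrt_nonneg _)]
        nlinarith
      calc (H : ℝ) * (H * √nS * √B) = H ^ 2 * (√nS * √B) := by ring
        _ ≤ H ^ 2 * (√nS * B) ^ 2 := by gcongr
        _ = _ := by ring
    calc 24 * H * √nS * √H * (4 * √√x) = 96 * (H * √nS) * (√(H : ℝ) * √√x) := by ring
      _ ≤ 96 * (H * √nS) * (H * √nS * B) := by rw [e1]; gcongr
      _ = 96 * (H ^ 2 * √nS ^ 2 * B) := by ring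
      _ = _ := by rw [hSs]
  have t3 : 48 * H ^ 2 * nS * B * (2 * (√T / (H * nS * √B))) = 96 * H * √B * √T := by
    nth_rewrite 1 [← hBs]
    field_simp
    ring
  have u1 : 16 * H * √nS * √B * _ ≤ _ := mul_le_mul_of_nonneg_left s1 (by positivity)
  have u2 : 24 * H * √nS * √H * _ ≤ _ := mul_le_mul_of_nonneg_left s2 (by positivity)
  have u3 : 48 * H ^ 2 * nS * B * _ ≤ _ := mul_le_mul_of_nonneg_left (s3.trans s3') (by positivity)
  have u4 : (H : ℝ) ^ 2 * nS * B * 128 ≤ H ^ 2 * nS * B * (128 * (1 + Real.log nS)) := by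
    gcongr
    linarith
  rw [mul_add, t3] at u3
  linarith

lemma sum_bigBonus_le (hH : 1 ≤ H) (hB : 1 ≤ B) (hS : 1 ≤ nS) (hD : 1 ≤ D) (hDS : D ≤ 2 * nS)
    (T : ℕ) :
    ∑ i ∈ Finset.range T, bigBonus H nS D B i ≤
      1100 * (H ^ 2 * nS * B * (1 + Real.log nS)) + 704 * (H * √D * √B * √T) := by
  have hH' : (1 : ℝ) ≤ H := by exact_mod_cast hH
  have hls : 0 ≤ Real.log nS := Real.log_nonneg hS
  -- Bonuses are collected at the count before the visit, so the sum starts at 0 samples; that first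
  -- term is at most the clip 2 H.
  have h0 : ∑ i ∈ Finset.range T, bigBonus H nS D B i ≤
      2 * H + ∑ i ∈ Finset.range T, bigBonus H nS D B (i + 1) := by
    have h1 := Finset.sum_range_succ' (bigBonus H nS D B) T
    have h2 := Finset.sum_range_succ (bigBonus H nS D B) T
    have h3 := bigBonus_nonneg (H := H) (D := D) (by linarith) (by linarith : 0 ≤ B) T (nS := nS)
    have h4 := bigBonus_le (H := H) (nS := nS) (D := D) (B := B) 0
    linarith
  have h1 : ∑ i ∈ Finset.range T, bigBonus H nS D B (i + 1) ≤
      4 * (∑ i ∈ Finset.range T, bonus₁ H D B (i + 1) +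
        ∑ i ∈ Finset.range T, bonus₂ H nS B (i + 1)) := by
    rw [← Finset.sum_add_distrib, Finset.mul_sum]
    exact Finset.sum_le_sum fun i _ => min_le_right _ _
  have h2 := sum_bonus₁_le (D := D) hH hB T
  have h3 := sum_bonus₂_le hH hB hS T
  have hD1 : 1 ≤ √D := Real.one_le_sqrt.2 hD
  have hDn : √D ≤ 2 * nS := (Real.sqrt_le_left (by linarith)).2 (by nlinarith)
  have hSB : 1 ≤ B * (1 + Real.log nS) := one_le_mul_of_one_le_of_one_le hB (by linarith)
  have e1 : (H : ℝ) ^ 2 * √D ≤ 2 * (H ^ 2 * nS * B * (1 + Real.log nS)) := by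
    calc (H : ℝ) ^ 2 * √D ≤ H ^ 2 * (2 * nS) := by gcongr
      _ = 2 * (H ^ 2 * nS) * 1 := by ring
      _ ≤ 2 * (H ^ 2 * nS) * (B * (1 + Real.log nS)) := by gcongr
      _ = _ := by ring
  have e2 : (H : ℝ) ≤ H ^ 2 * nS * B * (1 + Real.log nS) := by
    have := one_le_mul_of_one_le_of_one_le (one_le_mul_of_one_le_of_one_le hH' hS) hSB
    calc (H : ℝ) = H * 1 := by ring
      _ ≤ H * (H * nS * (B * (1 + Real.log nS))) := by gcongr
      _ = _ := by ring
  have e3 : H * √B * √T ≤ H * √D * √B * √T := by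
    calc H * √B * √T = 1 * (H * √B * √T) := by ring
      _ ≤ √D * (H * √B * √T) := by gcongr
      _ = _ := by ring
  linarith

end BonusSums

/-! ### Empirical models, bonuses and the exploration policy -/

section Tables

variable {S A : Type*} {H : ℕ} [Fintype S] [Fintype A] [MeasurableSpace S]
  [DiscreteMeasurableSpace S] [MeasurableSpace A] [DiscreteMeasurableSpace A]

/-- The number of samples at `(h, s, a)`. -/
noncomputable def visits (s₀ : S) (w : List (Traj S A ℕ H)) (h : Fin H) (s : S) (a : A) : ℕ :=
  (samples s₀ w h s a).length

/-- The initial samples at `(h, s, a)`, as many as the largest power of four allows. -/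
noncomputable def batch (s₀ : S) (w : List (Traj S A ℕ H)) (h : Fin H) (s : S) (a : A) :
    List (ℕ × S) :=
  (samples s₀ w h s a).take (4 ^ Nat.log 4 (visits s₀ w h s a))

/-- Frequencies of the next states in a list of samples. -/
noncomputable def freq (l : List (ℕ × S)) (s' : S) : ℝ := countIn (nextIs s') l / l.length

/-- The empirical transition frequencies. -/
noncomputable def empTrans (s₀ : S) (w : List (Traj S A ℕ H)) (h : Fin H) (s : S) (a : A)
    (s' : S) : ℝ :=
  freq (batch s₀ w h s a) s'

/-- The transition probabilities of `ν`. -/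
noncomputable def transOf (ν : Fin H → S → A → Measure (ℕ × S)) (h : Fin H) (s : S) (a : A)
    (s' : S) : ℝ :=
  (ν h s a).real (nextIs s')

section Means

variable {F : Type*} [NormedAddCommGroup F] [InnerProductSpace ℝ F]

/-- The empirical mean rewards. -/
noncomputable def empMean (ρ : ℕ → F) (s₀ : S) (w : List (Traj S A ℕ H)) (h : Fin H) (s : S)
    (a : A) : F :=
  emp (fun x => ρ x.1) (batch s₀ w h s a)

/-- The mean rewards of `ν`. -/
noncomputable def meanOf (ρ : ℕ → F) (ν : Fin H → S → A → Measure (ℕ × S)) (h : Fin H) (s : S)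
    (a : A) : F :=
  ∫ x, ρ x.1 ∂ν h s a

end Means

lemma length_batch (s₀ : S) (w : List (Traj S A ℕ H)) (h : Fin H) (s : S) (a : A)
    (hN : visits s₀ w h s a ≠ 0) :
    (batch s₀ w h s a).length = 4 ^ Nat.log 4 (visits s₀ w h s a) := by
  rw [batch, List.length_take, min_eq_left]
  exact Nat.pow_log_le_self 4 hN

lemma countIn_nonneg {X : Type*} [MeasurableSpace X] (I : Set X) (l : List X) :
    0 ≤ countIn I l := by
  classical
  refine List.sum_nonneg fun x hx => ?_
  obtain ⟨y, -, rfl⟩ := List.mem_map.1 hx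
  split_ifs <;> norm_num

lemma sum_countIn_nextIs (l : List (ℕ × S)) : ∑ s', countIn (nextIs s') l = l.length := by
  classical
  induction l with
  | nil => simp [countIn]
  | cons x l ih =>
    have h : ∀ s', countIn (nextIs s') (x :: l) =
        (if x.2 = s' then 1 else 0) + countIn (nextIs s') l := by
      intro s'
      simp only [countIn, List.map_cons, List.sum_cons]
      congr 1
    simp only [h, Finset.sum_add_distrib, ih, List.length_cons]
    simp [add_comm]

lemma freq_nonneg (l : List (ℕ × S)) (s' : S) : 0 ≤ freq l s' :=
  div_nonneg (countIn_nonneg _ _) (Nat.cast_nonneg _)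

lemma sum_freq_le (l : List (ℕ × S)) : ∑ s', freq l s' ≤ 1 := by
  simp only [freq]
  rw [← Finset.sum_div, sum_countIn_nextIs]
  exact div_self_le_one _

lemma subStoch_empTrans (s₀ : S) (w : List (Traj S A ℕ H)) : SubStoch (empTrans s₀ w) :=
  fun _ _ _ => ⟨fun s' => freq_nonneg _ s', sum_freq_le _⟩

lemma sum_real_nextIs (ν : Measure (ℕ × S)) [IsProbabilityMeasure ν] :
    ∑ s', ν.real (nextIs s') = 1 := by
  have h := integral_snd_eq_sum ν (fun _ : S => (1 : ℝ))
  simp only [smul_eq_mul, mul_one] at h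
  rw [show ∑ s', ν.real (nextIs s') = ∑ s', ν.real {x | x.2 = s'} from rfl, ← h]
  simp

lemma subStoch_transOf {ν : Fin H → S → A → Measure (ℕ × S)}
    (hν : ∀ h s a, IsProbabilityMeasure (ν h s a)) : SubStoch (transOf ν) := fun h s a => by
  have := hν h s a
  exact ⟨fun _ => measureReal_nonneg, (sum_real_nextIs (ν h s a)).le⟩

variable {F : Type*} [NormedAddCommGroup F] [InnerProductSpace ℝ F]

/-- Averaging reward plus next value over samples is a lookahead in the empirical model; deviation
bounds for averages thereby become bounds on the model error. -/
lemma emp_add_next (ρ : ℕ → F) (V : S → F) (l : List (ℕ × S)) :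
    emp (fun x => ρ x.1 + V x.2) l = emp (fun x => ρ x.1) l + ∑ s', freq l s' • V s' := by
  classical
  have h1 : (l.map fun x => V x.2).sum = ∑ s', countIn (nextIs s') l • V s' := by
    induction l with
    | nil => simp [countIn]
    | cons x l ih =>
      have h : ∀ s', countIn (nextIs s') (x :: l) =
          (if x.2 = s' then 1 else 0) + countIn (nextIs s') l := by
        intro s'
        simp only [countIn, List.map_cons, List.sum_cons]
        congr 1
      simp only [h, add_smul, Finset.sum_add_distrib, ← ih, List.map_cons, List.sum_cons]
      simp
  have h2 : (l.map fun x => ρ x.1 + V x.2).sum =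
      (l.map fun x => ρ x.1).sum + (l.map fun x => V x.2).sum := by
    induction l with
    | nil => simp
    | cons x l ih => simp only [List.map_cons, List.sum_cons]; rw [List.sum_map_add]; abel
  rw [emp, h2, smul_add, h1, emp, Finset.smul_sum]
  congr 1
  refine Finset.sum_congr rfl fun s' _ => ?_
  rw [smul_smul, freq, div_eq_inv_mul]

lemma norm_emp_le {X : Type*} [MeasurableSpace X] {f : X → F} {c : ℝ} (hc : 0 ≤ c)
    (hf : ∀ x, ‖f x‖ ≤ c) (l : List X) : ‖emp f l‖ ≤ c := by
  have h : ‖(l.map f).sum‖ ≤ l.length * c := by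
    induction l with
    | nil => simp
    | cons x l ih =>
      simp only [List.map_cons, List.sum_cons, List.length_cons]
      refine (norm_add_le _ _).trans ?_
      push_cast
      linarith [hf x]
  rw [emp, norm_smul, norm_inv, Real.norm_natCast]
  rcases Nat.eq_zero_or_pos l.length with h0 | h0
  · simp [h0, hc]
  · rw [inv_mul_le_iff₀ (by positivity)]
    exact h

variable {ν : Fin H → S → A → Measure (ℕ × S)} (hν : ∀ h s a, IsProbabilityMeasure (ν h s a))
include hν

lemma integrable_reward {ρ : ℕ → F} (hρ : ∀ i, ‖ρ i‖ ≤ 1) (h : Fin H) (s : S) (a : A) :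
    Integrable (fun x : ℕ × S => ρ x.1) (ν h s a) := by
  have := hν h s a
  exact Integrable.of_bound
    ((StronglyMeasurable.of_discrete (f := ρ)).comp_measurable measurable_fst).aestronglyMeasurable
    1 (.of_forall fun x => hρ x.1)

lemma norm_meanOf_le {ρ : ℕ → F} (hρ : ∀ i, ‖ρ i‖ ≤ 1) (h : Fin H) (s : S) (a : A) :
    ‖meanOf ρ ν h s a‖ ≤ 1 := by
  have := hν h s a
  refine (norm_integral_le_of_norm_le_const (f := fun x : ℕ × S => ρ x.1) (C := 1)
    (.of_forall fun x => hρ x.1)).trans ?_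
  simp

lemma integral_add_next [CompleteSpace F] {ρ : ℕ → F} (hρ : ∀ i, ‖ρ i‖ ≤ 1) (V : S → F)
    (h : Fin H) (s : S) (a : A) :
    ∫ x, (ρ x.1 + V x.2) ∂ν h s a = lookahead (transOf ν) (meanOf ρ ν) h V s a := by
  have := hν h s a
  rw [integral_add (integrable_reward hν hρ h s a), integral_snd_eq_sum]
  · rfl
  · exact Integrable.of_bound ((StronglyMeasurable.of_discrete (f := V)).comp_measurable
      measurable_snd).aestronglyMeasurable (∑ s, ‖V s‖) (.of_forall fun x =>
        Finset.single_le_sum (f := fun s => ‖V s‖) (fun _ _ => norm_nonneg _)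
          (Finset.mem_univ x.2))

omit hν

lemma emp_batch_add_next (ρ : ℕ → F) (V : S → F) (s₀ : S) (w : List (Traj S A ℕ H)) (h : Fin H)
    (s : S) (a : A) : emp (fun x => ρ x.1 + V x.2) (batch s₀ w h s a) =
      lookahead (empTrans s₀ w) (empMean ρ s₀ w) h V s a :=
  emp_add_next ρ V _

/-- The estimates from `w` are as accurate as their bonuses promise, up to the errors `e`. -/
def Accurate {F Θ : Type*} [NormedAddCommGroup F] [InnerProductSpace ℝ F] (s₀ : S)
    (ν : Fin H → S → A → Measure (ℕ × S)) (f : Θ → Fin H → ℕ × S → F)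
    (D B : ℝ) (e : Fin H → ℝ) (w : List (Traj S A ℕ H)) : Prop :=
  ∀ h s a, visits s₀ w h s a = 0 ∨
    ((∀ θ, ‖emp (f θ h) (batch s₀ w h s a) - ∫ x, f θ h x ∂ν h s a‖ ≤
        bonus₁ H D B (visits s₀ w h s a) / 2 + e h) ∧
      2 * H * ∑ s', |empTrans s₀ w h s a s' - transOf ν h s a s'| ≤
        bonus₁ H (Fintype.card S) B (visits s₀ w h s a) + e h ∧
      ∀ g : S → ℝ, (∀ s', 0 ≤ g s' ∧ g s' ≤ 2 * H) →
        ∑ s', empTrans s₀ w h s a s' * g s' ≤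
          (1 + 1 / (H : ℝ)) * ∑ s', transOf ν h s a s' * g s' +
            bonus₂ H (Fintype.card S) B (visits s₀ w h s a) + e h ∧
        ∑ s', transOf ν h s a s' * g s' ≤
          (1 + 1 / (H : ℝ)) * ∑ s', empTrans s₀ w h s a s' * g s' +
            bonus₂ H (Fintype.card S) B (visits s₀ w h s a) + e h)

lemma samples_take_prefix (s₀ : S) (w : List (Traj S A ℕ H)) (i : ℕ) (h : Fin H) (s : S) (a : A) :
    samples s₀ (w.take i) h s a <+: samples s₀ w h s a :=
  (List.take_prefix i w).filterMap _

lemma devLog_mul_le {D B : ℝ} (hD : 1 ≤ D) (j : ℕ) :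
    devLog H (D * B) j ≤ D * devLog H B j := by
  rw [devLog, devLog, mul_add]
  have : (0 : ℝ) ≤ H / 2 ^ j := by positivity
  nlinarith

/-- The samples in a prefix of the data are a prefix of all samples, and estimates use only the
first 4 ^ j of them. Confidence at the scales 4 ^ j of the whole window therefore makes the
estimates of all its prefixes accurate with the same errors. -/
lemma Confident.accurate {F Θ : Type*} [NormedAddCommGroup F] [InnerProductSpace ℝ F] {s₀ : S}
    {f : Θ → Fin H → ℕ × S → F} {D B ε : ℝ} {w : List (Traj S A ℕ H)} (hD : 1 ≤ D)
    (hν : ∀ h s a, IsProbabilityMeasure (ν h s a))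
    (hw : Confident s₀ ν f D B ε w) :
    ∃ e : Fin H → ℝ, (∀ h, 0 ≤ e h) ∧ ∑ h, e h ≤ ε ∧ ∀ i, Accurate s₀ ν f D B e (w.take i) := by
  obtain ⟨e, he, hsum, hw⟩ := hw
  refine ⟨e, he, hsum, fun i h s a => or_iff_not_imp_left.2 fun hN => ?_⟩
  set N := visits s₀ (w.take i) h s a with hNdef
  have hlen := length_batch s₀ (w.take i) h s a hN
  rw [← hNdef] at hlen
  have hbatch : batch s₀ (w.take i) h s a = (samples s₀ w h s a).take (4 ^ Nat.log 4 N) := by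
    obtain ⟨t, ht⟩ := samples_take_prefix s₀ w i h s a
    rw [← ht, List.take_append_of_le_length]
    · rfl
    · exact Nat.pow_log_le_self 4 hN
  obtain ⟨h1, h2, h3⟩ := hw h s a _ _ hbatch hlen
  set Λ := devLog H B (Nat.log 4 N) / 4 ^ Nat.log 4 N with hΛ
  have hE : ∀ s', countIn (nextIs s') (batch s₀ (w.take i) h s a) /
      ((batch s₀ (w.take i) h s a).length : ℝ) = empTrans s₀ (w.take i) h s a s' := fun _ => rfl
  have hT : ∀ s', (ν h s a).real (nextIs s') = transOf ν h s a s' := fun _ => rfl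
  simp only [hE, hT] at h2 h3
  have hb2 : bonus₂ H (Fintype.card S) B N = min (8 * H * √(Fintype.card S : ℝ) * √Λ)
      (4 * H ^ 2 * (Fintype.card S : ℝ) * devLog H B (Nat.log 4 N) / 4 ^ Nat.log 4 N) := by
    rw [bonus₂, if_neg hN]
  refine ⟨fun θ => (h1 θ).trans ?_, ?_, fun g hg => ?_⟩
  · have : √(devLog H (D * B) (Nat.log 4 N) / 4 ^ Nat.log 4 N) ≤ √D * √Λ := by
      rw [← Real.sqrt_mul (by linarith)]
      refine Real.sqrt_le_sqrt ?_
      rw [hΛ, ← mul_div_assoc]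
      gcongr
      exact devLog_mul_le hD _
    rw [bonus₁, if_neg hN]
    have := mul_le_mul_of_nonneg_left this (show (0 : ℝ) ≤ 4 * H by positivity)
    linarith
  · rw [bonus₁, if_neg hN]
    exact h2
  · obtain ⟨g1, g2⟩ := h3 g hg
    -- The L¹ deviation gives the first expression in the minimum `bonus₂`; the two-sided frequency
    -- bounds give the second.
    have hdiff : |∑ s', empTrans s₀ (w.take i) h s a s' * g s' - ∑ s', transOf ν h s a s' * g s'| ≤
        8 * H * √(Fintype.card S : ℝ) * √Λ + e h := by
      refine le_trans ?_ h2
      rw [← Finset.sum_sub_distrib, Finset.mul_sum]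
      refine (Finset.abs_sum_le_sum_abs _ _).trans (Finset.sum_le_sum fun s' _ => ?_)
      rw [← sub_mul, abs_mul, abs_of_nonneg (hg s').1, mul_comm]
      exact mul_le_mul_of_nonneg_right (hg s').2 (abs_nonneg _)
    have hP0 : 0 ≤ ∑ s', transOf ν h s a s' * g s' :=
      (subStoch_transOf hν).sum_mul_nonneg h s a fun s' => (hg s').1
    have hQ0 : 0 ≤ ∑ s', empTrans s₀ (w.take i) h s a s' * g s' :=
      (subStoch_empTrans _ _).sum_mul_nonneg h s a fun s' => (hg s').1
    have hH0 : (0 : ℝ) ≤ 1 / H := by positivity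
    have hP1 := mul_nonneg hH0 hP0
    have hQ1 := mul_nonneg hH0 hQ0
    rw [abs_le] at hdiff
    rw [hb2]
    constructor
    · rcases min_cases (8 * H * √(Fintype.card S : ℝ) * √Λ)
        (4 * H ^ 2 * (Fintype.card S : ℝ) * devLog H B (Nat.log 4 N) / 4 ^ Nat.log 4 N) with
        ⟨hm, -⟩ | ⟨hm, -⟩ <;> rw [hm]
      · linarith
      · exact g1
    · rcases min_cases (8 * H * √(Fintype.card S : ℝ) * √Λ)
        (4 * H ^ 2 * (Fintype.card S : ℝ) * devLog H B (Nat.log 4 N) / 4 ^ Nat.log 4 N) with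
        ⟨hm, -⟩ | ⟨hm, -⟩ <;> rw [hm]
      · linarith
      · exact g2

/-- The bonuses that belong to the data `w`. -/
noncomputable def bonusOf (s₀ : S) (D B : ℝ) (w : List (Traj S A ℕ H)) (h : Fin H) (s : S)
    (a : A) : ℝ :=
  bonus H (Fintype.card S) D B (visits s₀ w h s a)

lemma bonusOf_nonneg (s₀ : S) {D B : ℝ} (hB : 0 ≤ B) (w : List (Traj S A ℕ H)) (h : Fin H) (s : S)
    (a : A) : 0 ≤ bonusOf s₀ D B w h s a :=
  bonus_nonneg (Nat.cast_nonneg _) hB _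

lemma two_mul_le_bonusOf (s₀ : S) {D B : ℝ} (w : List (Traj S A ℕ H)) {h : Fin H} {s : S}
    {a : A} (h0 : visits s₀ w h s a = 0) : 2 * (H : ℝ) ≤ bonusOf s₀ D B w h s a := by
  rw [bonusOf, h0, bonus, bonus₁, bonus₂, if_pos rfl, if_pos rfl, add_zero]

variable [Nonempty A]

/-- The uncertainty of the model estimated from `w`. -/
noncomputable def uncOf (s₀ : S) (D B : ℝ) (w : List (Traj S A ℕ H)) : ℕ → S → ℝ :=
  unc (empTrans s₀ w) (bonusOf s₀ D B w)

/-- The policy that is greedy for the uncertainty. -/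
noncomputable def explorePolicy (s₀ : S) (D B : ℝ) (w : List (Traj S A ℕ H)) : Policy S A H :=
  detPolicy fun h s => (exists_unc_eq (empTrans s₀ w) (bonusOf s₀ D B w) h s).choose

lemma one_add_div_pow_le (H : ℕ) (x : ℝ) (hx : 0 ≤ x) : (1 + x / (H : ℝ)) ^ H ≤ Real.exp x := by
  rcases Nat.eq_zero_or_pos H with rfl | hH
  · simpa using Real.one_le_exp hx
  · calc (1 + x / (H : ℝ)) ^ H ≤ Real.exp (x / H) ^ H := by
          gcongr
          linarith [Real.add_one_le_exp (x / (H : ℝ))]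
      _ = Real.exp x := by
          rw [← Real.exp_nat_mul]
          congr 1
          field_simp

lemma slack_le_exp {x : ℝ} (hx : 0 ≤ x) {e : Fin H → ℝ} (he : ∀ h, 0 ≤ e h) :
    slack (1 + x / (H : ℝ)) e 0 ≤ Real.exp x * (3 * ∑ h, e h) := by
  refine (slack_zero_le (by have : 0 ≤ x / (H : ℝ) := by positivity
                            linarith) he).trans ?_
  exact mul_le_mul_of_nonneg_right (one_add_div_pow_le H x hx)
    (mul_nonneg (by norm_num) (Finset.sum_nonneg fun h _ => he h))

/-- The growth (1 + 5/H) ^ H over the horizon is at most exp 5, for the bonuses as well as for the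
errors. -/
lemma Accurate.uncOf_le {F Θ : Type*} [NormedAddCommGroup F] [InnerProductSpace ℝ F] {s₀ : S}
    {f : Θ → Fin H → ℕ × S → F} {D B : ℝ} {e : Fin H → ℝ} {w : List (Traj S A ℕ H)} (hH : 0 < H)
    (hν : ∀ h s a, IsProbabilityMeasure (ν h s a)) (hB : 0 ≤ B) (he : ∀ h, 0 ≤ e h)
    (hw : Accurate s₀ ν f D B e w) (s : S) :
    uncOf s₀ D B w 0 s ≤ Real.exp 5 *
      (polVal (transOf ν) (fun h s a => bigBonus H (Fintype.card S) D B (visits s₀ w h s a))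
        (explorePolicy s₀ D B w) 0 s + 3 * ∑ h, e h) := by
  have h1 := unc_le_polVal hH (subStoch_transOf hν) (subStoch_empTrans s₀ w)
    (β := bonusOf s₀ D B w) (fun h s a => bonus₁_nonneg (H := H) (D := D) (B := B)
      (visits s₀ w h s a)) (fun h s a => bonus₂_nonneg (H := H) (Nat.cast_nonneg (Fintype.card S))
      hB (visits s₀ w h s a)) (fun h s a => rfl) he
    (fun h s => (exists_unc_eq (empTrans s₀ w) (bonusOf s₀ D B w) h s).choose)
    (fun h s => (exists_unc_eq (empTrans s₀ w) (bonusOf s₀ D B w) h s).choose_spec)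
    (fun h s a => (hw h s a).imp (fun h0 => two_mul_le_bonusOf s₀ w h0)
      fun h3 g hg => (h3.2.2 g hg).1) 0 s
  have hpv : 0 ≤ polVal (transOf ν)
      (fun h s a => bigBonus H (Fintype.card S) D B (visits s₀ w h s a))
        (explorePolicy s₀ D B w) 0 s := by
    refine backward_induction (H := H) (Q := fun h => ∀ s, 0 ≤ polVal (transOf ν)
      (fun h s a => bigBonus H (Fintype.card S) D B (visits s₀ w h s a))
        (explorePolicy s₀ D B w) h s) (fun h hh s => (polVal_of_le _ _ _ hh s).ge)
      (fun h ih s => ?_) 0 s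
    rw [polVal_eq]
    refine Finset.sum_nonneg fun a _ => mul_nonneg (policy_nonneg _ _ _ _) (add_nonneg ?_ ?_)
    · exact bigBonus_nonneg (Nat.cast_nonneg _) hB _
    · exact (subStoch_transOf hν).sum_mul_nonneg h s a ih
  have h2 := slack_le_exp (x := 5) (by norm_num) he
  have h3 := mul_le_mul_of_nonneg_right (one_add_div_pow_le H 5 (by norm_num)) hpv
  refine h1.trans ?_
  rw [mul_add]
  exact add_le_add h3 h2

end Tables

/-! ### Collected and expected bonuses -/

section Regret

variable {S A O : Type*} {H : ℕ} [Fintype S] [Fintype A] [MeasurableSpace S]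
  [DiscreteMeasurableSpace S] [MeasurableSpace A] [DiscreteMeasurableSpace A] [MeasurableSpace O]

/-- The bonuses collected along `w`. -/
noncomputable def collected (s₀ : S) (β : ℕ → ℝ) (w : List (Traj S A ℕ H)) : ℝ :=
  ∑ h, ∑ s, ∑ a, ∑ i ∈ Finset.range (visits s₀ w h s a), β i

lemma collected_append (s₀ : S) (β : ℕ → ℝ) (w : List (Traj S A ℕ H)) (τ : Traj S A ℕ H) :
    collected s₀ β (w ++ [τ]) =
      collected s₀ β w + ∑ h, β (visits s₀ w h (τ h).1 (τ h).2.1) := by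
  classical
  rw [collected, collected, ← Finset.sum_add_distrib]
  refine Finset.sum_congr rfl fun h _ => ?_
  have key : ∀ s a, ∑ i ∈ Finset.range (visits s₀ (w ++ [τ]) h s a), β i =
      ∑ i ∈ Finset.range (visits s₀ w h s a), β i +
        if (τ h).1 = s then if (τ h).2.1 = a then β (visits s₀ w h s a) else 0 else 0 := by
    intro s a
    unfold visits
    rw [samples_append_singleton]
    by_cases h1 : (τ h).1 = s <;> by_cases h2 : (τ h).2.1 = a <;>
      simp [h1, h2, Finset.sum_range_succ]
  simp only [key, Finset.sum_add_distrib]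
  congr 1
  simp

lemma sum_visits (s₀ : S) (w : List (Traj S A ℕ H)) (h : Fin H) :
    ∑ s, ∑ a, visits s₀ w h s a = w.length := by
  classical
  induction w using List.reverseRecOn with
  | nil => simp [visits, samples]
  | append_singleton w τ ih =>
    have key : ∀ s a, visits s₀ (w ++ [τ]) h s a = visits s₀ w h s a +
        if (τ h).1 = s then if (τ h).2.1 = a then 1 else 0 else 0 := by
      intro s a
      unfold visits
      rw [samples_append_singleton]
      by_cases h1 : (τ h).1 = s <;> by_cases h2 : (τ h).2.1 = a <;> simp [h1, h2]
    simp only [key, Finset.sum_add_distrib, ih, List.length_append, List.length_singleton]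
    simp

/-- At each step the visit counts of the pairs add up to the number of episodes, so Cauchy–Schwarz
bounds the sum of their square roots. -/
lemma collected_le {β : ℕ → ℝ} {u v : ℝ} (hv : 0 ≤ v)
    (hβ : ∀ T : ℕ, ∑ i ∈ Finset.range T, β i ≤ u + v * √T) (s₀ : S)
    (w : List (Traj S A ℕ H)) :
    collected s₀ β w ≤ H * (Fintype.card S * Fintype.card A * u +
      v * √(Fintype.card S * Fintype.card A * w.length)) := by
  have key : ∀ h : Fin H, ∑ s, ∑ a, ∑ i ∈ Finset.range (visits s₀ w h s a), β i ≤
      Fintype.card S * Fintype.card A * u +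
        v * √(Fintype.card S * Fintype.card A * w.length) := by
    intro h
    have h1 : ∑ s, ∑ a, √(visits s₀ w h s a : ℝ) ≤
        √(Fintype.card S * Fintype.card A * w.length) := by
      refine Real.le_sqrt_of_sq_le ?_
      rw [← Finset.sum_product']
      refine (sq_sum_le_card_mul_sum_sq).trans (le_of_eq ?_)
      have h2 : ∀ x : S × A, √(visits s₀ w h x.1 x.2 : ℝ) ^ 2 = (visits s₀ w h x.1 x.2 : ℝ) :=
        fun x => Real.sq_sqrt (Nat.cast_nonneg _)
      simp only [h2]
      rw [Finset.sum_product]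
      have := sum_visits s₀ w h
      rw [← this]
      push_cast
      simp [Finset.card_univ]
    calc _ ≤ ∑ s, ∑ a, (u + v * √(visits s₀ w h s a : ℝ)) :=
          Finset.sum_le_sum fun s _ => Finset.sum_le_sum fun a _ => hβ _
      _ = Fintype.card S * Fintype.card A * u + v * ∑ s, ∑ a, √(visits s₀ w h s a : ℝ) := by
          simp only [Finset.sum_add_distrib, ← Finset.mul_sum]
          simp [Finset.card_univ, mul_assoc]
      _ ≤ _ := by gcongr
  refine (Finset.sum_le_sum fun h _ => key h).trans (le_of_eq ?_)
  rw [Finset.sum_const, Finset.card_univ, Fintype.card_fin, nsmul_eq_mul]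

lemma transOf_obsLaw {q : O → ℕ} (hq : Measurable q) (s₀ : S) (M : Env S A O H) (h : Fin H)
    (hh : h.1 + 1 < H) (s : S) (a : A) (s' : S) :
    transOf (obsLaw q s₀ M) h s a s' = (M.step h s a).real {x | x.2 = s'} := by
  rw [transOf, obsLaw, sampleLaw, Measure.map_map (by fun_prop) (measurable_sampleLaw_map s₀ h),
    measureReal_def, Measure.map_apply ((by fun_prop : Measurable (Prod.map q (id : S → S))).comp
      (measurable_sampleLaw_map s₀ h)) (measurableSet_nextIs s'), measureReal_def]
  congr 2
  ext x
  simp [nextIs, hh]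

/-- Values are polynomial expressions in the transition probabilities. -/
lemma expectedSum_eq_polVal {F : Type*} [NormedAddCommGroup F] [NormedSpace ℝ F] [CompleteSpace F]
    {q : O → ℕ} (hq : Measurable q) (s₀ : S) (M : Env S A O H) (g : Fin H → S → A → F)
    (π : Policy S A H) :
    M.expectedSum g π = polVal (transOf (obsLaw q s₀ M)) g π 0 M.init :=
  integral_trajLaw_sum M.step M.isProb _ (fun h hh s a s' => transOf_obsLaw hq s₀ M h hh s a s')
    g π M.init

lemma exp_neg_le_one_sub_half {x : ℝ} (h0 : 0 ≤ x) (h1 : x ≤ 1) :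
    Real.exp (-x) ≤ 1 - x / 2 := by
  have h2 : Real.exp (-x) ≤ (1 + x)⁻¹ := by
    rw [Real.exp_neg]
    exact inv_anti₀ (by linarith) (by linarith [Real.add_one_le_exp x])
  refine h2.trans ?_
  rw [inv_le_iff_one_le_mul₀ (by linarith)]
  nlinarith

/-- The sum over an episode divided by 2 H² lies in [0, 1], where exp (-x) ≤ 1 - x/2; taking means
and using 1 - y ≤ exp (-y) gives the bound. -/
lemma lintegral_exp_neg_sum_le {q : O → ℕ} (hq : Measurable q) (s₀ : S) (M : Env S A O H)
    (hH : 0 < H) {g : Fin H → S → A → ℝ} (hg0 : ∀ h s a, 0 ≤ g h s a)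
    (hg : ∀ h s a, g h s a ≤ 2 * H) (π : Policy S A H) :
    ∫⁻ τ, ENNReal.ofReal (Real.exp (-((∑ h, g h (τ h).1 (τ h).2.1) / (2 * (H : ℝ) ^ 2))))
      ∂M.episode π ≤
      ENNReal.ofReal (Real.exp (-(polVal (transOf (obsLaw q s₀ M)) g π 0 M.init /
        (4 * (H : ℝ) ^ 2)))) := by
  have hHp : (0 : ℝ) < H := by exact_mod_cast hH
  have hI := integrable_sum_visit g (M.episode π)
  have hbound : ∀ τ : Traj S A O H,
      Real.exp (-((∑ h, g h (τ h).1 (τ h).2.1) / (2 * (H : ℝ) ^ 2))) ≤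
        1 - (∑ h, g h (τ h).1 (τ h).2.1) / (4 * (H : ℝ) ^ 2) := by
    intro τ
    refine (exp_neg_le_one_sub_half ?_ ?_).trans (le_of_eq ?_)
    · exact div_nonneg (Finset.sum_nonneg fun h _ => hg0 _ _ _) (by positivity)
    · rw [div_le_one (by positivity)]
      refine (Finset.sum_le_sum fun h _ => hg h (τ h).1 (τ h).2.1).trans (le_of_eq ?_)
      simp
      ring
    · field_simp
      ring
  have hI' : Integrable (fun τ : Traj S A O H =>
      1 - (∑ h, g h (τ h).1 (τ h).2.1) / (4 * (H : ℝ) ^ 2)) (M.episode π) :=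
    (integrable_const 1).sub (hI.div_const _)
  refine (lintegral_mono fun τ => ENNReal.ofReal_le_ofReal (hbound τ)).trans ?_
  rw [← ofReal_integral_eq_lintegral_ofReal hI'
    (.of_forall fun τ => (Real.exp_pos _).le.trans (hbound τ))]
  refine ENNReal.ofReal_le_ofReal ?_
  rw [integral_sub (integrable_const 1) (hI.div_const _), integral_div]
  have := expectedSum_eq_polVal hq s₀ M g π
  rw [Env.expectedSum] at this
  rw [this]
  have h2 := Real.add_one_le_exp (-(polVal (transOf (obsLaw q s₀ M)) g π 0 M.init /
        (4 * (H : ℝ) ^ 2)))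
  simp
  linarith

section Window

variable [Nonempty A] {q : O → ℕ} (hq : Measurable q) (M : Env S A O H)
  (pol : List (Traj S A ℕ H) → Policy S A H)
  (out : List (Traj S A ℕ H) → ProbabilityMeasure (Policy S A H)) (m k : ℕ)
  (s₀ : S) {K₀ K : ℕ} {D B : ℝ}

/-- The clipped bonuses that belong to the data `w`. -/
noncomputable def bigBonusOf (s₀ : S) (D B : ℝ) (w : List (Traj S A ℕ H)) (h : Fin H) (s : S)
    (a : A) : ℝ :=
  bigBonus H (Fintype.card S) D B (visits s₀ w h s a)

/-- The expected sum of the clipped bonuses in the next episode. -/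
noncomputable def expBonus (q : O → ℕ) (M : Env S A O H) (s₀ : S) (D B : ℝ)
    (w : List (Traj S A ℕ H)) : ℝ :=
  polVal (transOf (obsLaw q s₀ M)) (bigBonusOf s₀ D B w) (explorePolicy s₀ D B w) 0 M.init

/-- An exponential supermartingale for nonnegative bounded sums. Giving away a factor 2 in the
collected bonuses avoids a fluctuation of order √K; only 4 H² L is added. -/
lemma measure_regret_le (hH : 0 < H) (hB : 0 ≤ B)
    (hpol : ∀ l : List (Traj S A ℕ H), K₀ ≤ l.length → l.length < K₀ + K →
      pol l = explorePolicy s₀ D B (window K₀ K l)) (L : ℝ) :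
    M.runLaw (policyLearner hq pol out m) k
      {X | 2 * collected s₀ (bigBonus H (Fintype.card S) D B) (window K₀ K (hist q X)) +
          4 * H ^ 2 * L < ∑ i ∈ Finset.range (window K₀ K (hist q X)).length,
            expBonus q M s₀ D B ((window K₀ K (hist q X)).take i)} ≤
      ENNReal.ofReal (Real.exp (-L)) := by
  have hHp : (0 : ℝ) < H := by exact_mod_cast hH
  set ψ : List (Traj S A ℕ H) → List (Traj S A ℕ H) → ENNReal := fun _ w =>
    ENNReal.ofReal (Real.exp ((∑ i ∈ Finset.range w.length, expBonus q M s₀ D B (w.take i)) /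
      (4 * H ^ 2) - collected s₀ (bigBonus H (Fintype.card S) D B) w / (2 * H ^ 2))) with hψ
  have h1 := lintegral_window_le hq M pol out m hpol ψ
    (fun _ => by simp [hψ, collected, visits, samples]) ?_ k
  · have hsub : {X | 2 * collected s₀ (bigBonus H (Fintype.card S) D B)
        (window K₀ K (hist q X)) + 4 * H ^ 2 * L <
          ∑ i ∈ Finset.range (window K₀ K (hist q X)).length,
            expBonus q M s₀ D B ((window K₀ K (hist q X)).take i)} ⊆
        {X : Fin k → Traj S A O H | ENNReal.ofReal (Real.exp L) ≤
          ψ ((hist q X).take K₀) (window K₀ K (hist q X))} := by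
      intro X hX
      refine ENNReal.ofReal_le_ofReal (Real.exp_le_exp.2 ?_)
      simp only [Set.mem_ofPred_eq] at hX
      rw [div_sub_div _ _ (by positivity) (by positivity), le_div_iff₀ (by positivity)]
      nlinarith [mul_lt_mul_of_pos_left hX (show (0 : ℝ) < 2 * H ^ 2 by positivity)]
    refine (measure_mono hsub).trans ?_
    have h2 := meas_ge_le_lintegral_div (μ := M.runLaw (policyLearner hq pol out m) k)
      (measurable_comp_hist hq (fun l => ψ (l.take K₀) (window K₀ K l)) k).aemeasurable
      (ε := ENNReal.ofReal (Real.exp L))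
      (by simp [Real.exp_pos]) ENNReal.ofReal_ne_top
    refine h2.trans ((ENNReal.div_le_div_right h1 _).trans (le_of_eq ?_))
    rw [one_div, Real.exp_neg, ENNReal.ofReal_inv_of_pos (Real.exp_pos L)]
  · intro _ w
    have h2 : ∀ τ : Traj S A O H, ψ [] (w ++ [digest q τ]) =
        ENNReal.ofReal (Real.exp ((∑ i ∈ Finset.range w.length, expBonus q M s₀ D B (w.take i)) /
          (4 * H ^ 2) - collected s₀ (bigBonus H (Fintype.card S) D B) w / (2 * H ^ 2) +
          expBonus q M s₀ D B w / (4 * H ^ 2))) *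
        ENNReal.ofReal (Real.exp (-((∑ h, bigBonusOf s₀ D B w h (τ h).1 (τ h).2.1) /
          (2 * (H : ℝ) ^ 2)))) := by
      intro τ
      rw [← ENNReal.ofReal_mul (Real.exp_pos _).le, ← Real.exp_add]
      simp only [hψ]
      congr 2
      rw [List.length_append, List.length_singleton, Finset.sum_range_succ, collected_append]
      have h3 : ∑ i ∈ Finset.range w.length, expBonus q M s₀ D B ((w ++ [digest q τ]).take i) =
          ∑ i ∈ Finset.range w.length, expBonus q M s₀ D B (w.take i) :=
        Finset.sum_congr rfl fun i hi => by
          rw [List.take_append_of_le_length (Finset.mem_range.1 hi).le]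
      have h4 : (w ++ [digest q τ]).take w.length = w := by simp
      have h5 : ∑ h, bigBonus H (Fintype.card S) D B
          (visits s₀ w h (digest q τ h).1 (digest q τ h).2.1) =
          ∑ h, bigBonusOf s₀ D B w h (τ h).1 (τ h).2.1 := rfl
      rw [h3, h4, h5]
      ring
    change ∫⁻ τ, ψ [] (w ++ [digest q τ]) ∂_ ≤ ψ [] w
    simp only [h2]
    rw [lintegral_const_mul' _ _ ENNReal.ofReal_ne_top]
    refine (mul_le_mul_right (lintegral_exp_neg_sum_le hq s₀ M hH
      (g := bigBonusOf s₀ D B w) (fun h s a => bigBonus_nonneg (Nat.cast_nonneg _) hB _)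
      (fun h s a => bigBonus_le _) (explorePolicy s₀ D B w)) _).trans (le_of_eq ?_)
    rw [← ENNReal.ofReal_mul (Real.exp_pos _).le, ← Real.exp_add]
    simp only [hψ]
    congr 2
    rw [expBonus]
    ring

include hq in
/-- Some prefix of accurate data with small regret has a small uncertainty. -/
lemma exists_uncOf_le {F Θ : Type*} [NormedAddCommGroup F] [InnerProductSpace ℝ F] [Nonempty S]
    (hH : 0 < H) (hB : 1 ≤ B) (hD : 1 ≤ D) (hDS : D ≤ 2 * Fintype.card S)
    {f : Θ → Fin H → ℕ × S → F} {e : Fin H → ℝ} (he : ∀ h, 0 ≤ e h)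
    {ε L : ℝ} (hε : ∑ h, e h ≤ ε) {w : List (Traj S A ℕ H)} (hw : w ≠ [])
    (hacc : ∀ i, Accurate s₀ (obsLaw q s₀ M) f D B e (w.take i))
    (hreg : ∑ i ∈ Finset.range w.length, expBonus q M s₀ D B (w.take i) ≤
      2 * collected s₀ (bigBonus H (Fintype.card S) D B) w + 4 * H ^ 2 * L) :
    ∃ i < w.length, uncOf s₀ D B (w.take i) 0 M.init ≤ Real.exp 5 *
      ((2200 * (H ^ 3 * Fintype.card S ^ 2 * Fintype.card A * B *
          (1 + Real.log (Fintype.card S))) +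
        1408 * (H ^ 2 * √D * √B * √(Fintype.card S * Fintype.card A * w.length)) +
        4 * H ^ 2 * L) / w.length + 3 * ε) := by
  have hν := isProbabilityMeasure_obsLaw (q := q) M hq s₀
  have hS : (1 : ℝ) ≤ Fintype.card S := by exact_mod_cast Fintype.card_pos
  have hlen : 0 < w.length := List.length_pos_iff.2 hw
  have hlen' : (0 : ℝ) < w.length := by exact_mod_cast hlen
  have hc := collected_le (β := bigBonus H (Fintype.card S) D B) (v := 704 * (H * √D * √B))
    (u := 1100 * (H ^ 2 * Fintype.card S * B * (1 + Real.log (Fintype.card S))))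
    (by positivity) (fun T => (sum_bigBonus_le hH hB hS hD hDS T).trans (le_of_eq (by ring)))
    s₀ w
  set Z : ℝ := 2200 * (H ^ 3 * Fintype.card S ^ 2 * Fintype.card A * B *
          (1 + Real.log (Fintype.card S))) +
        1408 * (H ^ 2 * √D * √B * √(Fintype.card S * Fintype.card A * w.length)) +
        4 * H ^ 2 * L with hZ
  have hsum : ∑ i ∈ Finset.range w.length, expBonus q M s₀ D B (w.take i) ≤ Z := by
    refine hreg.trans ?_
    rw [hZ]
    linarith
  -- The bonuses sum to at most Z over the window, so at some episode the expected bonus is at most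
  -- the average.
  obtain ⟨i, hi, hle⟩ := Finset.exists_le_of_sum_le (s := Finset.range w.length)
    ⟨0, Finset.mem_range.2 hlen⟩ (f := fun i => expBonus q M s₀ D B (w.take i))
    (g := fun _ => Z / w.length) (by
      rw [Finset.sum_const, Finset.card_range, nsmul_eq_mul, mul_div_cancel₀ _ hlen'.ne']
      exact hsum)
  refine ⟨i, Finset.mem_range.1 hi, ((hacc i).uncOf_le hH hν (by linarith) he _).trans ?_⟩
  refine mul_le_mul_of_nonneg_left (add_le_add hle ?_) (Real.exp_pos _).le
  linarith

end Window

/-- The first state of every episode is the initial state. -/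
lemma measure_hist_init {q : O → ℕ} (hq : Measurable q) (M : Env S A O H) (hH : 0 < H)
    (pol : List (Traj S A ℕ H) → Policy S A H)
    (out : List (Traj S A ℕ H) → ProbabilityMeasure (Policy S A H)) (m k : ℕ) :
    M.runLaw (policyLearner hq pol out m) k
      {X | ¬ ∀ τ ∈ hist q X, (τ ⟨0, hH⟩).1 = M.init} = 0 := by
  classical
  obtain ⟨n, rfl⟩ : ∃ n, H = n + 1 := ⟨H - 1, by omega⟩
  -- The indicator of a wrong first state starts at 0 and does not increase in the mean.
  set Ψ : List (Traj S A ℕ (n + 1)) → ENNReal := fun l =>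
    if ∀ τ ∈ l, (τ 0).1 = M.init then 0 else 1 with hΨ
  have h1 := lintegral_runLaw_le hq M pol out m Ψ (fun l => ?_) k
  · have h0 : Ψ [] = 0 := by simp [hΨ]
    rw [h0, nonpos_iff_eq_zero, lintegral_eq_zero_iff (measurable_comp_hist hq Ψ k)] at h1
    refine measure_mono_null (fun X hX => ?_) h1
    simp only [Set.mem_compl_iff, Set.mem_ofPred_eq] at hX ⊢
    intro hc
    have hc' : Ψ (hist q X) = 0 := hc
    simp only [hΨ] at hc'
    exact one_ne_zero ((if_neg hX).symm.trans hc')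
  · by_cases hl : ∀ τ ∈ l, (τ 0).1 = M.init
    · have h2 : ∀ τ : Traj S A O (n + 1), Ψ (l ++ [digest q τ]) =
          (fun s => if s = M.init then (0 : ENNReal) else 1) (τ 0).1 := by
        intro τ
        simp only [hΨ]
        refine if_congr ⟨fun h => h (digest q τ) (by simp), fun h t ht => ?_⟩ rfl rfl
        rcases List.mem_append.1 ht with ht | ht
        · exact hl t ht
        · rw [List.mem_singleton.1 ht]; exact h
      refine (lintegral_congr h2).le.trans ?_
      exact (lintegral_trajLaw_fst M.step M.isProb (pol l) M.init
        fun s => if s = M.init then (0 : ENNReal) else 1).le.trans (by simp)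
    · have h2 : Ψ l = 1 := if_neg hl
      rw [h2]
      calc _ ≤ ∫⁻ _, 1 ∂M.episode (pol l) := lintegral_mono fun τ => by
            simp only [hΨ]; split_ifs <;> simp
        _ = 1 := by simp

end Regret

/-! ### A net of directions in the unit ball -/

section Net

/-- The points of a grid in the unit ball. -/
noncomputable def gridPoint (d n : ℕ) (k : Fin d → Fin (2 * n + 1)) : Vec d :=
  WithLp.toLp 2 fun i => ((k i : ℕ) - n : ℝ) / n

/-- Every vector of the unit ball is near a grid point in the unit ball. -/
lemma exists_gridPoint_near {d n : ℕ} (hn : 0 < n) {u : Vec d} (hu : ‖u‖ ≤ 1) :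
    ∃ k, ‖gridPoint d n k‖ ≤ 1 ∧ ‖gridPoint d n k - u‖ ≤ d / n := by
  have hnp : (0 : ℝ) < n := by exact_mod_cast hn
  have hui : ∀ i, |u i| ≤ 1 := fun i => by
    have := PiLp.norm_apply_le u i
    rw [Real.norm_eq_abs] at this
    linarith
  -- Coordinates are rounded towards zero, so the grid point stays in the ball.
  have key : ∀ i, ∃ k : Fin (2 * n + 1), |((k : ℕ) - n : ℝ) / n| ≤ |u i| ∧
      |((k : ℕ) - n : ℝ) / n - u i| ≤ 1 / n := by
    intro i
    have hf0 : (0 : ℝ) ≤ n * |u i| := by positivity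
    have hf : (⌊n * |u i|⌋₊ : ℝ) ≤ n * |u i| := Nat.floor_le hf0
    have hf' : n * |u i| < ⌊n * |u i|⌋₊ + 1 := Nat.lt_floor_add_one _
    have hfn : ⌊n * |u i|⌋₊ ≤ n := by
      have : (⌊n * |u i|⌋₊ : ℝ) ≤ n := hf.trans (by nlinarith [hui i])
      exact_mod_cast this
    set f := ⌊n * |u i|⌋₊
    have e1 : (f : ℝ) / n ≤ |u i| := by rw [div_le_iff₀ hnp]; linarith
    have e2 : |u i| - 1 / n ≤ (f : ℝ) / n := by
      rw [sub_le_iff_le_add, ← add_div, le_div_iff₀ hnp]; linarith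
    rcases le_total 0 (u i) with h | h
    · refine ⟨⟨n + f, by omega⟩, ?_, ?_⟩
      · push_cast
        rw [add_sub_cancel_left, abs_of_nonneg (by positivity)]
        exact e1
      · push_cast
        rw [abs_of_nonneg h] at e1 e2
        rw [add_sub_cancel_left, abs_le]
        have : (0 : ℝ) ≤ 1 / n := by positivity
        constructor <;> linarith
    · refine ⟨⟨n - f, by omega⟩, ?_, ?_⟩
      · simp only [Nat.cast_sub hfn]
        rw [show ((n : ℝ) - f - n) / n = -(f / n) by ring, abs_neg, abs_of_nonneg (by positivity)]
        exact e1
      · simp only [Nat.cast_sub hfn]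
        rw [abs_of_nonpos h] at e1 e2
        rw [show ((n : ℝ) - f - n) / n = -(f / n) by ring, abs_le]
        have : (0 : ℝ) ≤ 1 / n := by positivity
        constructor <;> linarith
  choose k hk1 hk2 using key
  refine ⟨k, ?_, ?_⟩
  · refine le_trans ?_ hu
    rw [EuclideanSpace.norm_eq, EuclideanSpace.norm_eq]
    refine Real.sqrt_le_sqrt (Finset.sum_le_sum fun i _ => ?_)
    simp only [Real.norm_eq_abs]
    exact pow_le_pow_left₀ (abs_nonneg _) (hk1 i) 2
  · rw [EuclideanSpace.norm_eq]
    refine (Real.sqrt_le_sqrt (Finset.sum_le_sum (g := fun _ => (1 / (n : ℝ)) ^ 2)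
      fun i _ => ?_)).trans ?_
    · rw [Real.norm_eq_abs]
      exact pow_le_pow_left₀ (abs_nonneg _) (hk2 i) 2
    · rw [Finset.sum_const, Finset.card_univ, Fintype.card_fin, nsmul_eq_mul,
        Real.sqrt_le_left (by positivity), div_pow, div_pow, one_pow, mul_one_div]
      gcongr
      rcases Nat.eq_zero_or_pos d with rfl | hd
      · simp
      · exact_mod_cast Nat.le_self_pow (by norm_num) d

/-- Indices of a net of the unit ball. -/
def Net (d n : ℕ) : Type := {k : Fin d → Fin (2 * n + 1) // ‖gridPoint d n k‖ ≤ 1}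

noncomputable instance (d n : ℕ) : Fintype (Net d n) := by
  classical
  exact inferInstanceAs
    (Fintype {k : Fin d → Fin (2 * n + 1) // ‖gridPoint d n k‖ ≤ 1})

lemma card_net_le (d n : ℕ) : Fintype.card (Net d n) ≤ (2 * n + 1) ^ d := by
  classical
  refine (Fintype.card_subtype_le _).trans ?_
  simp

end Net

/-! ### Separation from a finite convex hull -/

section Separation

variable {d : ℕ}

/-- If every direction `u` has some `x j` with `⟪u, y - x j⟫ ≤ c`, then `y` is within `c` of a
convex combination of the `x j`. -/
lemma exists_stdSimplex_near {J : Type*} [Fintype J] [Nonempty J] (x : J → Vec d) (y : Vec d)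
    {c : ℝ} (hc : 0 ≤ c) (h : ∀ u : Vec d, ‖u‖ = 1 → ∃ j, inner ℝ u (y - x j) ≤ c) :
    ∃ w ∈ stdSimplex ℝ J, ‖∑ j, w j • x j - y‖ ≤ c := by
  classical
  let T : (J → ℝ) →ₗ[ℝ] Vec d := ∑ j, (LinearMap.proj j : (J → ℝ) →ₗ[ℝ] ℝ).smulRight (x j)
  have hT : ∀ w, T w = ∑ j, w j • x j := fun w => by simp [T]
  set C : Set (Vec d) := T '' stdSimplex ℝ J
  have hC : Convex ℝ C := (convex_stdSimplex ℝ J).linear_image T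
  have hcomp : IsCompact C := (isCompact_stdSimplex ℝ J).image T.continuous_of_finiteDimensional
  have hx : ∀ j, x j ∈ C := fun j => ⟨Pi.single j 1, single_mem_stdSimplex ℝ j, by
    rw [hT, Finset.sum_eq_single j]
    · simp
    · intro i _ hij; simp [Pi.single_eq_of_ne hij]
    · simp⟩
  obtain ⟨p, hpC, hp⟩ := exists_norm_eq_iInf_of_complete_convex
    ⟨x (Classical.arbitrary J), hx _⟩ hcomp.isComplete hC y
  have hp' := (norm_eq_iInf_iff_real_inner_le_zero hC hpC).1 hp
  obtain ⟨w, hw, rfl⟩ := hpC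
  refine ⟨w, hw, ?_⟩
  rw [← hT, norm_sub_rev]
  set v := y - T w with hv
  by_cases hv0 : v = 0
  · rw [hv0, norm_zero]; exact hc
  have hvn : 0 < ‖v‖ := norm_pos_iff.2 hv0
  -- The direction from the projection of y to y: no `x j` lies beyond the projection, so the
  -- component of y - x j is at least the distance ‖v‖.
  obtain ⟨j, hj⟩ := h (‖v‖⁻¹ • v) (by rw [norm_smul, norm_inv, norm_norm, inv_mul_cancel₀ hvn.ne'])
  have h1 := hp' (x j) (hx j)
  have h2 : y - x j = v - (x j - T w) := by rw [hv]; abel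
  rw [h2, inner_sub_right, inner_smul_left, inner_smul_left, real_inner_self_eq_norm_sq] at hj
  simp only [conj_trivial] at hj
  have h3 : ‖v‖⁻¹ * ‖v‖ ^ 2 = ‖v‖ := by field_simp
  have h4 : ‖v‖⁻¹ * inner ℝ v (x j - T w) ≤ 0 :=
    mul_nonpos_of_nonneg_of_nonpos (by positivity) h1
  linarith

end Separation

/-! ### Finite mixtures of policies -/

section Mixtures

variable {S A : Type*} [Fintype S] [Fintype A] [MeasurableSpace S] [MeasurableSpace A] {H : ℕ}
  {F : Type*} [NormedAddCommGroup F] [NormedSpace ℝ F]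

lemma stronglyMeasurable_polVal (P : Fin H → S → A → S → ℝ) (g : Fin H → S → A → F) (h : ℕ) :
    ∀ s, StronglyMeasurable fun π : Policy S A H => polVal P g π h s := by
  refine backward_induction (H := H)
    (Q := fun h => ∀ s, StronglyMeasurable fun π : Policy S A H => polVal P g π h s)
    (fun h hh s => ?_) (fun h ih s => ?_) h
  · simp only [polVal_of_le P g _ hh]
    exact stronglyMeasurable_const
  · simp only [polVal_eq, lookahead]
    refine Finset.stronglyMeasurable_fun_sum _ fun a _ => StronglyMeasurable.smul ?_ ?_
    · refine Measurable.stronglyMeasurable ?_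
      exact (measurable_pi_apply a).comp (measurable_subtype_coe.comp
          ((measurable_pi_apply s).comp (measurable_pi_apply h)))
    · refine stronglyMeasurable_const.add (Finset.stronglyMeasurable_fun_sum _ fun s' _ => ?_)
      exact (ih s').const_smul _

lemma integrable_polVal {P : Fin H → S → A → S → ℝ} (hP : SubStoch P) {g : Fin H → S → A → F}
    (hg : ∀ h s a, ‖g h s a‖ ≤ 1) (h : ℕ) (s : S) (μ : Measure (Policy S A H))
    [IsFiniteMeasure μ] : Integrable (fun π => polVal P g π h s) μ :=
  Integrable.of_bound (stronglyMeasurable_polVal P g h s).aestronglyMeasurable H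
    (.of_forall fun π => norm_polVal_le' hP hg π h s)

/-- Linear functionals of values are values of scalar rewards. -/
lemma map_polVal {G : Type*} [NormedAddCommGroup G] [NormedSpace ℝ G] (T : F →L[ℝ] G)
    (P : Fin H → S → A → S → ℝ) (g : Fin H → S → A → F) (π : Policy S A H) (h : ℕ) :
    ∀ s, T (polVal P g π h s) = polVal P (fun h s a => T (g h s a)) π h s := by
  refine backward_induction (H := H)
    (Q := fun h => ∀ s, T (polVal P g π h s) = polVal P (fun h s a => T (g h s a)) π h s)
    (fun h hh s => ?_) (fun h ih s => ?_) h
  · rw [polVal_of_le _ _ _ hh, polVal_of_le _ _ _ hh, map_zero]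
  · rw [polVal_eq, polVal_eq, map_sum]
    refine Finset.sum_congr rfl fun a _ => ?_
    rw [map_smul, lookahead, lookahead, map_add, map_sum]
    simp only [map_smul, ih]

/-- The mixture of the policies `x j` with weights `w j`. -/
noncomputable def mixture {J : Type*} [Fintype J] (x : J → Policy S A H) (w : J → ℝ)
    (hw : w ∈ stdSimplex ℝ J) : ProbabilityMeasure (Policy S A H) :=
  ⟨∑ j, ENNReal.ofReal (w j) • Measure.dirac (x j), ⟨by
    simp only [Measure.coe_finsetSum, Finset.sum_apply, Measure.smul_apply, measure_univ,
      smul_eq_mul, mul_one]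
    rw [← ENNReal.ofReal_sum_of_nonneg fun j _ => hw.1 j, hw.2, ENNReal.ofReal_one]⟩⟩

lemma coe_mixture {J : Type*} [Fintype J] (x : J → Policy S A H) (w : J → ℝ)
    (hw : w ∈ stdSimplex ℝ J) : (mixture x w hw : Measure (Policy S A H)) =
      ∑ j, ENNReal.ofReal (w j) • Measure.dirac (x j) := rfl

lemma integral_mixture [CompleteSpace F] {J : Type*} [Fintype J] (x : J → Policy S A H)
    (w : J → ℝ) (hw : w ∈ stdSimplex ℝ J) {f : Policy S A H → F} (hf : StronglyMeasurable f) :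
    ∫ π, f π ∂(mixture x w hw : Measure (Policy S A H)) = ∑ j, w j • f (x j) := by
  have hint : ∀ j, Integrable f (ENNReal.ofReal (w j) • Measure.dirac (x j)) := fun j =>
    (Integrable.smul_measure (integrable_dirac' hf (by simp [enorm_lt_top])) ENNReal.ofReal_ne_top)
  rw [coe_mixture, integral_finsetSum_measure fun j _ => hint j]
  refine Finset.sum_congr rfl fun j _ => ?_
  rw [integral_smul_measure, integral_dirac' f (x j) hf, ENNReal.toReal_ofReal (hw.1 j)]

end Mixtures

/-! ### Evaluation and planning in an accurate model -/

section Estimates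

variable {S A : Type*} {H : ℕ} [Fintype S] [Fintype A] [MeasurableSpace S]
  [DiscreteMeasurableSpace S] [MeasurableSpace A] [DiscreteMeasurableSpace A] [Nonempty A]

lemma norm_empMean_le {F : Type*} [NormedAddCommGroup F] [InnerProductSpace ℝ F] {ρ : ℕ → F}
    (hρ : ∀ i, ‖ρ i‖ ≤ 1) (s₀ : S) (w : List (Traj S A ℕ H)) (h : Fin H) (s : S) (a : A) :
    ‖empMean ρ s₀ w h s a‖ ≤ 1 :=
  norm_emp_le (f := fun x : ℕ × S => ρ x.1) zero_le_one (fun x => hρ x.1) _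

variable {ν : Fin H → S → A → Measure (ℕ × S)} (hν : ∀ h s a, IsProbabilityMeasure (ν h s a))
  {s₀ : S} {D B : ℝ} {e : Fin H → ℝ} {w : List (Traj S A ℕ H)}
include hν

lemma slack_two_le (he : ∀ h, 0 ≤ e h) {ε : ℝ} (hε : ∑ h, e h ≤ ε) :
    slack (1 + 2 / (H : ℝ)) e 0 ≤ Real.exp 2 * (3 * ε) :=
  (slack_le_exp (by norm_num) he).trans (by gcongr)

variable {F : Type*} [NormedAddCommGroup F] [InnerProductSpace ℝ F] [CompleteSpace F] {ρ : ℕ → F}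
  (hρ : ∀ i, ‖ρ i‖ ≤ 1)
include hρ

/-- Estimated values of policies whose value functions were tested are accurate. -/
lemma Accurate.norm_polVal_sub_le {Θ : Type*} (x : Θ → Policy S A H) (hB : 0 ≤ B)
    (he : ∀ h, 0 ≤ e h)
    (hw : Accurate s₀ ν (fun θ h y => ρ y.1 + polVal (transOf ν) (meanOf ρ ν) (x θ) (h + 1) y.2)
      D B e w) (θ : Θ) (s : S) :
    ‖polVal (empTrans s₀ w) (empMean ρ s₀ w) (x θ) 0 s -
      polVal (transOf ν) (meanOf ρ ν) (x θ) 0 s‖ ≤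
      uncOf s₀ D B w 0 s + slack (1 + 2 / (H : ℝ)) e 0 := by
  refine ConstrainedRL.norm_polVal_sub_le (subStoch_transOf hν) (subStoch_empTrans s₀ w)
    (bonusOf_nonneg s₀ hB w) he (norm_meanOf_le hν hρ) (norm_empMean_le hρ s₀ w) (x θ)
    (fun h s a => ?_) 0 s
  refine (hw h s a).imp (two_mul_le_bonusOf s₀ w) fun h3 => ?_
  have h4 := h3.1 θ
  rw [emp_batch_add_next, integral_add_next hν hρ] at h4
  refine h4.trans ?_
  rw [bonusOf, bonus]
  have := bonus₁_nonneg (H := H) (D := D) (B := B) (visits s₀ w h s a)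
  have := bonus₂_nonneg (H := H) (nS := Fintype.card S) (Nat.cast_nonneg _) hB
    (visits s₀ w h s a)
  linarith [he h]

/-- Estimated values of all policies are accurate if the bonus covers the `L¹` deviation of the
transition frequencies. -/
lemma Accurate.norm_polVal_sub_le_of_card (hB : 0 ≤ B) (he : ∀ h, 0 ≤ e h)
    (hw : Accurate s₀ ν (fun (_ : Unit) _ y => ρ y.1) (Fintype.card S) B e w)
    (π : Policy S A H) (s : S) :
    ‖polVal (empTrans s₀ w) (empMean ρ s₀ w) π 0 s - polVal (transOf ν) (meanOf ρ ν) π 0 s‖ ≤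
      uncOf s₀ (Fintype.card S) B w 0 s + slack (1 + 2 / (H : ℝ)) e 0 := by
  refine ConstrainedRL.norm_polVal_sub_le (subStoch_transOf hν) (subStoch_empTrans s₀ w)
    (bonusOf_nonneg s₀ hB w) he (norm_meanOf_le hν hρ) (norm_empMean_le hρ s₀ w) π
    (fun h s a => ?_) 0 s
  refine (hw h s a).imp (two_mul_le_bonusOf s₀ w) fun h3 => ?_
  obtain ⟨h4, h5, -⟩ := h3
  have h4' : ‖empMean ρ s₀ w h s a - meanOf ρ ν h s a‖ ≤ _ := h4 ()
  set V := polVal (transOf ν) (meanOf ρ ν) π (h + 1)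
  have h6 : ‖∑ s', empTrans s₀ w h s a s' • V s' - ∑ s', transOf ν h s a s' • V s'‖ ≤
      H * ∑ s', |empTrans s₀ w h s a s' - transOf ν h s a s'| := by
    rw [← Finset.sum_sub_distrib, Finset.mul_sum]
    refine (norm_sum_le _ _).trans (Finset.sum_le_sum fun s' _ => ?_)
    rw [← sub_smul, norm_smul, Real.norm_eq_abs, mul_comm]
    exact mul_le_mul_of_nonneg_right
      (norm_polVal_le' (subStoch_transOf hν) (norm_meanOf_le hν hρ) π _ s') (abs_nonneg _)
  have h7 : lookahead (empTrans s₀ w) (empMean ρ s₀ w) h V s a -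
      lookahead (transOf ν) (meanOf ρ ν) h V s a =
      (empMean ρ s₀ w h s a - meanOf ρ ν h s a) +
        (∑ s', empTrans s₀ w h s a s' • V s' - ∑ s', transOf ν h s a s' • V s') := by
    rw [lookahead, lookahead]; abel
  rw [h7]
  -- The mean reward uses one half of `bonus₁`. The values are bounded by H, and accuracy bounds 2 H
  -- times the L¹ deviation by `bonus₁`, so the transitions use the other half.
  refine (norm_add_le _ _).trans ?_
  rw [bonusOf, bonus]
  have := bonus₂_nonneg (H := H) (nS := Fintype.card S) (Nat.cast_nonneg _) hB
    (visits s₀ w h s a)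
  linarith [he h]

omit hρ [CompleteSpace F] [InnerProductSpace ℝ F] [NormedAddCommGroup F] hν

/-- The policy that is optimal in the model estimated from `w`. -/
noncomputable def plan (s₀ : S) (ρ : ℕ → ℝ) (w : List (Traj S A ℕ H)) : Policy S A H :=
  detPolicy fun h s => (exists_optVal_eq (empTrans s₀ w) (empMean ρ s₀ w) h s).choose

include hν in
/-- Policies that are optimal in an accurate model are nearly optimal. -/
lemma Accurate.optVal_sub_polVal_le {Θ : Type*} (hH : 0 < H) (ρ : Θ → ℕ → ℝ)
    (hρ : ∀ θ i, ‖ρ θ i‖ ≤ 1) (hB : 0 ≤ B) (he : ∀ h, 0 ≤ e h)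
    (hw : Accurate s₀ ν (fun θ h y => ρ θ y.1 +
      optVal (transOf ν) (meanOf (ρ θ) ν) (h + 1) y.2) D B e w) (θ : Θ) (s : S) :
    optVal (transOf ν) (meanOf (ρ θ) ν) 0 s -
      polVal (transOf ν) (meanOf (ρ θ) ν) (plan s₀ (ρ θ) w) 0 s ≤
      2 * (uncOf s₀ D B w 0 s + slack (1 + 2 / (H : ℝ)) e 0) := by
  refine ConstrainedRL.optVal_sub_polVal_le hH (subStoch_transOf hν) (subStoch_empTrans s₀ w)
    (β := bonusOf s₀ D B w)
    (fun h s a => bonus₁_nonneg (H := H) (D := D) (B := B) (visits s₀ w h s a))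
    (fun h s a => bonus₂_nonneg (H := H) (Nat.cast_nonneg (Fintype.card S))
      hB (visits s₀ w h s a)) (fun h s a => rfl) he (norm_meanOf_le hν (hρ θ))
    (norm_empMean_le (hρ θ) s₀ w) _
    (fun h s => (exists_optVal_eq (empTrans s₀ w) (empMean (ρ θ) s₀ w) h s).choose_spec)
    (fun h s a => ?_) 0 s
  refine (hw h s a).imp (two_mul_le_bonusOf s₀ w) fun h3 => ⟨?_, fun g hg => (h3.2.2 g hg).2⟩
  have h4 := h3.1 θ
  rw [emp_batch_add_next, integral_add_next hν (hρ θ), Real.norm_eq_abs] at h4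
  have := bonus₁_nonneg (H := H) (D := D) (B := B) (visits s₀ w h s a)
  linarith

omit [Nonempty A] in
include hν in
lemma inner_meanOf {d : ℕ} {ρ : ℕ → Vec d} (hρ : ∀ i, ‖ρ i‖ ≤ 1) (u : Vec d) (h : Fin H) (s : S)
    (a : A) : inner ℝ u (meanOf ρ ν h s a) = meanOf (fun i => (inner ℝ u (ρ i) : ℝ)) ν h s a :=
  ((innerSL ℝ u).integral_comp_comm (integrable_reward hν hρ h s a)).symm

omit [Nonempty A] in
include hν in
lemma inner_polVal {d : ℕ} {ρ : ℕ → Vec d} (hρ : ∀ i, ‖ρ i‖ ≤ 1) (u : Vec d) (π : Policy S A H)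
    (s : S) : inner ℝ u (polVal (transOf ν) (meanOf ρ ν) π 0 s) =
      polVal (transOf ν) (meanOf (fun i => (inner ℝ u (ρ i) : ℝ)) ν) π 0 s := by
  refine (map_polVal (innerSL ℝ u) (transOf ν) (meanOf ρ ν) π 0 s).trans ?_
  congr 1
  funext h s a
  exact inner_meanOf hν hρ u h s a

/-- The scalar rewards in the directions of a net. -/
noncomputable def netReward {d : ℕ} (n : ℕ) (ρ : ℕ → Vec d) (θ : Net d n) (i : ℕ) : ℝ :=
  inner ℝ (gridPoint d n θ.1) (ρ i)

lemma norm_netReward_le {d n : ℕ} {ρ : ℕ → Vec d} (hρ : ∀ i, ‖ρ i‖ ≤ 1) (θ : Net d n) (i : ℕ) :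
    ‖netReward n ρ θ i‖ ≤ 1 :=
  (norm_inner_le_norm _ _).trans (mul_le_one₀ θ.2 (norm_nonneg _) (hρ i))

include hν in
/-- Mixtures of policies that are nearly optimal in the directions of a net come close to the
value of every mixture. -/
lemma exists_mixture_near {d n : ℕ} (hn : 0 < n) {ρ : ℕ → Vec d} (hρ : ∀ i, ‖ρ i‖ ≤ 1)
    (x : Net d n → Policy S A H) (s : S) {c : ℝ} (hc : 0 ≤ c)
    (hx : ∀ θ, optVal (transOf ν) (meanOf (netReward n ρ θ) ν) 0 s -
      polVal (transOf ν) (meanOf (netReward n ρ θ) ν) (x θ) 0 s ≤ c)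
    (μ : Measure (Policy S A H)) [IsProbabilityMeasure μ] :
    ∃ w ∈ stdSimplex ℝ (Net d n),
      ‖∑ θ, w θ • polVal (transOf ν) (meanOf ρ ν) (x θ) 0 s -
        ∫ π, polVal (transOf ν) (meanOf ρ ν) π 0 s ∂μ‖ ≤ c + d / n * (2 * H) := by
  have hne : Nonempty (Net d n) := by
    obtain ⟨k, hk, -⟩ := exists_gridPoint_near (d := d) hn (u := 0) (by simp)
    exact ⟨⟨k, hk⟩⟩
  have hP := subStoch_transOf hν
  have hint := integrable_polVal hP (norm_meanOf_le hν hρ) 0 s μ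
  set y := ∫ π, polVal (transOf ν) (meanOf ρ ν) π 0 s ∂μ with hy
  have hyn : ‖y‖ ≤ H := by
    refine (norm_integral_le_of_norm_le_const (.of_forall fun π =>
      norm_polVal_le' hP (norm_meanOf_le hν hρ) π 0 s)).trans ?_
    simp
  refine exists_stdSimplex_near (fun θ => polVal (transOf ν) (meanOf ρ ν) (x θ) 0 s) y
    (by positivity) fun u hu => ?_
  obtain ⟨k, hk, hku⟩ := exists_gridPoint_near hn hu.le
  refine ⟨⟨k, hk⟩, ?_⟩
  set θ : Net d n := ⟨k, hk⟩ with hθ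
  -- In a net direction no mixture exceeds the optimal value, and x θ is within c of it. Replacing u
  -- by its neighbour in the net costs d/n times the norm of a difference of values, at most 2 H.
  have h1 : inner ℝ (gridPoint d n k) (y - polVal (transOf ν) (meanOf ρ ν) (x θ) 0 s) ≤ c := by
    have h2 : inner ℝ (gridPoint d n k) y ≤
        optVal (transOf ν) (meanOf (netReward n ρ θ) ν) 0 s := by
      have h3 : inner ℝ (gridPoint d n k) y =
          ∫ π, inner ℝ (gridPoint d n k) (polVal (transOf ν) (meanOf ρ ν) π 0 s) ∂μ :=
        ((innerSL ℝ (gridPoint d n k)).integral_comp_comm hint).symm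
      have hint2 := hint.const_inner (𝕜 := ℝ) (gridPoint d n k)
      rw [h3]
      calc _ ≤ ∫ _, optVal (transOf ν) (meanOf (netReward n ρ θ) ν) 0 s ∂μ := by
            refine integral_mono hint2 (integrable_const _) fun π => ?_
            simp only
            rw [inner_polVal hν hρ]
            exact polVal_le_optVal hP _ π 0 s
        _ = _ := by simp
    rw [inner_sub_right, inner_polVal hν hρ]
    exact (sub_le_sub_right h2 _).trans (hx θ)
  have h2 : inner ℝ (u - gridPoint d n k)
      (y - polVal (transOf ν) (meanOf ρ ν) (x θ) 0 s) ≤ d / n * (2 * H) := by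
    refine (real_inner_le_norm _ _).trans ?_
    rw [norm_sub_rev]
    refine mul_le_mul hku ?_ (norm_nonneg _) (by positivity)
    refine (norm_sub_le _ _).trans ?_
    have := norm_polVal_le' hP (norm_meanOf_le hν hρ) (x θ) 0 s
    linarith
  rw [inner_sub_left] at h2
  linarith

end Estimates

/-! ### The number of episodes in a window -/

section Budget

lemma exp_five_le : Real.exp 5 ≤ 149 := by
  have h := Real.exp_one_lt_d9.le
  have : Real.exp 5 = Real.exp 1 ^ 5 := by rw [← Real.exp_nat_mul]; norm_num
  rw [this]
  calc Real.exp 1 ^ 5 ≤ 2.7182818286 ^ 5 := by gcongr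
    _ ≤ 149 := by norm_num

lemma exp_two_le : Real.exp 2 ≤ 8 := by
  have h := Real.exp_one_lt_d9.le
  have : Real.exp 2 = Real.exp 1 ^ 2 := by rw [← Real.exp_nat_mul]; norm_num
  rw [this]
  calc Real.exp 1 ^ 2 ≤ 2.7182818286 ^ 2 := by gcongr
    _ ≤ 8 := by norm_num

/-- The length of a window of episodes. -/
noncomputable def windowLength (H : ℕ) (nS nA D B ε : ℝ) : ℕ :=
  ⌈2 * 10 ^ 14 * (H ^ 3 * nS ^ 2 * nA * B * (1 + Real.log nS) / ε +
    H ^ 4 * D * B * nS * nA / ε ^ 2)⌉₊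

/-- The two summands of `windowLength` make G3 / K and √(G4 / K) small multiples of ε; the term 4 H²
B is dominated by G3. -/
lemma windowLength_spec {H : ℕ} {nS nA D B ε : ℝ} (hH : 0 < H) (hS : 1 ≤ nS) (hA : 1 ≤ nA)
    (hD : 1 ≤ D) (hB : 1 ≤ B) (hε : 0 < ε) :
    0 < windowLength H nS nA D B ε ∧
    Real.exp 5 * ((2200 * (H ^ 3 * nS ^ 2 * nA * B * (1 + Real.log nS)) +
        1408 * (H ^ 2 * √D * √B * √(nS * nA * windowLength H nS nA D B ε)) +
        4 * H ^ 2 * B) / windowLength H nS nA D B ε + 3 * (ε / 8000)) ≤ ε / 8 := by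
  have hH' : (1 : ℝ) ≤ H := by exact_mod_cast hH
  have hls : 0 ≤ Real.log nS := Real.log_nonneg hS
  set G3 : ℝ := H ^ 3 * nS ^ 2 * nA * B * (1 + Real.log nS) with hG3
  set G4 : ℝ := H ^ 4 * D * B * nS * nA with hG4
  have hG3p : 0 < G3 := by positivity
  have hG4p : 0 < G4 := by positivity
  have hK : 2 * 10 ^ 14 * (G3 / ε + G4 / ε ^ 2) ≤ (windowLength H nS nA D B ε : ℝ) :=
    Nat.le_ceil _
  set K : ℝ := (windowLength H nS nA D B ε : ℝ)
  have hKpos : 0 < K := lt_of_lt_of_le (by positivity) hK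
  refine ⟨Nat.cast_pos.1 hKpos, ?_⟩
  have a3 : 2 * 10 ^ 14 * G3 ≤ K * ε := by
    have : 2 * 10 ^ 14 * (G3 / ε) ≤ K := le_trans (by
      have : 0 ≤ G4 / ε ^ 2 := by positivity
      linarith) hK
    calc 2 * 10 ^ 14 * G3 = 2 * 10 ^ 14 * (G3 / ε) * ε := by field_simp
      _ ≤ K * ε := by gcongr
  have a4 : 2 * 10 ^ 14 * G4 ≤ K * ε ^ 2 := by
    have : 2 * 10 ^ 14 * (G4 / ε ^ 2) ≤ K := le_trans (by
      have : 0 ≤ G3 / ε := by positivity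
      linarith) hK
    calc 2 * 10 ^ 14 * G4 = 2 * 10 ^ 14 * (G4 / ε ^ 2) * ε ^ 2 := by field_simp
      _ ≤ K * ε ^ 2 := by gcongr
  have b4 : (H : ℝ) ^ 2 * B ≤ G3 := by
    have h1 : 1 ≤ H * (nS ^ 2 * nA * (1 + Real.log nS)) :=
      one_le_mul_of_one_le_of_one_le hH' (one_le_mul_of_one_le_of_one_le
        (one_le_mul_of_one_le_of_one_le (one_le_pow₀ hS) hA) (by linarith))
    calc (H : ℝ) ^ 2 * B = H ^ 2 * B * 1 := by ring
      _ ≤ H ^ 2 * B * (H * (nS ^ 2 * nA * (1 + Real.log nS))) := by gcongr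
      _ = G3 := by rw [hG3]; ring
  -- The left side is √(G4 K), with G4 at most K ε² / (2 · 10 ^ 14), and 14000000² < 2 · 10 ^ 14.
  have b2 : H ^ 2 * √D * √B * √(nS * nA * K) ≤ K * ε / 14000000 := by
    have h1 : H ^ 2 * √D * √B * √(nS * nA * K) = √(G4 * K) := by
      rw [hG4, show (H : ℝ) ^ 4 * D * B * nS * nA * K =
        (H ^ 2) ^ 2 * (D * (B * (nS * nA * K))) by ring, Real.sqrt_mul (sq_nonneg _),
        Real.sqrt_sq (sq_nonneg _), Real.sqrt_mul (zero_le_one.trans hD),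
        Real.sqrt_mul (zero_le_one.trans hB) (nS * nA * K)]
      ring
    rw [h1, Real.sqrt_le_left (by positivity)]
    have h2 := mul_le_mul_of_nonneg_left a4 hKpos.le
    have h3 : 0 ≤ K * G4 := by positivity
    nlinarith
  have hsum : (2200 * G3 + 1408 * (H ^ 2 * √D * √B * √(nS * nA * K)) + 4 * H ^ 2 * B) / K ≤
      ε / 9000 := by
    rw [div_le_iff₀ hKpos]
    linarith
  calc _ ≤ 149 * (ε / 9000 + 3 * (ε / 8000)) := by
        refine mul_le_mul exp_five_le (by linarith) (add_nonneg (by positivity) (by positivity))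
          (by norm_num)
    _ ≤ ε / 8 := by linarith

end Budget

/-! ### Data of small uncertainty after one window -/

section WindowOutcome

variable {S A O : Type*} {H : ℕ} [Fintype S] [Fintype A] [MeasurableSpace S]
  [DiscreteMeasurableSpace S] [MeasurableSpace A] [DiscreteMeasurableSpace A] [MeasurableSpace O]
  [Nonempty S] [Nonempty A]

/-- A prefix of `w` whose uncertainty in state `s` is at most `c`, if there is one. -/
noncomputable def pickPrefix (s₀ : S) (D B c : ℝ) (s : S) (w : List (Traj S A ℕ H)) :
    List (Traj S A ℕ H) :=
  Classical.epsilon fun v => (∃ i, v = w.take i) ∧ uncOf s₀ D B v 0 s ≤ c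

/-- The first state in the data. -/
def startOf (hH : 0 < H) (s₀ : S) : List (Traj S A ℕ H) → S
  | [] => s₀
  | τ :: _ => (τ ⟨0, hH⟩).1

lemma startOf_eq (hH : 0 < H) (s₀ s : S) {l : List (Traj S A ℕ H)} (hl : l ≠ [])
    (h : ∀ τ ∈ l, (τ ⟨0, hH⟩).1 = s) : startOf hH s₀ l = s := by
  cases l with
  | nil => exact absurd rfl hl
  | cons τ l => exact h τ (by simp)

variable {F : Type*} [NormedAddCommGroup F] [InnerProductSpace ℝ F] [CompleteSpace F]
  {Θ : Type*} [Fintype Θ] {q : O → ℕ} (hq : Measurable q) (M : Env S A O H)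
  (pol : List (Traj S A ℕ H) → Policy S A H)
  (out : List (Traj S A ℕ H) → ProbabilityMeasure (Policy S A H)) (m k : ℕ) (s₀ : S)

/-- After a long window, a prefix with accurate estimates and small uncertainty can be picked. -/
lemma measure_window_fail_le (hH : 0 < H) {K₀ : ℕ} {D B p ε : ℝ} (hB : 1 ≤ B) (hD : 1 ≤ D)
    (hDS : D ≤ 2 * Fintype.card S) (hε : 0 < ε) (hp : Real.exp (-B) ≤ p)
    (hΘ : Fintype.card Θ * Real.exp (-(D * B)) ≤ p)
    (hpol : ∀ l : List (Traj S A ℕ H), K₀ ≤ l.length →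
      l.length < K₀ + windowLength H (Fintype.card S) (Fintype.card A) D B ε →
      pol l = explorePolicy s₀ D B
        (window K₀ (windowLength H (Fintype.card S) (Fintype.card A) D B ε) l))
    (hk : K₀ + windowLength H (Fintype.card S) (Fintype.card A) D B ε ≤ k)
    (f : List (Traj S A ℕ H) → Θ → Fin H → ℕ × S → F) (hf : ∀ D θ h x, ‖f D θ h x‖ ≤ H) :
    M.runLaw (policyLearner hq pol out m) k
      {X | ¬ ∃ e : Fin H → ℝ, (∀ h, 0 ≤ e h) ∧ ∑ h, e h ≤ ε / 8000 ∧
        Accurate s₀ (obsLaw q s₀ M) (f ((hist q X).take K₀)) D B e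
          (pickPrefix s₀ D B (ε / 8) M.init (window K₀
            (windowLength H (Fintype.card S) (Fintype.card A) D B ε) (hist q X))) ∧
        uncOf s₀ D B (pickPrefix s₀ D B (ε / 8) M.init (window K₀
          (windowLength H (Fintype.card S) (Fintype.card A) D B ε) (hist q X))) 0 M.init
            ≤ ε / 8} ≤
      ENNReal.ofReal (88 * H * Fintype.card S ^ 2 * Fintype.card A * p / (ε / 8000)) +
        ENNReal.ofReal p := by
  have hS : (1 : ℝ) ≤ Fintype.card S := by exact_mod_cast Fintype.card_pos
  have hA : (1 : ℝ) ≤ Fintype.card A := by exact_mod_cast Fintype.card_pos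
  obtain ⟨hKpos, hspec⟩ := windowLength_spec (H := H) hH hS hA hD hB hε
  set K := windowLength H (Fintype.card S) (Fintype.card A) D B ε with hK
  have h1 := measure_not_confident_le hq M pol out m k s₀ hH hpol f hf hB hD
    (ε := ε / 8000) (by positivity) hp hΘ
  -- With L = B the failure probability is exp (-B) ≤ p.
  have h2 := (measure_regret_le hq M pol out m k s₀ hH (zero_le_one.trans hB) hpol B).trans
    (ENNReal.ofReal_le_ofReal hp)
  refine (measure_mono fun X hX => ?_).trans ((measure_union_le _ _).trans (add_le_add h1 h2))
  by_contra hc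
  simp only [Set.mem_union, Set.mem_ofPred_eq, not_or, not_not, not_lt] at hc
  obtain ⟨hconf, hreg⟩ := hc
  refine hX ?_
  obtain ⟨e, he, hsum, hacc⟩ := hconf.accurate hD (isProbabilityMeasure_obsLaw M hq s₀)
  set W := window K₀ K (hist q X) with hW
  have hWlen : W.length = K := by
    rw [hW, window, List.length_take, List.length_drop, length_hist]
    omega
  obtain ⟨i, -, hi⟩ := exists_uncOf_le hq M s₀ hH hB hD hDS he hsum
    (List.ne_nil_of_length_pos (by omega : 0 < W.length)) hacc hreg
  rw [hWlen] at hi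
  -- Any prefix of small uncertainty will do, since accuracy holds for all prefixes; the learner can
  -- compute the uncertainty, so it can pick one.
  obtain ⟨⟨j, hj⟩, hu⟩ := Classical.epsilon_spec (p := fun v : List (Traj S A ℕ H) =>
    (∃ i, v = W.take i) ∧ uncOf s₀ D B v 0 M.init ≤ ε / 8)
    ⟨W.take i, ⟨i, rfl⟩, hi.trans hspec⟩
  refine ⟨e, he, hsum, ?_, hu⟩
  have : pickPrefix s₀ D B (ε / 8) M.init W = W.take j := hj
  rw [this]
  exact hacc j

end WindowOutcome

/-! ### The learning task and its failure probabilities -/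

section ValueLearning

variable (S A : Type*) (H : ℕ) [Fintype S] [Fintype A] [MeasurableSpace S]
  [DiscreteMeasurableSpace S] [MeasurableSpace A] [DiscreteMeasurableSpace A]

/-- `m` episodes suffice to find, with probability at least `1 - δ`, a set of policies and
`ε`-accurate estimates of their values, such that mixtures of these policies come `ε`-close to the
values of all mixtures. The rewards are read off from the samples through the quantizer `q` and the
table `ρ`. -/
def ValueLearning {d : ℕ} (ρ : ℕ → Vec d) (m : ℕ) (ε δ : ℝ) : Prop :=
  ∃ (pol : List (Traj S A ℕ H) → Policy S A H) (fam : List (Traj S A ℕ H) → Set (Policy S A H))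
    (est : List (Traj S A ℕ H) → Policy S A H → Vec d),
    (∀ l, StronglyMeasurable (est l)) ∧ (∀ l π, ‖est l π‖ ≤ H) ∧
    ∀ {O : Type} [MeasurableSpace O] {q : O → ℕ} (hq : Measurable q) (M : Env S A O H)
      (out : List (Traj S A ℕ H) → ProbabilityMeasure (Policy S A H)),
      M.runLaw (policyLearner hq pol out m) m
        {X | ¬ ((∀ π ∈ fam (hist q X), ‖est (hist q X) π -
            M.expectedSum (fun h s a => ∫ x, ρ (q x.1) ∂M.step h s a) π‖ ≤ ε) ∧
          ∀ μ : ProbabilityMeasure (Policy S A H), ∃ ν : ProbabilityMeasure (Policy S A H),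
            (∀ᵐ π ∂(ν : Measure (Policy S A H)), π ∈ fam (hist q X)) ∧
            ‖∫ π, M.expectedSum (fun h s a => ∫ x, ρ (q x.1) ∂M.step h s a) π
                ∂(ν : Measure (Policy S A H)) -
              ∫ π, M.expectedSum (fun h s a => ∫ x, ρ (q x.1) ∂M.step h s a) π
                ∂(μ : Measure (Policy S A H))‖ ≤ ε)} ≤ ENNReal.ofReal δ

variable {S A H}

lemma meanOf_obsLaw {O : Type*} [MeasurableSpace O] {d : ℕ} (ρ : ℕ → Vec d) {q : O → ℕ}
    (hq : Measurable q) (s₀ : S) (M : Env S A O H) :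
    meanOf ρ (obsLaw q s₀ M) = fun h s a => ∫ x, ρ (q x.1) ∂M.step h s a := by
  funext h s a
  have hm : Measurable fun x : ℕ × S => ρ x.1 :=
    (Measurable.of_discrete (f := ρ)).comp measurable_fst
  rw [meanOf, obsLaw, sampleLaw, integral_map (by fun_prop) hm.aestronglyMeasurable,
    integral_map (measurable_sampleLaw_map s₀ h).aemeasurable]
  · rfl
  · exact (hm.comp (by fun_prop : Measurable (Prod.map q (id : S → S)))).aestronglyMeasurable

lemma ae_mixture_mem {J : Type*} [Fintype J] (x : J → Policy S A H) (w : J → ℝ)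
    (hw : w ∈ stdSimplex ℝ J) :
    ∀ᵐ π ∂(mixture x w hw : Measure (Policy S A H)), π ∈ Set.range x := by
  have hmeas : MeasurableSet (Set.range x)ᶜ := (Set.finite_range x).measurableSet.compl
  rw [ae_iff, coe_mixture]
  change (∑ j, ENNReal.ofReal (w j) • Measure.dirac (x j)) (Set.range x)ᶜ = 0
  simp [Measure.dirac_apply' _ hmeas]

/-- The exponent in the failure probability of the estimates. -/
noncomputable def logBound (H d : ℕ) (nS nA ε δ : ℝ) : ℝ :=
  Real.log (2 * 10 ^ 6 * H * nS ^ 2 * nA / (δ * ε)) + Real.log (16 * d * H / ε + 3)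

/-- The failure probability of a single estimate. -/
noncomputable def failBound (H : ℕ) (nS nA ε δ : ℝ) : ℝ :=
  δ * ε / (2 * 10 ^ 6 * H * nS ^ 2 * nA)

variable {nS nA ε δ : ℝ}

lemma failBound_pos (hH : 0 < H) (hS : 1 ≤ nS) (hA : 1 ≤ nA) (hε : 0 < ε) (hδ : 0 < δ) :
    0 < failBound H nS nA ε δ := by
  unfold failBound; positivity

lemma log_inv_failBound :
    Real.log (2 * 10 ^ 6 * H * nS ^ 2 * nA / (δ * ε)) = -Real.log (failBound H nS nA ε δ) := by
  rw [failBound, ← Real.log_inv, inv_div]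

lemma one_le_log_base {H d : ℕ} {ε : ℝ} (hε : 0 < ε) : 1 ≤ Real.log (16 * d * H / ε + 3) := by
  rw [Real.le_log_iff_exp_le (by positivity)]
  have : (0 : ℝ) ≤ 16 * d * H / ε := by positivity
  linarith [Real.exp_one_lt_d9]

lemma log_inv_failBound_nonneg (hH : 0 < H) (hS : 1 ≤ nS) (hA : 1 ≤ nA) (hε : 0 < ε)
    (hεH : ε ≤ H) (hδ : 0 < δ) (hδ1 : δ ≤ 1) :
    0 ≤ -Real.log (failBound H nS nA ε δ) := by
  have hHp : (1 : ℝ) ≤ H := by exact_mod_cast hH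
  rw [neg_nonneg]
  refine Real.log_nonpos (failBound_pos hH hS hA hε hδ).le ?_
  rw [failBound, div_le_one (by positivity)]
  have h1 : 1 ≤ nS ^ 2 * nA := one_le_mul_of_one_le_of_one_le (one_le_pow₀ hS) hA
  nlinarith

lemma one_le_logBound {d : ℕ} (hH : 0 < H) (hS : 1 ≤ nS) (hA : 1 ≤ nA) (hε : 0 < ε) (hεH : ε ≤ H)
    (hδ : 0 < δ) (hδ1 : δ ≤ 1) : 1 ≤ logBound H d nS nA ε δ := by
  have h1 := log_inv_failBound_nonneg hH hS hA hε hεH hδ hδ1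
  have h2 := one_le_log_base (H := H) (d := d) hε
  rw [logBound, log_inv_failBound]
  linarith

lemma exp_neg_logBound_le {d : ℕ} (hH : 0 < H) (hS : 1 ≤ nS) (hA : 1 ≤ nA) (hε : 0 < ε)
    (hδ : 0 < δ) : Real.exp (-logBound H d nS nA ε δ) ≤ failBound H nS nA ε δ := by
  have h2 := one_le_log_base (H := H) (d := d) hε
  rw [← Real.le_log_iff_exp_le (failBound_pos hH hS hA hε hδ), logBound, log_inv_failBound]
  linarith

/-- The resolution of the net of directions. -/
noncomputable def netSize (H d : ℕ) (ε : ℝ) : ℕ := ⌈8 * d * H / ε⌉₊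

/-- The net has at most (2 n + 1) ^ d points and 2 n + 1 ≤ 16 d H / ε + 3. In d · `logBound` the
second logarithm, taken d times, cancels this count, and the first one leaves the failure
probability. -/
lemma card_net_mul_exp_le {d : ℕ} (hd : 1 ≤ d) (hH : 0 < H) (hS : 1 ≤ nS) (hA : 1 ≤ nA)
    (hε : 0 < ε) (hεH : ε ≤ H) (hδ : 0 < δ) (hδ1 : δ ≤ 1) :
    Fintype.card (Net d (netSize H d ε)) * Real.exp (-(d * logBound H d nS nA ε δ)) ≤
      failBound H nS nA ε δ := by
  have hdp : (1 : ℝ) ≤ d := by exact_mod_cast hd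
  have h1 : (Fintype.card (Net d (netSize H d ε)) : ℝ) ≤ (16 * d * H / ε + 3) ^ d := by
    have h2 : (netSize H d ε : ℝ) ≤ 8 * d * H / ε + 1 := (Nat.ceil_lt_add_one (by positivity)).le
    calc (Fintype.card (Net d (netSize H d ε)) : ℝ) ≤ ((2 * netSize H d ε + 1) ^ d : ℕ) := by
          exact_mod_cast card_net_le d _
      _ = (2 * (netSize H d ε : ℝ) + 1) ^ d := by push_cast; ring
      _ ≤ (16 * d * H / ε + 3) ^ d := by
          refine pow_le_pow_left₀ (by positivity) ?_ d
          have : 16 * d * H / ε = 2 * (8 * d * H / ε) := by ring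
          linarith
  have hb : (0 : ℝ) < 16 * d * H / ε + 3 := by positivity
  have h3 : (16 * d * H / ε + 3 : ℝ) ^ d = Real.exp (d * Real.log (16 * d * H / ε + 3)) := by
    rw [← Real.log_pow, Real.exp_log (by positivity)]
  have h4 := log_inv_failBound_nonneg hH hS hA hε hεH hδ hδ1
  calc _ ≤ (16 * d * H / ε + 3 : ℝ) ^ d * Real.exp (-(d * logBound H d nS nA ε δ)) := by gcongr
    _ ≤ failBound H nS nA ε δ := by
        rw [h3, ← Real.exp_add, ← Real.le_log_iff_exp_le (failBound_pos hH hS hA hε hδ), logBound,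
          log_inv_failBound]
        nlinarith

/-- Two windows, each with 88 · 8000 = 704000 against the 2 · 10 ^ 6 in `failBound`, together with
the regret events. -/
lemma fail_sum_le (hH : 0 < H) (hS : 1 ≤ nS) (hA : 1 ≤ nA) (hε : 0 < ε)
    (hεH : ε ≤ H) (hδ : 0 < δ) :
    2 * (88 * H * nS ^ 2 * nA * failBound H nS nA ε δ / (ε / 8000) + failBound H nS nA ε δ) ≤ δ := by
  have hHp : (1 : ℝ) ≤ H := by exact_mod_cast hH
  have h1 : 88 * H * nS ^ 2 * nA * failBound H nS nA ε δ / (ε / 8000) =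
      δ * (704000 / (2 * 10 ^ 6)) := by
    rw [failBound]; field_simp; norm_num
  have h2 : failBound H nS nA ε δ ≤ δ * (1 / (2 * 10 ^ 6)) := by
    rw [failBound, mul_div_assoc]
    refine mul_le_mul_of_nonneg_left ?_ hδ.le
    rw [div_le_div_iff₀ (by positivity) (by positivity)]
    have h1 : 1 ≤ nS ^ 2 * nA := one_le_mul_of_one_le_of_one_le (one_le_pow₀ hS) hA
    nlinarith
  rw [h1]
  linarith

end ValueLearning

/-! ### Learning values from two windows -/

section TwoWindows

variable {S A : Type*} {H : ℕ} [Fintype S] [Fintype A] [MeasurableSpace S]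
  [DiscreteMeasurableSpace S] [MeasurableSpace A] [DiscreteMeasurableSpace A] [Nonempty S]
  [Nonempty A]

/-- Exploration in two windows of `K` episodes. -/
noncomputable def twoWindows (s₀ : S) (D B : ℝ) (K : ℕ) (l : List (Traj S A ℕ H)) :
    Policy S A H :=
  explorePolicy s₀ D B (if l.length < K then l else l.drop K)

lemma twoWindows_fst (s₀ : S) (D B : ℝ) (K : ℕ) (l : List (Traj S A ℕ H)) (_ : 0 ≤ l.length)
    (hl : l.length < 0 + K) : twoWindows s₀ D B K l = explorePolicy s₀ D B (window 0 K l) := by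
  rw [twoWindows, if_pos (by omega), window, List.drop_zero, List.take_of_length_le (by omega)]

lemma twoWindows_snd (s₀ : S) (D B : ℝ) (K : ℕ) (l : List (Traj S A ℕ H)) (h : K ≤ l.length)
    (hl : l.length < K + K) : twoWindows s₀ D B K l = explorePolicy s₀ D B (window K K l) := by
  rw [twoWindows, if_neg (by omega), window,
    List.take_of_length_le (by rw [List.length_drop]; omega)]

/-- Values at step h + 1 are bounded by the number of remaining steps, so one-step targets stay
within the radius H of the deviation bounds. -/
lemma norm_add_le_of_le {F : Type*} [NormedAddCommGroup F] (h : Fin H) {x y : F}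
    (hx : ‖x‖ ≤ 1) (hy : ‖y‖ ≤ ((H - (h.1 + 1) : ℕ) : ℝ)) : ‖x + y‖ ≤ H := by
  refine (norm_add_le _ _).trans ((add_le_add hx hy).trans ?_)
  have : 1 + (H - (h.1 + 1)) ≤ H := by omega
  exact_mod_cast this

variable {d : ℕ} {ρ : ℕ → Vec d} {ε δ : ℝ}

lemma two_mul_slack_le {ε : ℝ} (hε : 0 < ε) : Real.exp 2 * (3 * (ε / 8000)) ≤ ε / 100 := by
  have := mul_le_mul_of_nonneg_right exp_two_le (show 0 ≤ 3 * (ε / 8000) by positivity)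
  linarith

/-- Learning the values of the policies that are optimal in the directions of a net. -/
theorem valueLearning_of_net (hH : 0 < H) (hd : 1 ≤ d) (hdS : (d : ℝ) ≤ 2 * Fintype.card S)
    (hρ : ∀ i, ‖ρ i‖ ≤ 1) (hε : 0 < ε) (hεH : ε ≤ H) (hδ : 0 < δ) (hδ1 : δ ≤ 1) :
    ValueLearning S A H ρ (2 * windowLength H (Fintype.card S) (Fintype.card A) d
      (logBound H d (Fintype.card S) (Fintype.card A) ε δ) ε) ε δ := by
  have hS : (1 : ℝ) ≤ Fintype.card S := by exact_mod_cast Fintype.card_pos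
  have hA : (1 : ℝ) ≤ Fintype.card A := by exact_mod_cast Fintype.card_pos
  have hdp : (1 : ℝ) ≤ d := by exact_mod_cast hd
  have hB := one_le_logBound (d := d) hH hS hA hε hεH hδ hδ1
  have hp := exp_neg_logBound_le (d := d) hH hS hA hε hδ
  have hΘ := card_net_mul_exp_le hd hH hS hA hε hεH hδ hδ1
  have hfail := fail_sum_le hH hS hA hε hεH hδ
  have hp0 := (failBound_pos hH hS hA hε hδ).le
  set B := logBound H d (Fintype.card S) (Fintype.card A) ε δ
  set p := failBound H (Fintype.card S) (Fintype.card A) ε δ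
  obtain ⟨hKpos, -⟩ := windowLength_spec (H := H) hH hS hA hdp hB hε
  set K := windowLength H (Fintype.card S) (Fintype.card A) d B ε with hK
  let s₀ : S := Classical.arbitrary S
  set n := netSize H d ε with hn
  have hn0 : 0 < n := Nat.ceil_pos.2 (by positivity)
  have hηn : (d : ℝ) / n * (2 * H) ≤ ε / 4 := by
    have h1 : 8 * d * H / ε ≤ (n : ℝ) := Nat.le_ceil _
    have h2 : (0 : ℝ) < n := by exact_mod_cast hn0
    rw [div_le_iff₀ hε] at h1
    rw [div_mul_eq_mul_div, div_le_iff₀ h2]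
    linarith
  let planner : S → List (Traj S A ℕ H) → Net d n → Policy S A H := fun s D θ =>
    plan s₀ (netReward n ρ θ) (pickPrefix s₀ d B (ε / 8) s (window 0 K D))
  let test : List (Traj S A ℕ H) → S → List (Traj S A ℕ H) := fun l s =>
    pickPrefix s₀ d B (ε / 8) s (window K K l)
  refine ⟨twoWindows s₀ d B K, fun l => Set.range (planner (startOf hH s₀ l) (l.take K)),
    fun l π => polVal (empTrans s₀ (test l (startOf hH s₀ l)))
      (empMean ρ s₀ (test l (startOf hH s₀ l))) π 0 (startOf hH s₀ l),
    fun l => stronglyMeasurable_polVal _ _ _ _,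
    fun l π => norm_polVal_le' (subStoch_empTrans _ _) (norm_empMean_le hρ _ _) _ _ _, ?_⟩
  intro O _ q hq M out
  have hν := isProbabilityMeasure_obsLaw M hq s₀
  have hP := subStoch_transOf hν
  have hW : ∀ π, M.expectedSum (fun h s a => ∫ x, ρ (q x.1) ∂M.step h s a) π =
      polVal (transOf (obsLaw q s₀ M)) (meanOf ρ (obsLaw q s₀ M)) π 0 M.init := fun π => by
    rw [← meanOf_obsLaw ρ hq s₀ M, expectedSum_eq_polVal hq s₀ M]
  -- First window: the tested functions are the true optimal values in the net directions, which do
  -- not depend on any data.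
  have e1 := measure_window_fail_le (K₀ := 0) hq M (twoWindows s₀ d B K) out (2 * K) (2 * K) s₀ hH
    hB hdp hdS hε hp hΘ (twoWindows_fst s₀ d B K) (by omega)
    (fun _ θ h x => netReward n ρ θ x.1 + optVal (transOf (obsLaw q s₀ M))
      (meanOf (netReward n ρ θ) (obsLaw q s₀ M)) (h + 1) x.2)
    (fun _ θ h x => norm_add_le_of_le h (norm_netReward_le hρ θ _)
      (abs_optVal_le hP (norm_meanOf_le hν (norm_netReward_le hρ θ)) _ _))
  -- Second window: the tested functions are the true values of the policies planned from the first
  -- window, fixed once that window is over.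
  have e2 := measure_window_fail_le (K₀ := K) hq M (twoWindows s₀ d B K) out (2 * K) (2 * K) s₀ hH
    hB hdp hdS hε hp hΘ (twoWindows_snd s₀ d B K) (by omega)
    (fun D θ h x => ρ x.1 + polVal (transOf (obsLaw q s₀ M))
      (meanOf ρ (obsLaw q s₀ M)) (planner M.init D θ) (h + 1) x.2)
    (fun _ θ h x => norm_add_le_of_le h (hρ _) (norm_polVal_le hP (norm_meanOf_le hν hρ) _ _ _))
  have e3 := measure_hist_init hq M hH (twoWindows s₀ d B K) out (2 * K) (2 * K)
  refine (measure_mono ?_).trans ((measure_union_le _ _).trans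
    (add_le_add ((measure_union_le _ _).trans (add_le_add e1 e2)) e3.le)) |>.trans ?_
  · intro X hX
    by_contra hc
    simp only [Set.mem_union, Set.mem_ofPred_eq, not_or, not_not] at hc
    obtain ⟨⟨⟨e, he, hes, hacc, hu⟩, ⟨e', he', hes', hacc', hu'⟩⟩, hinit⟩ := hc
    refine hX ?_
    have hs : startOf hH s₀ (hist q X) = M.init := startOf_eq hH s₀ M.init
      (List.ne_nil_of_length_pos (by rw [length_hist]; omega)) hinit
    simp only [hW, hs]
    have hwin : window 0 K (hist q X) = window 0 K ((hist q X).take K) := by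
      simp [window]
    rw [hwin] at hacc hu
    have hsl := two_mul_slack_le hε
    have hsl1 := (slack_two_le hν he hes).trans hsl
    have hsl2 := (slack_two_le hν he' hes').trans hsl
    constructor
    · rintro π ⟨θ, rfl⟩
      have := hacc'.norm_polVal_sub_le hν hρ _ (zero_le_one.trans hB) he' θ M.init
      exact this.trans (by linarith)
    · intro μ
      -- 2 (ε/8 + ε/100) ≤ ε/2, to which the resolution of the net adds ε/4.
      have hx : ∀ θ, optVal (transOf (obsLaw q s₀ M)) (meanOf (netReward n ρ θ) (obsLaw q s₀ M)) 0
          M.init - polVal (transOf (obsLaw q s₀ M)) (meanOf (netReward n ρ θ) (obsLaw q s₀ M))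
            (planner M.init ((hist q X).take K) θ) 0 M.init ≤ ε / 2 := fun θ =>
        (hacc.optVal_sub_polVal_le hν hH (netReward n ρ) (fun θ => norm_netReward_le hρ θ)
          (zero_le_one.trans hB) he θ M.init).trans (by linarith)
      obtain ⟨w, hw, hwμ⟩ := exists_mixture_near hν hn0 hρ
        (planner M.init ((hist q X).take K)) M.init (by positivity) hx
        (μ : Measure (Policy S A H))
      refine ⟨mixture _ w hw, ae_mixture_mem _ w hw, ?_⟩
      rw [integral_mixture _ w hw (stronglyMeasurable_polVal _ _ _ _)]
      exact hwμ.trans (by linarith)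
  · rw [add_zero, ← ENNReal.ofReal_add (by positivity) hp0,
      ← ENNReal.ofReal_add (by positivity) (by positivity)]
    exact ENNReal.ofReal_le_ofReal (by linarith)

/-- Learning the values of all policies. -/
theorem valueLearning_of_card (hH : 0 < H) (hρ : ∀ i, ‖ρ i‖ ≤ 1) (hε : 0 < ε) (hεH : ε ≤ H)
    (hδ : 0 < δ) (hδ1 : δ ≤ 1) :
    ValueLearning S A H ρ (2 * windowLength H (Fintype.card S) (Fintype.card A) (Fintype.card S)
      (logBound H d (Fintype.card S) (Fintype.card A) ε δ) ε) ε δ := by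
  have hS : (1 : ℝ) ≤ Fintype.card S := by exact_mod_cast Fintype.card_pos
  have hA : (1 : ℝ) ≤ Fintype.card A := by exact_mod_cast Fintype.card_pos
  have hB := one_le_logBound (d := d) hH hS hA hε hεH hδ hδ1
  have hp := exp_neg_logBound_le (d := d) hH hS hA hε hδ
  have hfail := fail_sum_le hH hS hA hε hεH hδ
  have hp0 := (failBound_pos hH hS hA hε hδ).le
  set B := logBound H d (Fintype.card S) (Fintype.card A) ε δ
  set p := failBound H (Fintype.card S) (Fintype.card A) ε δ
  -- Only the mean reward is tested; the values enter through the L¹ deviation of the frequencies,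
  -- so no union bound is needed.
  have hΘ : Fintype.card Unit * Real.exp (-(Fintype.card S * B)) ≤ p := by
    refine le_trans ?_ hp
    rw [Fintype.card_unit, Nat.cast_one, one_mul, Real.exp_le_exp]
    nlinarith
  obtain ⟨hKpos, -⟩ := windowLength_spec (H := H) hH hS hA hS hB hε
  set K := windowLength H (Fintype.card S) (Fintype.card A) (Fintype.card S) B ε with hK
  let s₀ : S := Classical.arbitrary S
  let test : List (Traj S A ℕ H) → S → List (Traj S A ℕ H) := fun l s =>
    pickPrefix s₀ (Fintype.card S) B (ε / 8) s (window K K l)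
  refine ⟨twoWindows s₀ (Fintype.card S) B K, fun _ => Set.univ,
    fun l π => polVal (empTrans s₀ (test l (startOf hH s₀ l)))
      (empMean ρ s₀ (test l (startOf hH s₀ l))) π 0 (startOf hH s₀ l),
    fun l => stronglyMeasurable_polVal _ _ _ _,
    fun l π => norm_polVal_le' (subStoch_empTrans _ _) (norm_empMean_le hρ _ _) _ _ _, ?_⟩
  intro O _ q hq M out
  have hν := isProbabilityMeasure_obsLaw M hq s₀
  have hW : ∀ π, M.expectedSum (fun h s a => ∫ x, ρ (q x.1) ∂M.step h s a) π =
      polVal (transOf (obsLaw q s₀ M)) (meanOf ρ (obsLaw q s₀ M)) π 0 M.init := fun π => by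
    rw [← meanOf_obsLaw ρ hq s₀ M, expectedSum_eq_polVal hq s₀ M]
  -- No policies have to be fixed in advance, and only the data of the second window are used.
  have e2 := measure_window_fail_le (K₀ := K) hq M (twoWindows s₀ (Fintype.card S) B K) out
    (2 * K) (2 * K) s₀ hH hB hS (by linarith) hε hp hΘ
    (twoWindows_snd s₀ (Fintype.card S) B K) (by omega) (fun _ _ _ x => ρ x.1)
    (fun _ _ _ x => (hρ _).trans (by exact_mod_cast hH))
  have e3 := measure_hist_init hq M hH (twoWindows s₀ (Fintype.card S) B K) out (2 * K) (2 * K)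
  refine (measure_mono ?_).trans ((measure_union_le _ _).trans (add_le_add e2 e3.le)) |>.trans ?_
  · intro X hX
    by_contra hc
    simp only [Set.mem_union, Set.mem_ofPred_eq, not_or, not_not] at hc
    obtain ⟨⟨e', he', hes', hacc', hu'⟩, hinit⟩ := hc
    refine hX ?_
    have hs : startOf hH s₀ (hist q X) = M.init := startOf_eq hH s₀ M.init
      (List.ne_nil_of_length_pos (by rw [length_hist]; omega)) hinit
    simp only [hW, hs]
    have hsl2 := (slack_two_le hν he' hes').trans (two_mul_slack_le hε)
    constructor
    · intro π _
      have := hacc'.norm_polVal_sub_le_of_card hν hρ (zero_le_one.trans hB) he' π M.init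
      exact this.trans (by linarith)
    · exact fun μ => ⟨μ, by simp, by simpa using hε.le⟩
  · rw [add_zero, ← ENNReal.ofReal_add (by positivity) hp0]
    refine ENNReal.ofReal_le_ofReal ?_
    have : 0 ≤ 88 * H * (Fintype.card S : ℝ) ^ 2 * Fintype.card A * p / (ε / 8000) + p := by
      positivity
    linarith

end TwoWindows

/-! ### Coding of observations -/

section Quantizer

open Classical in
/-- Vectors of norm at most `2` can be read off from a table, up to `η` and a factor `3`. -/
lemma exists_quantizer (d : ℕ) {η : ℝ} (hη : 0 < η) (hη1 : η ≤ 1) :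
    ∃ (q : Vec d → ℕ) (ρ : ℕ → Vec d), Measurable q ∧ (∀ i, ‖ρ i‖ ≤ 1) ∧
      ∀ v, ‖v‖ ≤ 2 → ‖v - (3 : ℝ) • ρ (q v)‖ ≤ η := by
  have hex : ∀ v : Vec d, ∃ n, dist v (TopologicalSpace.denseSeq (Vec d) n) < η := fun v =>
    (TopologicalSpace.denseRange_denseSeq (Vec d)).exists_dist_lt v hη
  set u := TopologicalSpace.denseSeq (Vec d)
  -- The code is the first point of a dense sequence within η. For norms at most 2 and η ≤ 1 this
  -- point has norm at most 3, so division by 3 brings it into the unit ball.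
  refine ⟨fun v => Nat.find (hex v), fun n => if ‖u n‖ ≤ 3 then (3 : ℝ)⁻¹ • u n else 0,
    measurable_find hex fun n => ?_, fun i => ?_, fun v hv => ?_⟩
  · exact measurableSet_lt (measurable_id.dist measurable_const) measurable_const
  · dsimp only
    split_ifs with h
    · rw [norm_smul, norm_inv, Real.norm_ofNat]
      linarith
    · simp
  · have h1 := Nat.find_spec (hex v)
    rw [dist_eq_norm] at h1
    have h2 : ‖u (Nat.find (hex v))‖ ≤ 3 := by
      have := norm_sub_norm_le (u (Nat.find (hex v))) v
      rw [norm_sub_rev] at this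
      linarith
    simp only [if_pos h2, smul_smul]
    rw [mul_inv_cancel₀ (by norm_num), one_smul]
    exact h1.le

end Quantizer

/-! ### Linearity and bounds for values -/

section Values

variable {S A O : Type*} {H : ℕ} [Fintype S] [Fintype A] [MeasurableSpace S]
  [DiscreteMeasurableSpace S] [MeasurableSpace A] [DiscreteMeasurableSpace A] [MeasurableSpace O]
  {F : Type*} [NormedAddCommGroup F] [NormedSpace ℝ F]

lemma norm_expectedSum_le (M : Env S A O H) {g : Fin H → S → A → F} {c : ℝ}
    (hg : ∀ h s a, ‖g h s a‖ ≤ c) (π : Policy S A H) : ‖M.expectedSum g π‖ ≤ H * c := by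
  refine (norm_integral_le_of_norm_le_const (C := H * c) (.of_forall fun τ => ?_)).trans
    (by simp)
  refine (norm_sum_le _ _).trans ((Finset.sum_le_sum fun h _ => hg h _ _).trans ?_)
  simp

lemma expectedSum_sub_smul (M : Env S A O H) (g g' : Fin H → S → A → F) (c : ℝ)
    (π : Policy S A H) :
    M.expectedSum (fun h s a => g h s a - c • g' h s a) π =
      M.expectedSum g π - c • M.expectedSum g' π := by
  simp only [Env.expectedSum, Finset.sum_sub_distrib, ← Finset.smul_sum]
  rw [← integral_smul]
  exact integral_sub (integrable_sum_visit g _) ((integrable_sum_visit g' _).smul c)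

lemma stronglyMeasurable_expectedSum [CompleteSpace F] (M : Env S A O H) (g : Fin H → S → A → F) :
    StronglyMeasurable fun π => M.expectedSum g π := by
  have h : ∀ π, M.expectedSum g π =
      polVal (fun h s a s' => (M.step h s a).real {x | x.2 = s'}) g π 0 M.init := fun π =>
    integral_trajLaw_sum M.step M.isProb _ (fun _ _ _ _ _ => rfl) g π M.init
  simp only [h]
  exact stronglyMeasurable_polVal _ _ _ _

lemma integrable_expectedSum [CompleteSpace F] (M : Env S A O H) (g : Fin H → S → A → F)
    (μ : Measure (Policy S A H)) [IsFiniteMeasure μ] :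
    Integrable (fun π => M.expectedSum g π) μ :=
  Integrable.of_bound (stronglyMeasurable_expectedSum M g).aestronglyMeasurable
    (H * ∑ h, ∑ s, ∑ a, ‖g h s a‖) (.of_forall fun π => norm_expectedSum_le M (fun h s a =>
      (Finset.single_le_sum (f := fun a => ‖g h s a‖) (fun _ _ => norm_nonneg _)
        (Finset.mem_univ a)).trans
      ((Finset.single_le_sum (f := fun s => ∑ a, ‖g h s a‖)
        (fun _ _ => Finset.sum_nonneg fun _ _ => norm_nonneg _) (Finset.mem_univ s)).trans
      (Finset.single_le_sum (f := fun h => ∑ s, ∑ a, ‖g h s a‖)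
        (fun _ _ => Finset.sum_nonneg fun _ _ => Finset.sum_nonneg fun _ _ => norm_nonneg _)
        (Finset.mem_univ h)))) π)

/-- Linear maps commute with the formation of values of mixtures. -/
lemma map_integral_expectedSum {G : Type*} [NormedAddCommGroup G] [NormedSpace ℝ G]
    [CompleteSpace F] [CompleteSpace G] (T : F →L[ℝ] G) (M : Env S A O H) (g : Fin H → S → A → F)
    (μ : Measure (Policy S A H)) [IsFiniteMeasure μ] :
    T (∫ π, M.expectedSum g π ∂μ) = ∫ π, M.expectedSum (fun h s a => T (g h s a)) π ∂μ := by
  rw [← T.integral_comp_comm (integrable_expectedSum M g μ)]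
  refine integral_congr_ae (.of_forall fun π => ?_)
  simp only [Env.expectedSum]
  rw [← T.integral_comp_comm (integrable_sum_visit g _)]
  simp only [map_sum]

end Values

/-! ### From coded rewards to the original ones -/

section Estimator

variable (S A : Type*) (H : ℕ) [Fintype S] [Fintype A] [MeasurableSpace S]
  [DiscreteMeasurableSpace S] [MeasurableSpace A] [DiscreteMeasurableSpace A]

/-- The number of episodes used to learn values in `ℝ^d`. -/
noncomputable def episodes (d : ℕ) (ε δ : ℝ) : ℕ :=
  2 * windowLength H (Fintype.card S) (Fintype.card A)
    (if (d : ℝ) ≤ 2 * Fintype.card S then (d : ℝ) else Fintype.card S)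
    (logBound H d (Fintype.card S) (Fintype.card A) ε δ) ε

variable {S A H} [Nonempty S] [Nonempty A]

lemma valueLearning_episodes {d : ℕ} {ρ : ℕ → Vec d} {ε δ : ℝ} (hH : 0 < H) (hd : 1 ≤ d)
    (hρ : ∀ i, ‖ρ i‖ ≤ 1) (hε : 0 < ε) (hεH : ε ≤ H) (hδ : 0 < δ) (hδ1 : δ ≤ 1) :
    ValueLearning S A H ρ (episodes S A H d ε δ) ε δ := by
  unfold episodes
  split_ifs with h
  · exact valueLearning_of_net hH hd h hρ hε hεH hδ hδ1
  · exact valueLearning_of_card hH hρ hε hεH hδ hδ1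

lemma one_sub_le_real_of_compl_le {Ω : Type*} [MeasurableSpace Ω] {μ : Measure Ω}
    [IsProbabilityMeasure μ] {s t : Set Ω} {δ : ℝ} (hδ : 0 ≤ δ) (hst : sᶜ ⊆ t)
    (ht : μ t ≤ ENNReal.ofReal δ) : 1 - δ ≤ μ.real s := by
  have h1 : 1 ≤ μ.real s + μ.real sᶜ := by
    have := measureReal_union_le (μ := μ) s sᶜ
    rwa [Set.union_compl_self, probReal_univ] at this
  have h2 : μ.real sᶜ ≤ δ := ENNReal.toReal_le_of_le_ofReal hδ ((measure_mono hst).trans ht)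
  linarith

/-- Values of mixtures can be learned from samples of bounded vectors. -/
theorem exists_value_estimator {O : Type} [MeasurableSpace O] {d : ℕ} (hH : 0 < H) (hd : 1 ≤ d)
    {φ : O → Vec d} (hφ : Measurable φ) {ε δ : ℝ} (hε : 0 < ε) (hεH : ε ≤ H) (hδ : 0 < δ)
    (hδ1 : δ ≤ 1) :
    ∃ (q : O → ℕ) (hq : Measurable q) (pol : List (Traj S A ℕ H) → Policy S A H)
      (cand : List (Traj S A ℕ H) → Set (ProbabilityMeasure (Policy S A H)))
      (est : List (Traj S A ℕ H) → ProbabilityMeasure (Policy S A H) → Vec d),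
      (∀ l ν, ‖est l ν‖ ≤ 3 * H) ∧
      ∀ M : Env S A O H, (∀ h s a, ∀ᵐ x ∂M.step h s a, ‖φ x.1‖ ≤ 2) →
        ∀ out (s : Set (Fin (episodes S A H d (ε / 6) δ) → Traj S A O H)),
        (∀ X, (∀ ν ∈ cand (hist q X), ‖est (hist q X) ν -
              ∫ π, M.expectedSum (fun h s a => ∫ x, φ x.1 ∂M.step h s a) π
                ∂(ν : Measure (Policy S A H))‖ ≤ ε) →
          (∀ μ : ProbabilityMeasure (Policy S A H), ∃ ν ∈ cand (hist q X),
            ‖∫ π, M.expectedSum (fun h s a => ∫ x, φ x.1 ∂M.step h s a) π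
                ∂(ν : Measure (Policy S A H)) -
              ∫ π, M.expectedSum (fun h s a => ∫ x, φ x.1 ∂M.step h s a) π
                ∂(μ : Measure (Policy S A H))‖ ≤ ε) → X ∈ s) →
        1 - δ ≤ (M.runLaw (policyLearner hq pol out (episodes S A H d (ε / 6) δ))
          (episodes S A H d (ε / 6) δ)).real s := by
  have hHp : (1 : ℝ) ≤ H := by exact_mod_cast hH
  have hη1 : ε / (4 * H) ≤ 1 := by rw [div_le_one (by positivity)]; linarith
  obtain ⟨q, ρ, hq, hρ, hqρ⟩ := exists_quantizer d (η := ε / (4 * H)) (by positivity) hη1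
  obtain ⟨pol, fam, est, hmeas, hbd, hmain⟩ := valueLearning_episodes (S := S) (A := A) hH hd hρ
    (ε := ε / 6) (by positivity) (by linarith) hδ hδ1
  have hint : ∀ l (ν : ProbabilityMeasure (Policy S A H)),
      Integrable (est l) (ν : Measure (Policy S A H)) := fun l ν =>
    Integrable.of_bound (hmeas l).aestronglyMeasurable H (.of_forall (hbd l))
  have hq' : Measurable fun o => q (φ o) := hq.comp hφ
  refine ⟨fun o => q (φ o), hq', pol,
    fun l => {ν | ∀ᵐ π ∂(ν : Measure (Policy S A H)), π ∈ fam l},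
    fun l ν => (3 : ℝ) • ∫ π, est l π ∂(ν : Measure (Policy S A H)), fun l ν => ?_, ?_⟩
  · rw [norm_smul, Real.norm_ofNat]
    have := norm_integral_le_of_norm_le_const (μ := (ν : Measure (Policy S A H)))
      (.of_forall (hbd l))
    simp only [probReal_univ, mul_one] at this
    linarith
  · intro M hM out s hs
    refine one_sub_le_real_of_compl_le hδ.le (fun X hX => ?_) (hmain hq' M out)
    intro hgood
    obtain ⟨h1, h2⟩ := hgood
    refine hX ?_
    set V : Policy S A H → Vec d := M.expectedSum (fun h s a => ∫ x, φ x.1 ∂M.step h s a) with hV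
    set W : Policy S A H → Vec d :=
      M.expectedSum (fun h s a => ∫ x, ρ (q (φ x.1)) ∂M.step h s a) with hW
    have hVW : ∀ π, ‖V π - (3 : ℝ) • W π‖ ≤ ε / 4 := by
      intro π
      -- Each of the H steps contributes a coding error of at most ε / (4 H).
      rw [hV, hW, ← expectedSum_sub_smul]
      refine (norm_expectedSum_le M (c := ε / (4 * H)) (fun h s a => ?_) π).trans
        (le_of_eq (by field_simp))
      have := M.isProb h s a
      have i1 : Integrable (fun x => φ x.1) (M.step h s a) :=
        Integrable.of_bound (hφ.comp measurable_fst).aestronglyMeasurable 2 (hM h s a)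
      have i2 : Integrable (fun x => ρ (q (φ x.1))) (M.step h s a) :=
        Integrable.of_bound ((Measurable.of_discrete (f := ρ)).comp
          (hq.comp (hφ.comp measurable_fst))).aestronglyMeasurable 1 (.of_forall fun x => hρ _)
      have i3 : Integrable (fun x => (3 : ℝ) • ρ (q (φ x.1))) (M.step h s a) := i2.smul (3 : ℝ)
      rw [← integral_smul, ← integral_sub i1 i3]
      refine (norm_integral_le_of_norm_le_const (C := ε / (4 * H)) ?_).trans (by simp)
      filter_upwards [hM h s a] with x hx using hqρ _ hx
    have iV : ∀ μ : ProbabilityMeasure (Policy S A H), Integrable V (μ : Measure _) := fun μ =>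
      integrable_expectedSum M _ _
    have iW : ∀ μ : ProbabilityMeasure (Policy S A H), Integrable W (μ : Measure _) := fun μ =>
      integrable_expectedSum M _ _
    have hVWμ : ∀ μ : ProbabilityMeasure (Policy S A H),
        ‖∫ π, V π ∂(μ : Measure _) - (3 : ℝ) • ∫ π, W π ∂(μ : Measure _)‖ ≤ ε / 4 := by
      intro μ
      have i3 : Integrable (fun π => (3 : ℝ) • W π) (μ : Measure (Policy S A H)) :=
        (iW μ).smul (3 : ℝ)
      rw [← integral_smul, ← integral_sub (iV μ) i3]
      exact (norm_integral_le_of_norm_le_const (C := ε / 4) (.of_forall hVW)).trans (by simp)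
    refine hs X (fun ν hν => ?_) fun μ => ?_
    · have e1 : ‖∫ π, est (hist (fun o => q (φ o)) X) π ∂(ν : Measure _) -
          ∫ π, W π ∂(ν : Measure _)‖ ≤ ε / 6 := by
        rw [← integral_sub (hint _ ν) (iW ν)]
        refine (norm_integral_le_of_norm_le_const (C := ε / 6) ?_).trans (by simp)
        filter_upwards [hν] with π hπ using h1 π hπ
      have e2 := hVWμ ν
      have e3 : (3 : ℝ) • ∫ π, est (hist (fun o => q (φ o)) X) π ∂(ν : Measure _) -
          ∫ π, V π ∂(ν : Measure _) =
          (3 : ℝ) • (∫ π, est (hist (fun o => q (φ o)) X) π ∂(ν : Measure _) -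
            ∫ π, W π ∂(ν : Measure _)) -
          (∫ π, V π ∂(ν : Measure _) - (3 : ℝ) • ∫ π, W π ∂(ν : Measure _)) := by
        rw [smul_sub]; abel
      rw [e3]
      refine (norm_sub_le _ _).trans ?_
      rw [norm_smul, Real.norm_ofNat]
      linarith
    · obtain ⟨ν, hν, e1 : ‖∫ π, W π ∂(ν : Measure _) - ∫ π, W π ∂(μ : Measure _)‖ ≤ ε / 6⟩ := h2 μ
      refine ⟨ν, hν, ?_⟩
      have e2 := hVWμ ν
      have e2' := hVWμ μ
      -- Coding errors ε/4 at both ends and 3 · ε/6 for the coded values: exactly ε, which explains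
      -- the accuracy ε/6 asked of the coded problem.
      have e3 : ∫ π, V π ∂(ν : Measure _) - ∫ π, V π ∂(μ : Measure _) =
          (∫ π, V π ∂(ν : Measure _) - (3 : ℝ) • ∫ π, W π ∂(ν : Measure _)) +
          (3 : ℝ) • (∫ π, W π ∂(ν : Measure _) - ∫ π, W π ∂(μ : Measure _)) -
          (∫ π, V π ∂(μ : Measure _) - (3 : ℝ) • ∫ π, W π ∂(μ : Measure _)) := by
        rw [smul_sub]; abel
      rw [e3]
      refine (norm_sub_le _ _).trans ?_
      have e4 := norm_add_le (∫ π, V π ∂(ν : Measure _) - (3 : ℝ) • ∫ π, W π ∂(ν : Measure _))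
        ((3 : ℝ) • (∫ π, W π ∂(ν : Measure _) - ∫ π, W π ∂(μ : Measure _)))
      rw [norm_smul, Real.norm_ofNat] at e4
      linarith

end Estimator

/-! ### Choice of a nearly best candidate -/

section Selection

/-- The infimum over the candidates need not be attained, so selections are made up to a small
error. -/
lemma exists_near_min {α : Type*} {F : Set α} (hF : F.Nonempty) (f : α → ℝ) {b ε : ℝ}
    (hb : ∀ x ∈ F, b ≤ f x) (hε : 0 < ε) : ∃ x ∈ F, ∀ y ∈ F, f x ≤ f y + ε := by
  obtain ⟨_, ⟨x, hx, rfl⟩, hlt⟩ := Real.lt_sInf_add_pos (hF.image f) hε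
  refine ⟨x, hx, fun y hy => hlt.le.trans ?_⟩
  gcongr
  exact csInf_le ⟨b, by rintro _ ⟨z, hz, rfl⟩; exact hb z hz⟩ ⟨y, hy, rfl⟩

lemma infDist_le_of_norm_sub_le {d : ℕ} {x y : Vec d} {ε : ℝ} (C : Set (Vec d))
    (h : ‖x - y‖ ≤ ε) : Metric.infDist x C ≤ Metric.infDist y C + ε :=
  Metric.infDist_le_infDist_add_dist.trans (by rw [dist_eq_norm]; gcongr)

end Selection

/-! ### Approachability -/

section Applications

variable {S A : Type*} [Fintype S] [Fintype A] [MeasurableSpace S] [DiscreteMeasurableSpace S]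
  [MeasurableSpace A] [DiscreteMeasurableSpace A] [Nonempty S] [Nonempty A] {H d : ℕ}

instance : Nonempty (Policy S A H) := ⟨detPolicy fun _ _ => Classical.arbitrary A⟩

instance : Nonempty (ProbabilityMeasure (Policy S A H)) :=
  ⟨⟨Measure.dirac (Classical.arbitrary _), inferInstance⟩⟩

variable (S A H d) in
/-- The number of episodes of the algorithms below. -/
noncomputable def sampleSize (ε δ : ℝ) : ℕ := episodes S A H d (min ε H / 4 / 6) (min δ 1)

/-- The learner outputs a candidate whose estimate is nearly closest to the set. Four errors η ≤ ε/4
add up: the estimate of the output, the selection, the estimate of the competing candidate, and its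
distance to the mixture it replaces. -/
theorem solvesApproachability_sampleSize (hH : 0 < H) (hd : 1 ≤ d) :
    SolvesApproachability S A H d (sampleSize S A H d) := by
  have key : ∀ (C : Set (Vec d)) (ε δ : ℝ),
      ∃ L : Learner S A (Vec d) H (sampleSize S A H d ε δ), 0 < ε → 0 < δ →
        ∀ M : VMDP S A H d, 1 - δ ≤ (M.runLaw L (sampleSize S A H d ε δ)).real
          {D | ∀ μ : ProbabilityMeasure (Policy S A H),
            Metric.infDist (M.value (L.output D)) C ≤
              Metric.infDist (M.value (μ : Measure (Policy S A H))) C + ε} := by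
    intro C ε δ
    by_cases h : 0 < ε ∧ 0 < δ
    swap
    · exact ⟨policyLearner (measurable_const (a := (0 : ℕ))) (fun _ => Classical.arbitrary _)
        (fun _ => Classical.arbitrary _) _, fun h1 h2 => absurd ⟨h1, h2⟩ h⟩
    obtain ⟨hε, hδ⟩ := h
    have hHp : (0 : ℝ) < H := by exact_mod_cast hH
    have hε1 : 0 < min ε H / 4 := by have := lt_min hε hHp; positivity
    have hε4 : 4 * (min ε H / 4) ≤ ε := by have := min_le_left ε (H : ℝ); linarith
    obtain ⟨q, hq, pol, cand, est, -, hmain⟩ := exists_value_estimator (S := S) (A := A) hH hd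
      (φ := fun x : Vec d => x) measurable_id hε1
      (by have := min_le_right ε (H : ℝ); linarith) (lt_min hδ one_pos) (min_le_right δ 1)
    set η := min ε H / 4
    refine ⟨policyLearner hq pol (fun l => Classical.epsilon fun ν => ν ∈ cand l ∧ ∀ ν' ∈ cand l,
      Metric.infDist (est l ν) C ≤ Metric.infDist (est l ν') C + η) _, fun _ _ M => ?_⟩
    refine le_trans (by have := min_le_left δ 1; linarith)
      (hmain M.toEnv (fun h s a => ?_) _ _ fun X h1 h2 μ => ?_)
    · filter_upwards [M.bounded h s a] with x hx
      linarith
    · obtain ⟨ν₀, hν₀, -⟩ := h2 μ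
      obtain ⟨hν, hmin⟩ := Classical.epsilon_spec (p := fun ν => ν ∈ cand (hist q X) ∧
        ∀ ν' ∈ cand (hist q X), Metric.infDist (est (hist q X) ν) C ≤
          Metric.infDist (est (hist q X) ν') C + η)
        (exists_near_min ⟨ν₀, hν₀⟩ (fun ν => Metric.infDist (est (hist q X) ν) C)
          (fun _ _ => Metric.infDist_nonneg) hε1)
      obtain ⟨ν', hν', hνμ⟩ := h2 μ
      have e1 := infDist_le_of_norm_sub_le C ((norm_sub_rev _ _).le.trans (h1 _ hν))
      have e2 := hmin ν' hν'
      have e3 := infDist_le_of_norm_sub_le C (h1 _ hν')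
      have e4 := infDist_le_of_norm_sub_le C hνμ
      refine (e1.trans (add_le_add_left (e2.trans (add_le_add_left (e3.trans
        (add_le_add_left e4 _)) _)) _)).trans ?_
      change Metric.infDist (M.value (μ : Measure (Policy S A H))) C + η + η + η + η ≤ _
      linarith
  choose L hL using key
  exact ⟨L, fun C _ _ ε δ hε hδ M => hL C ε δ hε hδ M⟩

/-! ### Constrained MDPs, with the cost as a further coordinate -/

/-- A return vector together with a cost. -/
noncomputable def withCost (x : Vec d × ℝ) : Vec (d + 1) :=
  WithLp.toLp 2 (Fin.snoc (α := fun _ => ℝ) (fun i => x.1 i) x.2)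

/-- The return vector. -/
noncomputable def retPart (d : ℕ) : Vec (d + 1) →L[ℝ] Vec d :=
  LinearMap.toContinuousLinearMap
    { toFun := fun v => WithLp.toLp 2 fun i => v i.castSucc
      map_add' := fun _ _ => rfl
      map_smul' := fun _ _ => rfl }

/-- The cost. -/
noncomputable def costPart (d : ℕ) : Vec (d + 1) →L[ℝ] ℝ := EuclideanSpace.proj (Fin.last d)

lemma retPart_apply (v : Vec (d + 1)) (i : Fin d) : retPart d v i = v i.castSucc := rfl

lemma retPart_withCost (x : Vec d × ℝ) : retPart d (withCost x) = x.1 := by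
  ext i
  rw [retPart_apply]
  simp [withCost]

lemma costPart_withCost (x : Vec d × ℝ) : costPart d (withCost x) = x.2 := by
  simp [costPart, withCost]

lemma norm_retPart_le (v : Vec (d + 1)) : ‖retPart d v‖ ≤ ‖v‖ := by
  rw [EuclideanSpace.norm_eq, EuclideanSpace.norm_eq]
  refine Real.sqrt_le_sqrt ?_
  rw [Fin.sum_univ_castSucc]
  simp only [retPart_apply]
  exact le_add_of_nonneg_right (by positivity)

lemma abs_costPart_le (v : Vec (d + 1)) : |costPart d v| ≤ ‖v‖ :=
  PiLp.norm_apply_le v (Fin.last d)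

lemma norm_withCost_le (x : Vec d × ℝ) : ‖withCost x‖ ≤ ‖x.1‖ + |x.2| := by
  rw [EuclideanSpace.norm_eq, Real.sqrt_le_left (by positivity), Fin.sum_univ_castSucc]
  have h : ‖x.1‖ ^ 2 = ∑ i, ‖x.1 i‖ ^ 2 := EuclideanSpace.norm_sq_eq _
  simp only [Real.norm_eq_abs] at h
  simp only [withCost, Fin.snoc_castSucc, Fin.snoc_last, Real.norm_eq_abs, ← h]
  nlinarith [norm_nonneg x.1, abs_nonneg x.2]

lemma measurable_withCost : Measurable (withCost (d := d)) := by
  refine (WithLp.measurable_toLp 2 _).comp (measurable_pi_lambda _ fun i => ?_)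
  refine Fin.lastCases ?_ (fun j => ?_) i
  · simp only [Fin.snoc_last]; fun_prop
  · simp only [Fin.snoc_castSucc]; fun_prop

/-- The values of returns and costs together. -/
noncomputable def CMDP.fullValue (M : CMDP S A H d) (μ : Measure (Policy S A H)) : Vec (d + 1) :=
  ∫ π, M.expectedSum (fun h s a => ∫ x, withCost x.1 ∂M.step h s a) π ∂μ

lemma norm_withCost_le_two (M : CMDP S A H d) (h : Fin H) (s : S) (a : A) :
    ∀ᵐ x ∂M.step h s a, ‖withCost x.1‖ ≤ 2 := by
  filter_upwards [M.bounded h s a] with x hx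
  linarith [norm_withCost_le x.1]

lemma integrable_withCost (M : CMDP S A H d) (h : Fin H) (s : S) (a : A) :
    Integrable (fun x => withCost x.1) (M.step h s a) := by
  have := M.isProb h s a
  exact Integrable.of_bound (measurable_withCost.comp measurable_fst).aestronglyMeasurable 2
    (norm_withCost_le_two M h s a)

lemma retPart_fullValue (M : CMDP S A H d) (μ : Measure (Policy S A H)) [IsFiniteMeasure μ] :
    retPart d (M.fullValue μ) = M.value μ := by
  rw [CMDP.fullValue, map_integral_expectedSum, CMDP.value]
  have : (fun h s a => retPart d (∫ x, withCost x.1 ∂M.step h s a)) = M.ret := by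
    funext h s a
    rw [← (retPart d).integral_comp_comm (integrable_withCost M h s a), CMDP.ret]
    simp only [retPart_withCost]
  rw [this]

lemma costPart_fullValue (M : CMDP S A H d) (μ : Measure (Policy S A H)) [IsFiniteMeasure μ] :
    costPart d (M.fullValue μ) = M.costValue μ := by
  rw [CMDP.fullValue, map_integral_expectedSum, CMDP.costValue]
  have : (fun h s a => costPart d (∫ x, withCost x.1 ∂M.step h s a)) = M.cost := by
    funext h s a
    rw [← (costPart d).integral_comp_comm (integrable_withCost M h s a), CMDP.cost]
    simp only [costPart_withCost]
  rw [this]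

/-- Returns and costs are learned together as vectors in dimension d + 1. The output nearly
minimises the estimated cost among candidates whose estimated return is close to the set. -/
theorem solvesCMDP_sampleSize (hH : 0 < H) :
    SolvesCMDP S A H d (sampleSize S A H (d + 1)) := by
  have key : ∀ (C : Set (Vec d)) (ε δ : ℝ),
      ∃ L : Learner S A (Vec d × ℝ) H (sampleSize S A H (d + 1) ε δ), 0 < ε → 0 < δ →
        ∀ M : CMDP S A H d,
        (∃ μ : ProbabilityMeasure (Policy S A H), M.value (μ : Measure (Policy S A H)) ∈ C) →
        1 - δ ≤ (M.runLaw L (sampleSize S A H (d + 1) ε δ)).real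
          {D | (∀ μ : ProbabilityMeasure (Policy S A H),
              M.value (μ : Measure (Policy S A H)) ∈ C →
                M.costValue (L.output D) - M.costValue (μ : Measure (Policy S A H)) ≤ ε) ∧
            Metric.infDist (M.value (L.output D)) C ≤ ε} := by
    intro C ε δ
    by_cases h : 0 < ε ∧ 0 < δ
    swap
    · exact ⟨policyLearner (measurable_const (a := (0 : ℕ))) (fun _ => Classical.arbitrary _)
        (fun _ => Classical.arbitrary _) _, fun h1 h2 => absurd ⟨h1, h2⟩ h⟩
    obtain ⟨hε, hδ⟩ := h
    have hHp : (0 : ℝ) < H := by exact_mod_cast hH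
    have hε1 : 0 < min ε H / 4 := by have := lt_min hε hHp; positivity
    have hε4 : 4 * (min ε H / 4) ≤ ε := by have := min_le_left ε (H : ℝ); linarith
    obtain ⟨q, hq, pol, cand, est, hbd, hmain⟩ := exists_value_estimator (S := S) (A := A) hH
      (Nat.le_add_left 1 d) measurable_withCost hε1
      (by have := min_le_right ε (H : ℝ); linarith) (lt_min hδ one_pos) (min_le_right δ 1)
    set η := min ε H / 4
    -- The tolerance 2 η (one η for replacing a mixture by a candidate, one for the estimate) keeps
    -- a competitor for every feasible mixture. The output is then within 3 η of the set, and its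
    -- cost exceeds the optimum by at most 4 η.
    let feas : List (Traj S A ℕ H) → Set (ProbabilityMeasure (Policy S A H)) := fun l =>
      {ν | ν ∈ cand l ∧ Metric.infDist (retPart d (est l ν)) C ≤ 2 * η}
    refine ⟨policyLearner hq pol (fun l => Classical.epsilon fun ν => ν ∈ feas l ∧ ∀ ν' ∈ feas l,
      costPart d (est l ν) ≤ costPart d (est l ν') + η) _, fun _ _ M ⟨μ₀, hμ₀⟩ => ?_⟩
    refine le_trans (by have := min_le_left δ 1; linarith)
      (hmain M.toEnv (norm_withCost_le_two M) _ _ fun X h1 h2 => ?_)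
    have h1' : ∀ ν ∈ cand (hist q X), ‖est (hist q X) ν - M.fullValue ν‖ ≤ η := h1
    have hr : ∀ ν ∈ cand (hist q X),
        ‖retPart d (est (hist q X) ν) - M.value (ν : Measure _)‖ ≤ η := fun ν hν => by
      rw [← retPart_fullValue, ← map_sub]
      exact (norm_retPart_le _).trans (h1' ν hν)
    have hc : ∀ ν ∈ cand (hist q X),
        |costPart d (est (hist q X) ν) - M.costValue (ν : Measure _)| ≤ η := fun ν hν => by
      rw [← costPart_fullValue, ← map_sub]
      exact (abs_costPart_le _).trans (h1' ν hν)
    have hfeas : ∀ μ : ProbabilityMeasure (Policy S A H),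
        M.value (μ : Measure (Policy S A H)) ∈ C → ∃ ν ∈ feas (hist q X),
          |M.costValue (ν : Measure _) - M.costValue (μ : Measure _)| ≤ η := by
      intro μ hμ
      obtain ⟨ν, hν, hνμ⟩ := h2 μ
      have h3 : ‖M.fullValue ν - M.fullValue μ‖ ≤ η := hνμ
      refine ⟨ν, ⟨hν, ?_⟩, ?_⟩
      · have e1 := infDist_le_of_norm_sub_le C (hr ν hν)
        have e2 : ‖M.value (ν : Measure _) - M.value (μ : Measure _)‖ ≤ η := by
          rw [← retPart_fullValue, ← retPart_fullValue, ← map_sub]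
          exact (norm_retPart_le _).trans h3
        have e3 := infDist_le_of_norm_sub_le C e2
        rw [Metric.infDist_zero_of_mem hμ] at e3
        linarith
      · rw [← costPart_fullValue, ← costPart_fullValue, ← map_sub]
        exact (abs_costPart_le _).trans h3
    obtain ⟨ν₀, hν₀, -⟩ := hfeas μ₀ hμ₀
    obtain ⟨⟨hν, hνC⟩, hmin⟩ := Classical.epsilon_spec (p := fun ν => ν ∈ feas (hist q X) ∧
        ∀ ν' ∈ feas (hist q X), costPart d (est (hist q X) ν) ≤
          costPart d (est (hist q X) ν') + η)
        (exists_near_min ⟨ν₀, hν₀⟩ (fun ν => costPart d (est (hist q X) ν)) (b := -(3 * H))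
          (fun ν _ => (abs_le.1 ((abs_costPart_le _).trans (hbd _ ν))).1) hε1)
    set ν := Classical.epsilon (fun ν => ν ∈ feas (hist q X) ∧
        ∀ ν' ∈ feas (hist q X), costPart d (est (hist q X) ν) ≤
          costPart d (est (hist q X) ν') + η) with hνdef
    have hgoal : (∀ μ : ProbabilityMeasure (Policy S A H),
        M.value (μ : Measure (Policy S A H)) ∈ C →
          M.costValue (ν : Measure _) - M.costValue (μ : Measure (Policy S A H)) ≤ ε) ∧
        Metric.infDist (M.value (ν : Measure _)) C ≤ ε := by
      constructor
      · intro μ hμ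
        obtain ⟨ν', hν', hcν'⟩ := hfeas μ hμ
        have e1 := hmin ν' hν'
        have e2 := abs_le.1 (hc ν hν)
        have e3 := abs_le.1 (hc ν' hν'.1)
        have e4 := abs_le.1 hcν'
        linarith [e2.1, e3.2, e4.2]
      · have e1 := infDist_le_of_norm_sub_le C ((norm_sub_rev _ _).le.trans (hr ν hν))
        linarith
    exact hgoal
  choose L hL using key
  exact ⟨L, fun C _ ε δ hε hδ M hM => hL C ε δ hε hδ M hM⟩

/-! ### Problems with a single policy -/

section Trivial

variable [Subsingleton (Policy S A H)]

lemma integral_eq_of_subsingleton {F : Type*} [NormedAddCommGroup F] [NormedSpace ℝ F]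
    [CompleteSpace F] (f : Policy S A H → F) (μ : Measure (Policy S A H))
    [IsProbabilityMeasure μ] : ∫ π, f π ∂μ = f (Classical.arbitrary _) := by
  have : f = fun _ => f (Classical.arbitrary _) := funext fun π => by
    rw [Subsingleton.elim π (Classical.arbitrary _)]
  rw [this]
  simp

lemma solvesApproachability_zero : SolvesApproachability S A H d fun _ _ => 0 := by
  refine ⟨fun _ _ _ => policyLearner (measurable_const (a := (0 : ℕ)))
    (fun _ => Classical.arbitrary _) (fun _ => Classical.arbitrary _) _,
    fun C _ _ ε δ hε hδ M => ?_⟩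
  rw [show {D | _} = Set.univ from Set.eq_univ_of_forall fun D μ => ?_, probReal_univ]
  · linarith
  · have := (policyLearner (S := S) (A := A) (O := Vec d) (H := H)
      (measurable_const (a := (0 : ℕ))) (fun _ => Classical.arbitrary _)
      (fun _ => Classical.arbitrary _) 0).output_markov
    simp only [VMDP.value, integral_eq_of_subsingleton]
    linarith

lemma solvesCMDP_zero : SolvesCMDP S A H d fun _ _ => 0 := by
  refine ⟨fun _ _ _ => policyLearner (measurable_const (a := (0 : ℕ)))
    (fun _ => Classical.arbitrary _) (fun _ => Classical.arbitrary _) _,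
    fun C _ ε δ hε hδ M ⟨μ, hμ⟩ => ?_⟩
  rw [show {D | _} = Set.univ from Set.eq_univ_of_forall fun D => ?_, probReal_univ]
  · linarith
  · simp only [CMDP.value, CMDP.costValue, integral_eq_of_subsingleton] at hμ ⊢
    refine ⟨fun _ _ => by linarith, ?_⟩
    rw [Metric.infDist_zero_of_mem hμ]
    exact hε.le

end Trivial

end Applications

/-! ### The explicit bounds -/

section SampleComplexity

lemma log_const_le : Real.log (4 * 10 ^ 10) ≤ 36 * Real.log 2 := by
  have : (36 : ℝ) * Real.log 2 = Real.log (2 ^ 36) := by rw [Real.log_pow]; norm_num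
  rw [this]
  exact Real.log_le_log (by norm_num) (by norm_num)

variable {H d d' nS nA : ℕ} {cS cA ε δ : ℝ}

/-- Both arguments of the logarithms in `logBound` are at most a constant times a power of Y = exp
ι, the exponents being 2 and 1. As nA ≥ 2 forces Y ≥ 2, the constants are absorbed as 36 log 2 ≤ 36
ι, giving 36 + 3 = 39. -/
lemma logBound_le (hH : 0 < H) (hd : 1 ≤ d) (hd' : d' ≤ d + 1) (hcS1 : 1 ≤ cS)
    (hcS : cS ≤ nS) (hcA1 : 1 ≤ cA) (hcA : cA ≤ nA) (hA2 : 2 ≤ nA) (hε : 0 < ε) (hεH : ε ≤ H)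
    (hδ : 0 < δ) (hδ1 : δ ≤ 1) :
    Real.log 2 ≤ logFactor d nS nA H ε δ ∧ Real.log cS ≤ logFactor d nS nA H ε δ ∧
      logBound H d' cS cA (ε / 24) δ ≤ 39 * logFactor d nS nA H ε δ := by
  have hd1 : (1 : ℝ) ≤ d := by exact_mod_cast hd
  have hd2 : (d' : ℝ) ≤ 2 * d := by
    have : (d' : ℝ) ≤ d + 1 := by exact_mod_cast hd'
    linarith
  have hH1 : (1 : ℝ) ≤ H := by exact_mod_cast hH
  have hA2' : (2 : ℝ) ≤ nA := by exact_mod_cast hA2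
  have hS1 : (1 : ℝ) ≤ nS := hcS1.trans hcS
  set r : ℝ := H / (ε * δ) with hr
  have hr1 : H / ε ≤ r := by
    rw [hr]
    exact div_le_div_of_nonneg_left (by linarith) (by positivity) (by nlinarith)
  have hr0 : 1 ≤ H / ε := by rw [le_div_iff₀ hε]; linarith
  have hr2 : 1 ≤ r := hr0.trans hr1
  set Y : ℝ := d * nS * nA * r with hY
  have hXY : (d : ℝ) * nS * nA * H / (ε * δ) = Y := by rw [hY, hr, mul_div_assoc]
  have hdS : (1 : ℝ) ≤ d * nS := one_le_mul_of_one_le_of_one_le hd1 hS1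
  have hdSr : 1 ≤ d * nS * r := one_le_mul_of_one_le_of_one_le hdS hr2
  have hY2 : 2 ≤ Y := by
    calc (2 : ℝ) = 1 * 2 := by norm_num
      _ ≤ (d * nS * r) * nA := mul_le_mul hdSr hA2' (by norm_num) (by linarith)
      _ = Y := by rw [hY]; ring
  have hYS : cS ≤ Y := by
    have h1 : 1 ≤ d * nA * r :=
      one_le_mul_of_one_le_of_one_le (one_le_mul_of_one_le_of_one_le hd1 (by linarith)) hr2
    calc cS ≤ nS * 1 := by linarith
      _ ≤ nS * (d * nA * r) := by gcongr
      _ = Y := by rw [hY]; ring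
  have hι : logFactor d nS nA H ε δ = Real.log Y := by rw [logFactor, hXY]
  rw [hι]
  have hlog2 : Real.log 2 ≤ Real.log Y := Real.log_le_log (by norm_num) hY2
  refine ⟨hlog2, Real.log_le_log (by linarith) hYS, ?_⟩
  have e1 : 2 * 10 ^ 6 * H * cS ^ 2 * cA / (δ * (ε / 24)) ≤ 4.8 * 10 ^ 7 * Y ^ 2 := by
    have h1 : 2 * 10 ^ 6 * H * cS ^ 2 * cA / (δ * (ε / 24)) = 4.8 * 10 ^ 7 * (cS ^ 2 * cA * r) := by
      rw [hr]; field_simp; norm_num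
    rw [h1]
    refine mul_le_mul_of_nonneg_left ?_ (by norm_num)
    have h2 : 1 ≤ d ^ 2 * nA * r := one_le_mul_of_one_le_of_one_le
      (one_le_mul_of_one_le_of_one_le (one_le_pow₀ hd1) (by linarith)) hr2
    calc cS ^ 2 * cA * r ≤ nS ^ 2 * nA * r * 1 := by rw [mul_one]; gcongr
      _ ≤ nS ^ 2 * nA * r * (d ^ 2 * nA * r) := by gcongr
      _ = Y ^ 2 := by rw [hY]; ring
  have e2 : 16 * d' * H / (ε / 24) + 3 ≤ 771 * Y := by
    have h1 : 16 * d' * H / (ε / 24) = 384 * (d' * (H / ε)) := by field_simp; ring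
    have h2 : d' * (H / ε) ≤ 2 * Y := by
      have h3 : (1 : ℝ) ≤ nS * nA := one_le_mul_of_one_le_of_one_le hS1 (by linarith)
      calc d' * (H / ε) ≤ 2 * d * r := by gcongr
        _ = 2 * (d * r) * 1 := by ring
        _ ≤ 2 * (d * r) * (nS * nA) := by gcongr
        _ = 2 * Y := by rw [hY]; ring
    rw [h1]
    linarith
  have hb1 : (0 : ℝ) < 2 * 10 ^ 6 * H * cS ^ 2 * cA / (δ * (ε / 24)) := by positivity
  have hb2 : (0 : ℝ) < 16 * d' * H / (ε / 24) + 3 := by positivity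
  calc logBound H d' cS cA (ε / 24) δ ≤ Real.log (4.8 * 10 ^ 7 * Y ^ 2) + Real.log (771 * Y) :=
        add_le_add (Real.log_le_log hb1 e1) (Real.log_le_log hb2 e2)
    _ = Real.log (4.8 * 10 ^ 7 * 771) + 3 * Real.log Y := by
        have hY0 : Y ≠ 0 := by linarith
        rw [Real.log_mul (x := 4.8 * 10 ^ 7) (y := Y ^ 2) (by norm_num) (pow_ne_zero 2 hY0),
          Real.log_mul (x := 771) (y := Y) (by norm_num) hY0,
          Real.log_mul (x := 4.8 * 10 ^ 7) (y := 771) (by norm_num) (by norm_num), Real.log_pow]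
        push_cast
        ring
    _ ≤ 36 * Real.log 2 + 3 * Real.log Y := by
        gcongr
        exact (Real.log_le_log (by norm_num) (by norm_num)).trans log_const_le
    _ ≤ 39 * Real.log Y := by linarith

/-- The first summand is at least 1 because ε ≤ H, so it absorbs the rounding up. Since ι ≥ log 2 >
1/2, also 1 + log cS ≤ 3 ι; together with B ≤ 39 ι this turns B (1 + log cS) into a multiple of ι².
-/
lemma two_mul_windowLength_le {D B G : ℝ} (hH : 0 < H) (hcS1 : 1 ≤ cS) (hcS : cS ≤ nS)
    (hcA1 : 1 ≤ cA) (hcA : cA ≤ nA) (hε : 0 < ε) (hεH : ε ≤ H) {ι : ℝ} (hι : Real.log 2 ≤ ι)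
    (hSι : Real.log cS ≤ ι) (hB1 : 1 ≤ B) (hB : B ≤ 39 * ι) (hD : 0 ≤ D) (hDG : D ≤ 2 * G) :
    ((2 * windowLength H cS cA D B (ε / 24) : ℕ) : ℝ) ≤ 5 * 10 ^ 19 *
      (G * H ^ 4 * nS * nA * ι / ε ^ 2 + H ^ 3 * nS ^ 2 * nA * ι ^ 2 / ε) := by
  have hH1 : (1 : ℝ) ≤ H := by exact_mod_cast hH
  have hl2 := Real.log_two_gt_d9
  have hι0 : 0 < ι := by linarith
  have hls : 0 ≤ Real.log cS := Real.log_nonneg hcS1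
  have hG : 0 ≤ G := by linarith
  set a : ℝ := H ^ 3 * cS ^ 2 * cA * B * (1 + Real.log cS) / (ε / 24) with ha
  set b : ℝ := H ^ 4 * D * B * cS * cA / (ε / 24) ^ 2 with hb
  have hb0 : 0 ≤ b := by positivity
  have ha1 : 1 ≤ a := by
    rw [ha, le_div_iff₀ (by positivity)]
    have h1 : 1 ≤ cS ^ 2 * cA * B * (1 + Real.log cS) := one_le_mul_of_one_le_of_one_le
      (one_le_mul_of_one_le_of_one_le (one_le_mul_of_one_le_of_one_le (one_le_pow₀ hcS1) hcA1)
        hB1) (by linarith)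
    have h2 : (H : ℝ) ≤ H ^ 3 := le_self_pow₀ hH1 (by norm_num)
    calc 1 * (ε / 24) ≤ H * 1 := by linarith
      _ ≤ H ^ 3 * (cS ^ 2 * cA * B * (1 + Real.log cS)) := by gcongr
      _ = _ := by ring
  have hceil : (windowLength H cS cA D B (ε / 24) : ℝ) ≤ 2 * 10 ^ 14 * (a + b) + 1 :=
    (Nat.ceil_lt_add_one (by positivity)).le
  have hae : a ≤ 2808 * (H ^ 3 * nS ^ 2 * nA * ι ^ 2 / ε) := by
    calc a = 24 * (H ^ 3 * cS ^ 2 * cA * (B * (1 + Real.log cS)) / ε) := by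
          rw [ha]; field_simp
      _ ≤ 24 * (H ^ 3 * nS ^ 2 * nA * ((39 * ι) * (3 * ι)) / ε) := by
          gcongr
          linarith
      _ = _ := by ring
  have hbe : b ≤ 44928 * (G * H ^ 4 * nS * nA * ι / ε ^ 2) := by
    calc b = 576 * (H ^ 4 * D * B * cS * cA / ε ^ 2) := by
          rw [hb]; field_simp; norm_num
      _ ≤ 576 * (H ^ 4 * (2 * G) * (39 * ι) * nS * nA / ε ^ 2) := by gcongr
      _ = _ := by ring
  have h3 : 0 ≤ H ^ 3 * nS ^ 2 * nA * ι ^ 2 / ε := by positivity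
  have h4 : 0 ≤ G * H ^ 4 * nS * nA * ι / ε ^ 2 := by positivity
  push_cast
  linarith

/-- In both cases the parameter D is at most 2 min (d, nS): with the net it is d' ≤ d + 1 ≤ 2 d and
d' ≤ 2 |S|; otherwise it is |S|, and 2 |S| < d' ≤ d + 1 gives |S| ≤ d. The accuracy ε/24 comes from
ε/4 in the selection and the 1/6 from coding. -/
lemma sampleSize_le {S A : Type*} [Fintype S] [Fintype A] [Nonempty S] [Nonempty A]
    [MeasurableSpace S] [DiscreteMeasurableSpace S] [MeasurableSpace A]
    [DiscreteMeasurableSpace A] (hH : 0 < H) (hd : 1 ≤ d) (hd' : d' ≤ d + 1)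
    (hS : Fintype.card S ≤ nS) (hA : Fintype.card A ≤ nA) (hA2 : 2 ≤ nA)
    (hε : 0 < ε) (hεH : ε ≤ H) (hδ : 0 < δ) (hδ1 : δ ≤ 1) :
    Real.log 2 ≤ logFactor d nS nA H ε δ ∧
    (sampleSize S A H d' ε δ : ℝ) ≤ 5 * 10 ^ 19 *
      (min (d : ℝ) nS * H ^ 4 * nS * nA * logFactor d nS nA H ε δ / ε ^ 2 +
        H ^ 3 * nS ^ 2 * nA * logFactor d nS nA H ε δ ^ 2 / ε) := by
  have hcS1 : (1 : ℝ) ≤ Fintype.card S := by exact_mod_cast Fintype.card_pos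
  have hcA1 : (1 : ℝ) ≤ Fintype.card A := by exact_mod_cast Fintype.card_pos
  have hcS : (Fintype.card S : ℝ) ≤ nS := by exact_mod_cast hS
  have hcA : (Fintype.card A : ℝ) ≤ nA := by exact_mod_cast hA
  have hd1 : (1 : ℝ) ≤ d := by exact_mod_cast hd
  have hd2 : (d' : ℝ) ≤ d + 1 := by exact_mod_cast hd'
  obtain ⟨h1, h2, h3⟩ := logBound_le hH hd hd' hcS1 hcS hcA1 hcA hA2 hε hεH hδ hδ1
  refine ⟨h1, ?_⟩
  rw [sampleSize, episodes, min_eq_left hεH, min_eq_left hδ1, div_div,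
    show (4 : ℝ) * 6 = 24 by norm_num]
  refine two_mul_windowLength_le hH hcS1 hcS hcA1 hcA hε hεH h1 h2
    (one_le_logBound hH hcS1 hcA1 (by positivity) (by linarith) hδ hδ1) h3 ?_ ?_
  · split_ifs <;> positivity
  · rw [mul_min_of_nonneg _ _ (by norm_num : (0 : ℝ) ≤ 2)]
    split_ifs with h
    · exact le_min (by linarith) (h.trans (by linarith))
    · rw [not_le] at h
      have h4 : 2 * Fintype.card S < d' := by exact_mod_cast h
      have h5 : Fintype.card S ≤ d := by omega
      have h6 : (Fintype.card S : ℝ) ≤ d := by exact_mod_cast h5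
      exact le_min (by linarith) (by linarith)

lemma logFactor_nonneg (hd : 1 ≤ d) (hS : 1 ≤ nS) (hA : 1 ≤ nA) (hε : 0 < ε)
    (hεH : ε ≤ H) (hδ : 0 < δ) (hδ1 : δ ≤ 1) : 0 ≤ logFactor d nS nA H ε δ := by
  have hd1 : (1 : ℝ) ≤ d := by exact_mod_cast hd
  have hS1 : (1 : ℝ) ≤ nS := by exact_mod_cast hS
  have hA1 : (1 : ℝ) ≤ nA := by exact_mod_cast hA
  refine Real.log_nonneg ?_
  rw [le_div_iff₀ (by positivity)]
  have h1 := one_le_mul_of_one_le_of_one_le (one_le_mul_of_one_le_of_one_le hd1 hS1) hA1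
  nlinarith

end SampleComplexity

end ConstrainedRL

/-! ### Conclusion -/

theorem mainTheorem7 :
    ∃ c : ℝ, 0 < c ∧
      ∀ (S : Type*) (A : Type*) [Fintype S] [Fintype A] [Nonempty S] [Nonempty A]
        [MeasurableSpace S] [DiscreteMeasurableSpace S]
        [MeasurableSpace A] [DiscreteMeasurableSpace A]
        (nS nA H d : ℕ), Fintype.card S ≤ nS → Fintype.card A ≤ nA → 1 ≤ d →
        (∃ m : ℝ → ℝ → ℕ, ConstrainedRL.SolvesApproachability S A H d m ∧
          ∀ ε δ : ℝ, 0 < ε → ε ≤ H → 0 < δ → δ ≤ 1 →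
            (m ε δ : ℝ) ≤ c *
              (min (d : ℝ) (nS : ℝ) * (H : ℝ) ^ 4 * nS * nA *
                  ConstrainedRL.logFactor d nS nA H ε δ / ε ^ 2 +
                (H : ℝ) ^ 3 * (nS : ℝ) ^ 2 * nA *
                  ConstrainedRL.logFactor d nS nA H ε δ ^ 2 / ε)) ∧
        (∃ m : ℝ → ℝ → ℕ, ConstrainedRL.SolvesCMDP S A H d m ∧
          ∀ ε δ : ℝ, 0 < ε → ε ≤ H → 0 < δ → δ ≤ 1 →
            (m ε δ : ℝ) ≤ c *
              (min (d : ℝ) (nS : ℝ) * (H : ℝ) ^ 4 * nS * nA *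
                  ConstrainedRL.logFactor d nS nA H ε δ ^ 2 / ε ^ 2 +
                (H : ℝ) ^ 3 * (nS : ℝ) ^ 2 * nA *
                  ConstrainedRL.logFactor d nS nA H ε δ ^ 3 / ε)) := by
  refine ⟨10 ^ 20, by positivity, ?_⟩
  intro S A _ _ _ _ _ _ _ _ nS nA H d hS hA hd
  -- The factor ι, and with it the whole bound, can vanish, for instance when d = S = A = H = ε = δ
  -- = 1. This needs a single action; then there is only one policy and no episode is required.
  by_cases htriv : H = 0 ∨ Fintype.card A = 1
  · have hsub : Subsingleton (ConstrainedRL.Policy S A H) := by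
      rcases htriv with rfl | h1
      · infer_instance
      · have : Subsingleton A := Fintype.card_le_one_iff_subsingleton.1 h1.le
        refine ⟨fun π π' => funext fun h => funext fun s => Subtype.ext (funext fun a => ?_)⟩
        have e : ∀ π : ConstrainedRL.Policy S A H, π h s a = 1 := fun π => by
          have := ConstrainedRL.policy_sum π h s
          rwa [Fintype.sum_subsingleton _ a] at this
        exact (e π).trans (e π').symm
    have hι : ∀ ε δ : ℝ, 0 < ε → ε ≤ H → 0 < δ → δ ≤ 1 →
        0 ≤ ConstrainedRL.logFactor d nS nA H ε δ := fun ε δ hε hεH hδ hδ1 =>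
      ConstrainedRL.logFactor_nonneg hd
        (Fintype.card_pos.trans_le hS) (Fintype.card_pos.trans_le hA) hε hεH hδ hδ1
    refine ⟨⟨_, ConstrainedRL.solvesApproachability_zero, fun ε δ hε hεH hδ hδ1 => ?_⟩,
      ⟨_, ConstrainedRL.solvesCMDP_zero, fun ε δ hε hεH hδ hδ1 => ?_⟩⟩ <;>
    · have := hι ε δ hε hεH hδ hδ1
      rw [Nat.cast_zero]
      positivity
  · rw [not_or] at htriv
    have hH : 0 < H := Nat.pos_of_ne_zero htriv.1
    have hA2 : 2 ≤ nA := by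
      have : 0 < Fintype.card A := Fintype.card_pos
      omega
    refine ⟨⟨_, ConstrainedRL.solvesApproachability_sampleSize hH hd,
      fun ε δ hε hεH hδ hδ1 => ?_⟩,
      ⟨_, ConstrainedRL.solvesCMDP_sampleSize hH, fun ε δ hε hεH hδ hδ1 => ?_⟩⟩
    · obtain ⟨hι, hm⟩ := ConstrainedRL.sampleSize_le (S := S) (A := A) hH hd (Nat.le_succ d) hS hA
        hA2 hε hεH hδ hδ1
      have hι0 := (Real.log_pos one_lt_two).le.trans hι
      exact hm.trans (mul_le_mul_of_nonneg_right (by norm_num) (by positivity))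
    · obtain ⟨hι, hm⟩ := ConstrainedRL.sampleSize_le (S := S) (A := A) hH hd le_rfl hS hA
        hA2 hε hεH hδ hδ1
      have hι0 := (Real.log_pos one_lt_two).le.trans hι
      have hl2 := Real.log_two_gt_d9
      set ι := ConstrainedRL.logFactor d nS nA H ε δ
      -- ι ≥ log 2 > 1/2. The algorithm for CMDPs satisfies a bound with one factor ι fewer; the
      -- stated one follows at the price of a factor 2, which gives the constant 10 ^ 20.
      have h1 : ι ≤ 2 * ι ^ 2 := by nlinarith
      have h2 : ι ^ 2 ≤ 2 * ι ^ 3 := by nlinarith [sq_nonneg ι]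
      calc _ ≤ _ := hm
        _ ≤ 5 * 10 ^ 19 * (min (d : ℝ) nS * H ^ 4 * nS * nA * (2 * ι ^ 2) / ε ^ 2 +
            H ^ 3 * nS ^ 2 * nA * (2 * ι ^ 3) / ε) := by gcongr
        _ = _ := by ring
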